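/- **Definitions.** A graph is a pair $G=(V,E)$ of sets with $E\subseteq[V]^2$, and $N_G(v)=\{w\in V:\{v,w\}\in E\}$. A *path* is a graph $P$ with a well-ordering $\prec$ of its vertex set such that for every vertex $v$ of $P$ the set $\{w\in N_P(v): w\prec v\}$ is $\prec$-cofinal below $v$; its order type is that of $\prec$, and it is a path *of $G$* if it is a subgraph of $G$. For a set $A\subseteq V$, the path $P$ is *concentrated on $A$* if for every $\prec$-limit element $y$ of $P$ and every $x\prec y$ in $P$ there is a neighbour $z\in A$ of $y$ in $P$ with $x\preceq z\prec y$. $A$ is *$\kappa$-unseparable* if any two distinct $v,w\in A$ are joined by $\kappa$ many distinct finite paths of $G$, any two of which meet only in $v$ and $w$. $H(\Theta)$ is the family of sets whose transitive closure has size $<\Theta$. A *nice $\kappa$-chain of elementary submodels for $X$* is a sequence $(M_\alpha)_{\alpha<\mathrm{cf}(\kappa)}$ with $M_0=\emptyset$ such that, for some cardinal $\Theta$, every $M_\alpha$ with $\alpha\ge1$ is an elementary submodel of $(H(\Theta),\in)$ and, with $\kappa_\alpha=|M_\alpha|$, 1. $X\in M_\alpha$ for $1\le\alpha<\mathrm{cf}(\kappa)$,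 and $M_\alpha\cup\{M_\alpha\}\subseteq M_\beta$ for $1\le\alpha<\beta<\mathrm{cf}(\kappa)$; 2. $\kappa_{\alpha+1}\cup\{\kappa_{\alpha+1}\}\subseteq M_{\alpha+1}$ whenever $\alpha+1<\mathrm{cf}(\kappa)$; 3. $M_\beta=\bigcup_{\alpha<\beta}M_\alpha$ for every limit $\beta<\mathrm{cf}(\kappa)$; 4. if $\kappa$ is a limit cardinal, then $(\kappa_\alpha)_{\alpha<\mathrm{cf}(\kappa)}$ is a strictly increasing sequence of cardinals below $\kappa$ and every $\kappa_{\alpha+1}$ is regular; 5. if $\kappa=\lambda^+$ is a successor cardinal, then $M_\alpha\cap\kappa\in\kappa$ for all $\alpha<\mathrm{cf}(\kappa)$, and $\kappa_\alpha=\lambda$ for all $1\le\alpha<\kappa$. **Lemma 3.6.** Let $G=(V,E)$ be a graph, $\kappa\ge\omega$ a cardinal and $A\subseteq V$ with $|A|=\kappa$. Suppose that $A$ is $\kappa$-unseparable and, if $\kappa>\omega$, suppose moreover that * for each cardinal $\lambda<\kappa$ there are $\kappa$ many pairwise disjoint paths of $G$ concentrated on $A$, each of order type $\lambda$; and * there is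 a nice $\kappa$-chain $(M_\alpha)_{\alpha<\mathrm{cf}(\kappa)}$ of elementary submodels for $\{A,G\}$ with $A\subseteq\bigcup_{\alpha<\mathrm{cf}(\kappa)}M_\alpha$ such that for every $\beta<\mathrm{cf}(\kappa)$ there are $x_\beta\in A\setminus M_\beta$ and $y_\beta\in V\setminus M_\beta$ with $\{x_\beta,y_\beta\}\in E$ and $|N_G(y_\beta)\cap A\cap M_\beta\setminus M_\alpha|\ge\omega$ for all $\alpha<\beta$. Then there is a path $P$ of $G$ that is concentrated on $A$ and whose vertex set contains $A$. -/

import Mathlib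

open Cardinal

universe u

/-! ### Transfinite paths and connectivity in a graph -/

section Graphs

variable {V : Type u}

/-- A path in `G`, in the sense of Rado: a subgraph `P` of `G` together with a well-ordering `≺` of
its vertex set such that, for every vertex `v` of `P`, the `P`-neighbours of `v` that precede `v`
are `≺`-cofinal below `v`. -/
structure TransfinitePath (G : SimpleGraph V) where
  graph : G.Subgraph
  lt : graph.verts → graph.verts → Prop
  wellOrder : IsWellOrder graph.verts lt
  cofinal : ∀ u v, lt u v → ∃ w : graph.verts, graph.Adj w v ∧ lt w v ∧ ¬ lt w u

namespace TransfinitePath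

variable {G : SimpleGraph V}

/-- The set of vertices of a path. -/
def verts (P : TransfinitePath G) : Set V := P.graph.verts

/-- The order type of a path. -/
noncomputable def orderType (P : TransfinitePath G) : Ordinal.{u} :=
  haveI := P.wellOrder
  Ordinal.type P.lt

/-- `y` is a limit element of the well-order of the path `P`: it is not the first element and it
has no immediate predecessor. -/
def IsLimit (P : TransfinitePath G) (y : P.graph.verts) : Prop :=
  (∃ x, P.lt x y) ∧ ∀ x, P.lt x y → ∃ z, P.lt x z ∧ P.lt z y

/-- `P` is concentrated on `A`: for every limit element `y` of `P` and every `x ≺ y`, the vertex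
`y` has a neighbour in `A` that lies in the segment `[x, y)` of `P`. -/
def ConcentratedOn (P : TransfinitePath G) (A : Set V) : Prop :=
  ∀ y, P.IsLimit y → ∀ x, P.lt x y →
    ∃ z : P.graph.verts, P.graph.Adj z y ∧ (z : V) ∈ A ∧ ¬ P.lt z x ∧ P.lt z y

end TransfinitePath

/-- `A` is `κ`-unseparable in `G`: any two distinct points `v, w` of `A` are joined by `κ` many
(distinct) finite paths of `G`, any two of which share no vertex other than `v` and `w`. -/
def Unseparable (G : SimpleGraph V) (κ : Cardinal.{u}) (A : Set V) : Prop :=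
  ∀ v ∈ A, ∀ w ∈ A, v ≠ w → ∃ S : Set (G.Path v w), #S = κ ∧
    ∀ p ∈ S, ∀ q ∈ S, p ≠ q → ∀ z, z ∈ p.1.support → z ∈ q.1.support → z = v ∨ z = w

/-- For each cardinal `μ < κ` there are `κ` many pairwise disjoint paths of `G` concentrated on
`A`, each of order type `μ`. -/
def ManyDisjointPaths (G : SimpleGraph V) (κ : Cardinal.{u}) (A : Set V) : Prop :=
  ∀ μ < κ, ∃ (I : Type u) (P : I → TransfinitePath G), #I = κ ∧
    (∀ i j, i ≠ j → Disjoint (P i).verts (P j).verts) ∧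
    ∀ i, (P i).ConcentratedOn A ∧ (P i).orderType = μ.ord

end Graphs

/-! ### Elementary submodels of `H(Θ)` -/

/-- The relation symbols of the language of set theory: one binary symbol. -/
inductive MembershipRel : ℕ → Type
  | mem : MembershipRel 2

/-- The first-order language of set theory, with a single binary relation symbol. -/
def setLanguage : FirstOrder.Language.{0, 0} := ⟨fun _ => Empty, MembershipRel⟩

/-- `H(Θ)`: the sets whose transitive closure has fewer than `Θ` elements, that is, the sets
included in some transitive set with fewer than `Θ` elements. -/
def hereditary (Θ : Cardinal.{u}) : Set ZFSet.{u} :=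
  {x | ∃ t : ZFSet.{u}, t.IsTransitive ∧ x ⊆ t ∧ t.card < Θ}

/-- `H(Θ)` as a first-order structure, with the membership relation. -/
instance hereditaryStructure (Θ : Cardinal.{u}) : setLanguage.Structure (hereditary Θ) where
  funMap := fun f _ => nomatch f
  RelMap | .mem => fun x => (x 0 : ZFSet.{u}) ∈ (x 1 : ZFSet.{u})

/-- The set `M` is (the universe of) an elementary submodel of `(H(Θ), ∈)`. -/
def IsElementarySubmodel (Θ : Cardinal.{u}) (M : ZFSet.{u}) : Prop :=
  ∃ S : setLanguage.ElementarySubstructure (hereditary Θ),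
    ∀ x : ZFSet.{u}, x ∈ M ↔ ∃ h : x ∈ hereditary Θ, (⟨x, h⟩ : hereditary Θ) ∈ S

/-- A nice `κ`-chain `(M α)`, `α < cf κ`, of elementary submodels of `H(Θ)` for `X`.
Only the values `M α` for `α < cf κ` matter. -/
structure IsNiceChain (κ : Cardinal.{u}) (X : ZFSet.{u}) (Θ : Cardinal.{u})
    (M : Ordinal.{u} → ZFSet.{u}) : Prop where
  zero : M 0 = ∅
  elementary : ∀ α, 1 ≤ α → α < κ.ord.cof.ord → IsElementarySubmodel Θ (M α)
  mem : ∀ α, 1 ≤ α → α < κ.ord.cof.ord → X ∈ M α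
  subset_and_mem : ∀ α β, 1 ≤ α → α < β → β < κ.ord.cof.ord → M α ⊆ M β ∧ M α ∈ M β
  card_subset_and_mem : ∀ α, α + 1 < κ.ord.cof.ord →
    (M (α + 1)).card.ord.toZFSet ⊆ M (α + 1) ∧ (M (α + 1)).card.ord.toZFSet ∈ M (α + 1)
  continuous : ∀ β, Order.IsSuccLimit β → β < κ.ord.cof.ord →
    ∀ x, x ∈ M β ↔ ∃ α < β, x ∈ M α
  -- if `κ` is a limit cardinal, the cardinalities are strictly increasing below `κ`, and regular
  -- at successor indices
  of_limit : Order.IsSuccLimit κ →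
    (∀ α β, α < β → β < κ.ord.cof.ord → (M α).card < (M β).card) ∧
    (∀ α, α < κ.ord.cof.ord → (M α).card < κ) ∧
    (∀ α, α + 1 < κ.ord.cof.ord → (M (α + 1)).card.IsRegular)
  -- if `κ` is the successor of `μ`, then `M α ∩ κ ∈ κ`, and `M α` has cardinality `μ` for `1 ≤ α`
  of_succ : ∀ μ : Cardinal.{u}, κ = Order.succ μ →
    (∀ α, α < κ.ord.cof.ord → M α ∩ κ.ord.toZFSet ∈ κ.ord.toZFSet) ∧
    (∀ α, 1 ≤ α → α < κ.ord.cof.ord → (M α).card = μ)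

/-! ### Graphs as sets -/

section Coding

variable {V : Type u}

/-- The set of the labels of the elements of `A`. -/
noncomputable def codeSet (label : V ↪ ZFSet.{u}) (A : Set V) : ZFSet.{u} :=
  ZFSet.range fun a : A => label a

/-- A graph `(V, E)` as a set, for a labelling of its vertices by sets: the ordered pair of the
vertex set and the set of edges, an edge being the unordered pair of its ends. -/
noncomputable def codeGraph (label : V ↪ ZFSet.{u}) (G : SimpleGraph V) : ZFSet.{u} :=
  ZFSet.pair (codeSet label Set.univ)
    (ZFSet.range fun d : G.Dart => ({label d.fst, label d.snd} : ZFSet.{u}))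

end Coding

/-! For countable `A` a single ray suffices: enumerate `A` and keep prolonging a finite path to the
next point, along a path that avoids what has been built (`exists_ray_covering`).

For uncountable κ the chain splits `A` into stages, the parts of `A` in M (β + 1) \ M β. Each stage
is covered by a system of disjoint rays (`IsRaySystem`), and all rays are concatenated in
lexicographic order, by stage and then by index (`exists_transfinitePath_of_rays`). Only first
vertices of rays can be limits of the resulting order, so it is enough that each such vertex has
neighbours in `A` cofinally on the earlier rays. System β starts at a vertex y β. At a limit β, the
neighbours of y β in `A` reach cofinally many stages, and these stages are covered. At β = α + 1,
the last ray of system α must contain infinitely many neighbours of y β, and the system is built to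
achieve this. The edges given by the hypothesis lie merely outside M β; elementarity moves them into
M (β + 1) (`IsNiceChain.exists_isStageEdge`).

Within a stage let M be the new submodel and μ its size. If μ = ω, one ray suffices. Otherwise the
rays follow a scaffold inside M: a path r of order type μ concentrated on `A`, and an apex y with
neighbours g ξ in `A` for unboundedly many ξ < μ. Ray i > 0 starts at the first vertex of the i-th
ω-block of r and collects the `A`-vertices of this block, the vertex g i, and the i-th point of `A`
in the stage; a last ray starts at y. Thus all first vertices keep their cofinal neighbours
(`exists_raySystem_of_scaffold`). Scaffolds exist outside any small set and reflect to M. The path r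
comes from the many disjoint paths. The apex is the vertex of index μ on a path of type μ⁺ if κ is a
limit cardinal, and some y (γ + μ) if κ = μ⁺.

The connecting paths come from `IsGraphSubmodel.exists_walk_avoiding`. Of the κ many disjoint paths,
μ have one common length, so they are described by finitely many injective functions on μ. Such
functions can be found in M, their values lie in M because μ ⊆ M, and a set of fewer than μ vertices
spoils fewer than μ of the paths. -/

/-! ### Definability over `H(Θ)` with parameters in a submodel -/

section Definability

variable {Θ : Cardinal.{u}} {M : ZFSet.{u}} {ι : Type}

/-- A term over `H(Θ)`: a variable, or a parameter from `M`. -/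
def ParamTerm (Θ : Cardinal.{u}) (M : ZFSet.{u}) (t : (ι → hereditary Θ) → ZFSet.{u}) : Prop :=
  (∃ i, t = fun v => (v i : ZFSet.{u})) ∨
    ∃ c : hereditary Θ, (c : ZFSet.{u}) ∈ M ∧ t = fun _ => (c : ZFSet.{u})

/-- `P` is first-order definable over `(H(Θ), ∈)` with parameters from `M`. -/
def ParamDefinable (Θ : Cardinal.{u}) (M : ZFSet.{u}) (P : (ι → hereditary Θ) → Prop) : Prop :=
  ∃ φ : setLanguage.Formula (ι ⊕ {x : hereditary Θ // (x : ZFSet.{u}) ∈ M}),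
    ∀ v, φ.Realize (Sum.elim v Subtype.val) ↔ P v

theorem ParamTerm.var (i : ι) : ParamTerm Θ M fun v : ι → hereditary Θ => (v i : ZFSet.{u}) :=
  Or.inl ⟨i, rfl⟩

theorem IsElementarySubmodel.mem_hereditary (hM : IsElementarySubmodel Θ M) {c : ZFSet.{u}}
    (hc : c ∈ M) : c ∈ hereditary Θ := by
  obtain ⟨S, hS⟩ := hM
  exact ((hS c).1 hc).1

theorem ParamTerm.const (hM : IsElementarySubmodel Θ M) {c : ZFSet.{u}} (hc : c ∈ M) :
    ParamTerm Θ M fun _ : ι → hereditary Θ => c :=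
  Or.inr ⟨⟨c, hM.mem_hereditary hc⟩, hc, rfl⟩

theorem ParamTerm.exists_sum {t : (ι → hereditary Θ) → ZFSet.{u}} (ht : ParamTerm Θ M t) :
    ∃ j : ι ⊕ {x : hereditary Θ // (x : ZFSet.{u}) ∈ M},
      ∀ v : ι → hereditary Θ, t v = (Sum.elim v Subtype.val j : hereditary Θ) := by
  rcases ht with ⟨i, rfl⟩ | ⟨c, hc, rfl⟩
  · exact ⟨Sum.inl i, fun v => rfl⟩
  · exact ⟨Sum.inr ⟨c, hc⟩, fun v => rfl⟩

namespace ParamDefinable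

theorem mem {s t : (ι → hereditary Θ) → ZFSet.{u}} (hs : ParamTerm Θ M s)
    (ht : ParamTerm Θ M t) : ParamDefinable Θ M fun v => s v ∈ t v := by
  obtain ⟨i, hi⟩ := hs.exists_sum
  obtain ⟨j, hj⟩ := ht.exists_sum
  let R : setLanguage.Relations 2 := MembershipRel.mem
  refine ⟨R.formula₂ (FirstOrder.Language.Term.var i) (FirstOrder.Language.Term.var j),
    fun v => ?_⟩
  rw [FirstOrder.Language.Formula.realize_rel₂]
  beta_reduce
  rw [hi, hj]
  rfl

theorem eq {s t : (ι → hereditary Θ) → ZFSet.{u}} (hs : ParamTerm Θ M s)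
    (ht : ParamTerm Θ M t) : ParamDefinable Θ M fun v => s v = t v := by
  obtain ⟨i, hi⟩ := hs.exists_sum
  obtain ⟨j, hj⟩ := ht.exists_sum
  refine ⟨FirstOrder.Language.Term.equal
    (FirstOrder.Language.Term.var i) (FirstOrder.Language.Term.var j), fun v => ?_⟩
  rw [FirstOrder.Language.Formula.realize_equal]
  beta_reduce
  rw [hi, hj, ← Subtype.ext_iff]
  rfl

theorem not {P : (ι → hereditary Θ) → Prop} (hP : ParamDefinable Θ M P) :
    ParamDefinable Θ M fun v => ¬ P v := by
  obtain ⟨φ, hφ⟩ := hP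
  exact ⟨φ.not, fun v => by rw [FirstOrder.Language.Formula.realize_not, hφ]⟩

theorem and {P Q : (ι → hereditary Θ) → Prop} (hP : ParamDefinable Θ M P)
    (hQ : ParamDefinable Θ M Q) : ParamDefinable Θ M fun v => P v ∧ Q v := by
  obtain ⟨φ, hφ⟩ := hP
  obtain ⟨ψ, hψ⟩ := hQ
  exact ⟨φ ⊓ ψ, fun v => by rw [FirstOrder.Language.Formula.realize_inf, hφ, hψ]⟩

theorem congr {P Q : (ι → hereditary Θ) → Prop} (hP : ParamDefinable Θ M P)
    (h : ∀ v, P v ↔ Q v) : ParamDefinable Θ M Q := by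
  obtain ⟨φ, hφ⟩ := hP
  exact ⟨φ, fun v => (hφ v).trans (h v)⟩

theorem or {P Q : (ι → hereditary Θ) → Prop} (hP : ParamDefinable Θ M P)
    (hQ : ParamDefinable Θ M Q) : ParamDefinable Θ M fun v => P v ∨ Q v :=
  (hP.not.and hQ.not).not.congr fun v => by tauto

theorem imp {P Q : (ι → hereditary Θ) → Prop} (hP : ParamDefinable Θ M P)
    (hQ : ParamDefinable Θ M Q) : ParamDefinable Θ M fun v => P v → Q v :=
  (hP.and hQ.not).not.congr fun v => by tauto

/-- The extra index `none` stands for the bound variable; relabelling separates it from the free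
variables and the parameters. -/
theorem ex {P : hereditary Θ → (ι → hereditary Θ) → Prop}
    (hP : ParamDefinable Θ M fun w : Option ι → hereditary Θ => P (w none) fun i => w (some i)) :
    ParamDefinable Θ M fun v => ∃ x, P x v := by
  obtain ⟨φ, hφ⟩ := hP
  let f : Option ι ⊕ {x : hereditary Θ // (x : ZFSet.{u}) ∈ M} →
      (ι ⊕ {x : hereditary Θ // (x : ZFSet.{u}) ∈ M}) ⊕ Unit :=
    Sum.elim (fun o => o.elim (Sum.inr ()) fun i => Sum.inl (Sum.inl i)) fun c => Sum.inl (Sum.inr c)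
  refine ⟨(φ.relabel f).iExs Unit, fun v => ?_⟩
  rw [FirstOrder.Language.Formula.realize_iExs]
  have key : ∀ i : Unit → hereditary Θ,
      (φ.relabel f).Realize (Sum.elim (Sum.elim v Subtype.val) i) ↔ P (i ()) v := by
    intro i
    rw [FirstOrder.Language.Formula.realize_relabel]
    have := hφ fun o => o.elim (i ()) v
    refine Iff.trans (iff_of_eq (congrArg _ ?_)) this
    funext j
    rcases j with (_ | j) | j <;> rfl
  constructor
  · rintro ⟨i, hi⟩
    exact ⟨i (), (key i).1 hi⟩
  · rintro ⟨x, hx⟩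
    exact ⟨fun _ => x, (key _).2 hx⟩

theorem all {P : hereditary Θ → (ι → hereditary Θ) → Prop}
    (hP : ParamDefinable Θ M fun w : Option ι → hereditary Θ => P (w none) fun i => w (some i)) :
    ParamDefinable Θ M fun v => ∀ x, P x v :=
  (ex (P := fun x v => ¬ P x v) hP.not).not.congr fun _ => not_exists_not

end ParamDefinable

/-- The Tarski–Vaught property of an elementary submodel of `H(Θ)`. -/
theorem IsElementarySubmodel.exists_mem (hM : IsElementarySubmodel Θ M) {P : hereditary Θ → Prop}
    (hP : ParamDefinable Θ M fun v : Unit → hereditary Θ => P (v ())) (h : ∃ x, P x) :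
    ∃ x : hereditary Θ, (x : ZFSet.{u}) ∈ M ∧ P x := by
  obtain ⟨S, hS⟩ := hM
  obtain ⟨φ, hφ⟩ := hP
  have hmem : ∀ x : hereditary Θ, (x : ZFSet.{u}) ∈ M ↔ x ∈ S := by
    intro x
    rw [hS]
    exact ⟨fun ⟨_, h⟩ => h, fun h => ⟨x.2, h⟩⟩
  let e : {x : hereditary Θ // (x : ZFSet.{u}) ∈ M} → S := fun x => ⟨x.1, (hmem x.1).1 x.2⟩
  let f : Unit ⊕ {x : hereditary Θ // (x : ZFSet.{u}) ∈ M} →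
      {x : hereditary Θ // (x : ZFSet.{u}) ∈ M} ⊕ Unit := Sum.swap
  -- The existential statement passes from H(Θ) to `S`, and the witness found there is carried back
  -- to H(Θ), both times by elementarity.
  let ψ := (φ.relabel f).iExs Unit
  have h1 : ψ.Realize (fun x : {x : hereditary Θ // (x : ZFSet.{u}) ∈ M} => x.1) := by
    rw [FirstOrder.Language.Formula.realize_iExs]
    obtain ⟨x, hx⟩ := h
    refine ⟨fun _ => x, ?_⟩
    rw [FirstOrder.Language.Formula.realize_relabel]
    have := (hφ fun _ => x).2 hx
    convert this using 1
    funext j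
    rcases j with j | j <;> rfl
  have h2 : ψ.Realize e := (S.subtype.map_formula ψ e).1 h1
  rw [FirstOrder.Language.Formula.realize_iExs] at h2
  obtain ⟨i, hi⟩ := h2
  refine ⟨(i ()).1, (hmem _).2 (i ()).2, ?_⟩
  rw [← S.subtype.map_formula, FirstOrder.Language.Formula.realize_relabel] at hi
  refine (hφ fun _ => (i ()).1).1 ?_
  convert hi using 1
  funext j
  rcases j with j | j <;> rfl

end Definability

/-! ### Closure properties of `H(Θ)` -/

section Hereditary

variable {Θ : Cardinal.{u}}

theorem hereditary_of_mem {x y : ZFSet.{u}} (hy : y ∈ hereditary Θ) (h : x ∈ y) :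
    x ∈ hereditary Θ := by
  obtain ⟨t, ht, hyt, hc⟩ := hy
  exact ⟨t, ht, ht x (hyt h), hc⟩

theorem hereditary_of_subset {x y : ZFSet.{u}} (hy : y ∈ hereditary Θ) (h : x ⊆ y) :
    x ∈ hereditary Θ := by
  obtain ⟨t, ht, hyt, hc⟩ := hy
  exact ⟨t, ht, fun _ hz => hyt (h hz), hc⟩

theorem card_lt_of_hereditary {x : ZFSet.{u}} (hx : x ∈ hereditary Θ) : x.card < Θ := by
  obtain ⟨t, ht, hyt, hc⟩ := hx
  exact (ZFSet.card_mono hyt).trans_lt hc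

theorem ZFSet.card_prod_le (x y : ZFSet.{u}) : (x.prod y).card ≤ x.card * y.card := by
  rw [← Cardinal.lift_le.{u + 1}, Cardinal.lift_mul, ← ZFSet.cardinalMk_coe_sort,
    ← ZFSet.cardinalMk_coe_sort, ← ZFSet.cardinalMk_coe_sort, Cardinal.mul_def]
  refine Cardinal.mk_le_of_surjective
    (f := fun p : x × y => ⟨ZFSet.pair p.1 p.2, ZFSet.pair_mem_prod.2 ⟨p.1.2, p.2.2⟩⟩) ?_
  rintro ⟨z, hz⟩
  obtain ⟨a, ha, b, hb, rfl⟩ := ZFSet.mem_prod.1 hz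
  exact ⟨(⟨a, ha⟩, ⟨b, hb⟩), rfl⟩

theorem hereditary_union (hΘ : ℵ₀ ≤ Θ) {x y : ZFSet.{u}} (hx : x ∈ hereditary Θ)
    (hy : y ∈ hereditary Θ) : x ∪ y ∈ hereditary Θ := by
  obtain ⟨s, hs, hxs, hsc⟩ := hx
  obtain ⟨t, ht, hyt, htc⟩ := hy
  refine ⟨s ∪ t, hs.union ht, fun z hz => ?_,
    ZFSet.card_union_le.trans_lt (Cardinal.add_lt_of_lt hΘ hsc htc)⟩
  rcases ZFSet.mem_union.1 hz with h | h
  · exact ZFSet.mem_union.2 (Or.inl (hxs h))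
  · exact ZFSet.mem_union.2 (Or.inr (hyt h))

/-- A pair is {{a}, {a, b}}. Adding to a transitive t all unordered pairs of its elements and then t
× t gives a transitive set again, and for infinite Θ its size stays below Θ. -/
theorem hereditary_prod (hΘ : ℵ₀ ≤ Θ) {x y : ZFSet.{u}} (hx : x ∈ hereditary Θ)
    (hy : y ∈ hereditary Θ) : x.prod y ∈ hereditary Θ := by
  obtain ⟨t, ht, hxyt, htc⟩ := hereditary_union hΘ hx hy
  let pairs : ZFSet.{u} := ZFSet.range fun p : Shrink.{u} t × Shrink.{u} t =>
    ({((equivShrink t).symm p.1 : ZFSet.{u}), ((equivShrink t).symm p.2 : ZFSet.{u})} : ZFSet.{u})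
  have hpairs : ∀ a ∈ t, ∀ b ∈ t, ({a, b} : ZFSet.{u}) ∈ pairs := by
    intro a ha b hb
    refine ZFSet.mem_range.2 ⟨(equivShrink t ⟨a, ha⟩, equivShrink t ⟨b, hb⟩), ?_⟩
    simp
  have hpairs' : ∀ z ∈ pairs, ∃ a ∈ t, ∃ b ∈ t, z = {a, b} := by
    intro z hz
    obtain ⟨p, rfl⟩ := ZFSet.mem_range.1 hz
    exact ⟨_, Subtype.prop _, _, Subtype.prop _, rfl⟩
  refine ⟨t ∪ (pairs ∪ t.prod t), ?_, ?_, ?_⟩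
  · intro z hz w hw
    rw [ZFSet.mem_union, ZFSet.mem_union] at hz
    rw [ZFSet.mem_union, ZFSet.mem_union]
    rcases hz with hz | hz | hz
    · exact Or.inl (ht z hz hw)
    · obtain ⟨a, ha, b, hb, rfl⟩ := hpairs' z hz
      rcases ZFSet.mem_pair.1 hw with rfl | rfl
      exacts [Or.inl ha, Or.inl hb]
    · obtain ⟨a, ha, b, hb, rfl⟩ := ZFSet.mem_prod.1 hz
      rcases ZFSet.mem_pair.1 hw with rfl | rfl
      · refine Or.inr (Or.inl ?_)
        have := hpairs a ha a ha
        rwa [ZFSet.pair_eq_singleton] at this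
      · exact Or.inr (Or.inl (hpairs a ha b hb))
  · intro z hz
    obtain ⟨a, ha, b, hb, rfl⟩ := ZFSet.mem_prod.1 hz
    simp only [ZFSet.mem_union, ZFSet.pair_mem_prod]
    exact Or.inr (Or.inr ⟨hxyt (ZFSet.mem_union.2 (Or.inl ha)),
      hxyt (ZFSet.mem_union.2 (Or.inr hb))⟩)
  · have hmul : t.card * t.card < Θ := Cardinal.mul_lt_of_lt hΘ htc htc
    refine ZFSet.card_union_le.trans_lt (Cardinal.add_lt_of_lt hΘ htc
      (ZFSet.card_union_le.trans_lt (Cardinal.add_lt_of_lt hΘ ?_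
        ((ZFSet.card_prod_le _ _).trans_lt hmul))))
    refine lt_of_le_of_lt ?_ hmul
    have := ZFSet.lift_card_range_le (f := fun p : Shrink.{u} t × Shrink.{u} t =>
      ({((equivShrink t).symm p.1 : ZFSet.{u}), ((equivShrink t).symm p.2 : ZFSet.{u})} : ZFSet.{u}))
    rw [Cardinal.lift_id, Cardinal.lift_id, ← Cardinal.mul_def] at this
    exact this

theorem hereditary_upair (hΘ : ℵ₀ ≤ Θ) {x y : ZFSet.{u}} (hx : x ∈ hereditary Θ)
    (hy : y ∈ hereditary Θ) : ({x, y} : ZFSet.{u}) ∈ hereditary Θ := by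
  obtain ⟨t, ht, hxyt, htc⟩ := hereditary_union hΘ hx hy
  refine ⟨insert x (insert y t), ?_, ?_, ?_⟩
  · intro z hz w hw
    rw [ZFSet.mem_insert_iff, ZFSet.mem_insert_iff] at hz ⊢
    refine Or.inr (Or.inr ?_)
    rcases hz with rfl | rfl | hz
    · exact hxyt (ZFSet.mem_union.2 (Or.inl hw))
    · exact hxyt (ZFSet.mem_union.2 (Or.inr hw))
    · exact ht z hz hw
  · intro z hz
    rw [ZFSet.mem_insert_iff, ZFSet.mem_insert_iff]
    rcases ZFSet.mem_pair.1 hz with rfl | rfl <;> simp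
  · have h1 : (1 : Cardinal.{u}) < Θ := Cardinal.one_lt_aleph0.trans_le hΘ
    exact ZFSet.card_insert_le.trans_lt (Cardinal.add_lt_of_lt hΘ
      (ZFSet.card_insert_le.trans_lt (Cardinal.add_lt_of_lt hΘ htc h1)) h1)

namespace ParamTerm

variable {M : ZFSet.{u}} {ι κ : Type} {q : (ι → hereditary Θ) → ZFSet.{u}}

theorem comp (hq : ParamTerm Θ M q) (f : ι → κ) :
    ParamTerm Θ M fun w : κ → hereditary Θ => q fun i => w (f i) := by
  rcases hq with ⟨i, rfl⟩ | ⟨c, hc, rfl⟩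
  · exact Or.inl ⟨f i, rfl⟩
  · exact Or.inr ⟨c, hc, rfl⟩

theorem mem_hereditary (hq : ParamTerm Θ M q) (v : ι → hereditary Θ) : q v ∈ hereditary Θ := by
  rcases hq with ⟨i, rfl⟩ | ⟨c, hc, rfl⟩
  exacts [(v i).2, c.2]

end ParamTerm

namespace ParamDefinable

variable {M : ZFSet.{u}} {ι : Type} {s t r : (ι → hereditary Θ) → ZFSet.{u}}

/-- Extensionality can be tested inside H(Θ), which contains all elements of its elements. -/
theorem upair_eq (hs : ParamTerm Θ M s) (ht : ParamTerm Θ M t) (hr : ParamTerm Θ M r) :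
    ParamDefinable Θ M fun v => ({s v, t v} : ZFSet.{u}) = r v := by
  have : ParamDefinable Θ M fun v => ∀ z : hereditary Θ,
      ((z : ZFSet.{u}) ∈ r v → (z : ZFSet.{u}) = s v ∨ (z : ZFSet.{u}) = t v) ∧
      ((z : ZFSet.{u}) = s v ∨ (z : ZFSet.{u}) = t v → (z : ZFSet.{u}) ∈ r v) :=
    all (and (imp (mem (.var _) (hr.comp _)) (or (eq (.var _) (hs.comp _))
      (eq (.var _) (ht.comp _)))) (imp (or (eq (.var _) (hs.comp _)) (eq (.var _) (ht.comp _)))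
      (mem (.var _) (hr.comp _))))
  refine this.congr fun v => ⟨fun h => ?_, fun h z => ?_⟩
  · ext z
    rw [ZFSet.mem_pair]
    constructor
    · rintro (rfl | rfl)
      · exact (h ⟨_, hs.mem_hereditary v⟩).2 (Or.inl rfl)
      · exact (h ⟨_, ht.mem_hereditary v⟩).2 (Or.inr rfl)
    · intro hz
      exact (h ⟨z, hereditary_of_mem (hr.mem_hereditary v) hz⟩).1 hz
  · rw [← h]
    simp

theorem upair_mem (hΘ : ℵ₀ ≤ Θ) (hs : ParamTerm Θ M s) (ht : ParamTerm Θ M t)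
    (hr : ParamTerm Θ M r) : ParamDefinable Θ M fun v => ({s v, t v} : ZFSet.{u}) ∈ r v := by
  have key : ParamDefinable Θ M fun v => ∃ p : hereditary Θ,
      ({s v, t v} : ZFSet.{u}) = p ∧ (p : ZFSet.{u}) ∈ r v :=
    ex (and (upair_eq (hs.comp _) (ht.comp _) (.var _)) (mem (.var _) (hr.comp _)))
  refine key.congr fun v => ⟨?_, fun h => ?_⟩
  · rintro ⟨p, hp, h⟩
    rwa [← hp] at h
  · exact ⟨⟨_, hereditary_upair hΘ (hs.mem_hereditary v) (ht.mem_hereditary v)⟩, rfl, h⟩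

/-- Kuratowski's pair is unfolded into {s, s} and {s, t}; these sets are available in H(Θ) because Θ
is infinite. -/
theorem pair_mem (hΘ : ℵ₀ ≤ Θ) (hs : ParamTerm Θ M s) (ht : ParamTerm Θ M t)
    (hr : ParamTerm Θ M r) : ParamDefinable Θ M fun v => (s v).pair (t v) ∈ r v := by
  have key : ParamDefinable Θ M fun v => ∃ p q : hereditary Θ, ({s v, s v} : ZFSet.{u}) = p ∧
      ({s v, t v} : ZFSet.{u}) = q ∧ ({(p : ZFSet.{u}), (q : ZFSet.{u})} : ZFSet.{u}) ∈ r v :=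
    ex (ex (and (upair_eq ((hs.comp some).comp some) ((hs.comp some).comp some) (.var _))
      (and (upair_eq ((hs.comp some).comp some) ((ht.comp some).comp some) (.var _))
      (upair_mem hΘ (.var _) (.var _) ((hr.comp some).comp some)))))
  refine key.congr fun v => ⟨?_, fun h => ?_⟩
  · rintro ⟨p, q, hp, hq, h⟩
    rw [← hp, ← hq, ZFSet.pair_eq_singleton] at h
    exact h
  · refine ⟨⟨_, hereditary_upair hΘ (hs.mem_hereditary v) (hs.mem_hereditary v)⟩,
      ⟨_, hereditary_upair hΘ (hs.mem_hereditary v) (ht.mem_hereditary v)⟩, rfl, rfl, ?_⟩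
    simp only [ZFSet.pair_eq_singleton]
    exact h

end ParamDefinable

end Hereditary

/-! ### Relations as sets -/

/-- The set coding the relation `q` between the elements of `x` and those of `y`. -/
noncomputable def relCode (x y : ZFSet.{u}) (q : ZFSet.{u} → ZFSet.{u} → Prop) : ZFSet.{u} :=
  (x.prod y).sep fun p => ∃ a b, p = a.pair b ∧ q a b

theorem pair_mem_relCode {x y a b : ZFSet.{u}} {q : ZFSet.{u} → ZFSet.{u} → Prop} :
    a.pair b ∈ relCode x y q ↔ a ∈ x ∧ b ∈ y ∧ q a b := by
  rw [relCode, ZFSet.mem_sep, ZFSet.pair_mem_prod]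
  constructor
  · rintro ⟨⟨ha, hb⟩, a', b', h, hq⟩
    obtain ⟨rfl, rfl⟩ := ZFSet.pair_injective h
    exact ⟨ha, hb, hq⟩
  · rintro ⟨ha, hb, hq⟩
    exact ⟨⟨ha, hb⟩, a, b, rfl, hq⟩

theorem relCode_mem_hereditary {Θ : Cardinal.{u}} (hΘ : ℵ₀ ≤ Θ) {x y : ZFSet.{u}}
    (hx : x ∈ hereditary Θ) (hy : y ∈ hereditary Θ) (q : ZFSet.{u} → ZFSet.{u} → Prop) :
    relCode x y q ∈ hereditary Θ :=
  hereditary_of_subset (hereditary_prod hΘ hx hy) ZFSet.sep_subset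

theorem hereditary_of_pair_mem {Θ : Cardinal.{u}} {c a b : ZFSet.{u}} (hc : c ∈ hereditary Θ)
    (h : a.pair b ∈ c) : a ∈ hereditary Θ ∧ b ∈ hereditary Θ := by
  have h1 : ({a, b} : ZFSet.{u}) ∈ hereditary Θ :=
    hereditary_of_mem (hereditary_of_mem hc h) (ZFSet.mem_pair.2 (Or.inr rfl))
  exact ⟨hereditary_of_mem h1 (ZFSet.mem_pair.2 (Or.inl rfl)),
    hereditary_of_mem h1 (ZFSet.mem_pair.2 (Or.inr rfl))⟩

theorem toZFSet_mem_hereditary {Θ : Cardinal.{u}} {o a : Ordinal.{u}}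
    (h : o.toZFSet ∈ hereditary Θ) (ha : a < o) : a.toZFSet ∈ hereditary Θ :=
  hereditary_of_mem h (Ordinal.mem_toZFSet_iff.2 ⟨a, ha, rfl⟩)

/-! ### Codes of vertex sets and edge sets -/

section Coding

variable {V : Type u} {label : V ↪ ZFSet.{u}}

theorem mem_codeSet {A : Set V} {x : ZFSet.{u}} : x ∈ codeSet label A ↔ ∃ a ∈ A, label a = x := by
  simp [codeSet]

theorem label_mem_codeSet {A : Set V} {a : V} : label a ∈ codeSet label A ↔ a ∈ A := by
  simp [codeSet]

/-- The set of the edges of a graph. -/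
noncomputable def codeEdges (label : V ↪ ZFSet.{u}) (G : SimpleGraph V) : ZFSet.{u} :=
  ZFSet.range fun d : G.Dart => ({label d.fst, label d.snd} : ZFSet.{u})

theorem upair_mem_codeEdges {G : SimpleGraph V} {v w : V} :
    ({label v, label w} : ZFSet.{u}) ∈ codeEdges label G ↔ G.Adj v w := by
  rw [codeEdges, ZFSet.mem_range]
  constructor
  · rintro ⟨d, hd⟩
    have h1 : label d.fst ∈ ({label v, label w} : ZFSet.{u}) := by
      rw [← hd]; exact ZFSet.mem_pair.2 (Or.inl rfl)
    have h2 : label d.snd ∈ ({label v, label w} : ZFSet.{u}) := by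
      rw [← hd]; exact ZFSet.mem_pair.2 (Or.inr rfl)
    rw [ZFSet.mem_pair, label.apply_eq_iff_eq, label.apply_eq_iff_eq] at h1 h2
    have hadj := d.adj
    rcases h1 with h1 | h1 <;> rcases h2 with h2 | h2 <;> rw [h1, h2] at hadj
    · exact (G.loopless.irrefl _ hadj).elim
    · exact hadj
    · exact hadj.symm
    · exact (G.loopless.irrefl _ hadj).elim
  · intro h
    exact ⟨⟨(v, w), h⟩, rfl⟩

theorem card_codeSet (A : Set V) : (codeSet label A).card = #A := by
  rw [← Cardinal.lift_inj.{u, u + 1}, ← ZFSet.cardinalMk_coe_sort]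
  have : #(codeSet label A : Set ZFSet.{u}) = #(label '' A) := by
    congr 2
    ext x
    rw [SetLike.mem_coe, mem_codeSet]
    rfl
  refine this.trans ?_
  have h := Cardinal.mk_image_eq_lift label A label.injective
  rw [Cardinal.lift_id'.{u, u+1}] at h
  exact h

end Coding

/-! ### Closure properties of elementary submodels -/

namespace IsElementarySubmodel

variable {Θ : Cardinal.{u}} {M : ZFSet.{u}}

/-- The value is definable from c and a, so it is the witness that M provides. Functions coded in M
are evaluated in this way at arguments in M. -/
theorem value_mem (hM : IsElementarySubmodel Θ M) (hΘ : ℵ₀ ≤ Θ) {c a b : ZFSet.{u}} (hc : c ∈ M)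
    (ha : a ∈ M) (h : a.pair b ∈ c) (hu : ∀ b', a.pair b' ∈ c → b' = b) : b ∈ M := by
  have hb := (hereditary_of_pair_mem (hM.mem_hereditary hc) h).2
  obtain ⟨x, hx, hxc⟩ := hM.exists_mem (P := fun x => a.pair x ∈ c)
    (ParamDefinable.pair_mem hΘ (.const hM ha) (.var _) (.const hM hc)) ⟨⟨b, hb⟩, h⟩
  rwa [← hu _ hxc]

theorem empty_mem (hM : IsElementarySubmodel Θ M) {z : ZFSet.{u}} (hz : z ∈ M) : ∅ ∈ M := by
  have h0 : (∅ : ZFSet.{u}) ∈ hereditary Θ :=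
    hereditary_of_subset (hM.mem_hereditary hz) (ZFSet.empty_subset _)
  obtain ⟨x, hx, hxe⟩ := hM.exists_mem
    (P := fun x => ∀ y : hereditary Θ, ¬ (y : ZFSet.{u}) ∈ (x : ZFSet.{u}))
    (ParamDefinable.all (ParamDefinable.not (ParamDefinable.mem (.var _) (.var _))))
    ⟨⟨∅, h0⟩, fun y => ZFSet.notMem_empty _⟩
  have : (x : ZFSet.{u}) = ∅ := by
    rw [ZFSet.eq_empty]
    intro y hy
    exact hxe ⟨y, hereditary_of_mem x.2 hy⟩ hy
  rwa [← this]

/-- M contains some element of the pair; the other one, if there is any, is definable from the pair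
and the first. -/
theorem of_upair_mem (hM : IsElementarySubmodel Θ M) {a b : ZFSet.{u}}
    (h : ({a, b} : ZFSet.{u}) ∈ M) : a ∈ M ∧ b ∈ M := by
  have hH := hM.mem_hereditary h
  have ha : a ∈ hereditary Θ := hereditary_of_mem hH (ZFSet.mem_pair.2 (Or.inl rfl))
  have hb : b ∈ hereditary Θ := hereditary_of_mem hH (ZFSet.mem_pair.2 (Or.inr rfl))
  obtain ⟨x, hx, hxe⟩ := hM.exists_mem (P := fun x => (x : ZFSet.{u}) ∈ ({a, b} : ZFSet.{u}))
    (ParamDefinable.mem (.var _) (.const hM h)) ⟨⟨a, ha⟩, ZFSet.mem_pair.2 (Or.inl rfl)⟩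
  by_cases hab : a = b
  · subst hab
    rw [ZFSet.mem_pair, or_self] at hxe
    rw [hxe] at hx
    exact ⟨hx, hx⟩
  · have hother : ∃ y : hereditary Θ, (y : ZFSet.{u}) ∈ ({a, b} : ZFSet.{u}) ∧
        ¬ (y : ZFSet.{u}) = x := by
      rcases ZFSet.mem_pair.1 hxe with h | h
      · exact ⟨⟨b, hb⟩, by simp, fun h' => hab (h.symm.trans h'.symm)⟩
      · exact ⟨⟨a, ha⟩, by simp, fun h' => hab (h'.trans h)⟩
    obtain ⟨y, hy, hye, hyx⟩ := hM.exists_mem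
      (ParamDefinable.and (ParamDefinable.mem (.var _) (.const hM h))
        (ParamDefinable.not (ParamDefinable.eq (.var _) (.const hM hx)))) hother
    rw [ZFSet.mem_pair] at hxe hye
    rcases hxe with h1 | h1 <;> rcases hye with h2 | h2
    · exact (hyx (h2.trans h1.symm)).elim
    · rw [h1] at hx; rw [h2] at hy; exact ⟨hx, hy⟩
    · rw [h1] at hx; rw [h2] at hy; exact ⟨hy, hx⟩
    · exact (hyx (h2.trans h1.symm)).elim

theorem of_pair_mem (hM : IsElementarySubmodel Θ M) {a b : ZFSet.{u}} (h : a.pair b ∈ M) :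
    a ∈ M ∧ b ∈ M :=
  hM.of_upair_mem (hM.of_upair_mem h).2

/-- An element of a submodel including the cardinal `μ`, of size at most `μ`, is a subset. -/
theorem subset_of_card_le (hM : IsElementarySubmodel Θ M) (hΘ : ℵ₀ ≤ Θ) {μ : Cardinal.{u}}
    (hμ : μ.ord.toZFSet ∈ M) (hμ' : μ.ord.toZFSet ⊆ M) {Z : ZFSet.{u}} (hZ : Z ∈ M)
    (hc : Z.card ≤ μ) : Z ⊆ M := by
  have hle : #Z ≤ #(Set.Iio μ.ord) := by
    rw [ZFSet.cardinalMk_coe_sort, Cardinal.mk_Iio_ordinal, Cardinal.card_ord]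
    exact Cardinal.lift_le.2 hc
  obtain ⟨f⟩ := Cardinal.le_def _ _ |>.1 hle
  -- The inverse of an injection of `Z` into μ: a partial function from μ onto `Z`. Some such
  -- function lies in M, and so do its values at the ordinals below μ, since μ ⊆ M.
  let q : ZFSet.{u} → ZFSet.{u} → Prop := fun a z => ∃ h : z ∈ Z, a = (f ⟨z, h⟩ : Ordinal).toZFSet
  obtain ⟨c, hcM, hc1, hc2⟩ := hM.exists_mem (P := fun c => (∀ z : hereditary Θ, (z : ZFSet.{u}) ∈ Z →
      ∃ ξ : hereditary Θ, (ξ : ZFSet.{u}) ∈ μ.ord.toZFSet ∧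
        (ξ : ZFSet.{u}).pair z ∈ (c : ZFSet.{u})) ∧
      ∀ ξ z z' : hereditary Θ, (ξ : ZFSet.{u}).pair z ∈ (c : ZFSet.{u}) →
        (ξ : ZFSet.{u}).pair z' ∈ (c : ZFSet.{u}) → (z : ZFSet.{u}) = z')
    (by
      repeat' first
        | exact ParamTerm.var _
        | exact ParamTerm.const hM ‹_›
        | apply ParamDefinable.and
        | apply ParamDefinable.ex
        | apply ParamDefinable.all
        | apply ParamDefinable.imp
        | apply ParamDefinable.pair_mem hΘ
        | apply ParamDefinable.mem
        | apply ParamDefinable.eq)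
    ⟨⟨relCode μ.ord.toZFSet Z q, relCode_mem_hereditary hΘ (hM.mem_hereditary hμ)
      (hM.mem_hereditary hZ) q⟩, by
      refine ⟨fun z hz => ?_, fun ξ z z' h h' => ?_⟩
      · have hlt : (f ⟨z, hz⟩ : Ordinal) < μ.ord := (f ⟨z, hz⟩).2
        refine ⟨⟨(f ⟨z, hz⟩ : Ordinal).toZFSet,
          toZFSet_mem_hereditary (hM.mem_hereditary hμ) hlt⟩, ?_, ?_⟩
        · exact Ordinal.mem_toZFSet_iff.2 ⟨_, hlt, rfl⟩
        · exact pair_mem_relCode.2 ⟨Ordinal.mem_toZFSet_iff.2 ⟨_, hlt, rfl⟩, hz, hz, rfl⟩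
      · obtain ⟨-, -, hz, h1⟩ := pair_mem_relCode.1 h
        obtain ⟨-, -, hz', h2⟩ := pair_mem_relCode.1 h'
        have := f.injective (Subtype.ext (Ordinal.toZFSet_injective (h1.symm.trans h2)))
        exact Subtype.mk.inj this⟩
  intro z hz
  obtain ⟨ξ, hξ, hξz⟩ := hc1 ⟨z, hereditary_of_mem (hM.mem_hereditary hZ) hz⟩ hz
  refine hM.value_mem hΘ hcM (hμ' hξ) hξz fun b' hb' => ?_
  have := (hereditary_of_pair_mem c.2 hb').2
  exact hc2 ξ ⟨b', this⟩ _ hb' hξz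

end IsElementarySubmodel

/-! ### Submodels containing a graph -/

section GraphSubmodel

variable {V : Type u}

/-- `M` is an elementary submodel of `H(Θ)` that contains the graph `G`, the set `A` and the
infinite cardinal `μ`, and includes `μ`. -/
structure IsGraphSubmodel (G : SimpleGraph V) (label : V ↪ ZFSet.{u}) (A : Set V)
    (μ Θ : Cardinal.{u}) (M : ZFSet.{u}) : Prop where
  elementary : IsElementarySubmodel Θ M
  code_mem : ({codeSet label A, codeGraph label G} : ZFSet.{u}) ∈ M
  card_subset : μ.ord.toZFSet ⊆ M
  card_mem : μ.ord.toZFSet ∈ M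
  aleph0_le : ℵ₀ ≤ μ

namespace IsGraphSubmodel

variable {G : SimpleGraph V} {label : V ↪ ZFSet.{u}} {A : Set V} {μ Θ : Cardinal.{u}}
  {M : ZFSet.{u}}

theorem aleph0_le_bound (hM : IsGraphSubmodel G label A μ Θ M) : ℵ₀ ≤ Θ := by
  have := card_lt_of_hereditary (hM.elementary.mem_hereditary hM.card_mem)
  rw [Ordinal.card_toZFSet, Cardinal.card_ord] at this
  exact hM.aleph0_le.trans this.le

theorem codeSet_mem (hM : IsGraphSubmodel G label A μ Θ M) : codeSet label A ∈ M :=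
  (hM.elementary.of_upair_mem hM.code_mem).1

theorem codeUniv_mem (hM : IsGraphSubmodel G label A μ Θ M) :
    codeSet label (Set.univ : Set V) ∈ M :=
  (hM.elementary.of_pair_mem (hM.elementary.of_upair_mem hM.code_mem).2).1

theorem codeEdges_mem (hM : IsGraphSubmodel G label A μ Θ M) :
    codeEdges label G ∈ M :=
  (hM.elementary.of_pair_mem (hM.elementary.of_upair_mem hM.code_mem).2).2

theorem ord_mem (hM : IsGraphSubmodel G label A μ Θ M) {ξ : Ordinal.{u}} (h : ξ < μ.ord) :
    ξ.toZFSet ∈ M :=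
  hM.card_subset (Ordinal.mem_toZFSet_iff.2 ⟨ξ, h, rfl⟩)

theorem label_mem_hereditary (hM : IsGraphSubmodel G label A μ Θ M) (v : V) :
    label v ∈ hereditary Θ :=
  hereditary_of_mem (hM.elementary.mem_hereditary hM.codeUniv_mem)
    (label_mem_codeSet.2 (Set.mem_univ v))

theorem codeSet_mem_hereditary (hM : IsGraphSubmodel G label A μ Θ M) (Z : Set V) :
    codeSet label Z ∈ hereditary Θ :=
  hereditary_of_subset (hM.elementary.mem_hereditary hM.codeUniv_mem) fun x hx => by
    obtain ⟨a, -, rfl⟩ := mem_codeSet.1 hx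
    exact label_mem_codeSet.2 (Set.mem_univ a)

end IsGraphSubmodel

end GraphSubmodel

/-! ### Fans of walks coded by functions on μ -/

section Fans

variable {V : Type u}

/-- The set coding the restriction of `u` to the ordinals in `D` below `μ`. -/
noncomputable def funCode (label : V ↪ ZFSet.{u}) (μ : Cardinal.{u}) (D : Set Ordinal.{u})
    (u : Ordinal.{u} → V) : ZFSet.{u} :=
  relCode μ.ord.toZFSet (codeSet label Set.univ) fun a b =>
    ∃ ξ ∈ D, a = ξ.toZFSet ∧ b = label (u ξ)

theorem pair_mem_funCode {label : V ↪ ZFSet.{u}} {μ : Cardinal.{u}} {D : Set Ordinal.{u}}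
    {u : Ordinal.{u} → V} {a b : ZFSet.{u}} :
    a.pair b ∈ funCode label μ D u ↔
      ∃ ξ ∈ D, ξ < μ.ord ∧ a = ξ.toZFSet ∧ b = label (u ξ) := by
  rw [funCode, pair_mem_relCode]
  constructor
  · rintro ⟨ha, -, ξ, hξ, rfl, rfl⟩
    exact ⟨ξ, hξ, Ordinal.toZFSet_mem_toZFSet_iff.1 ha, rfl, rfl⟩
  · rintro ⟨ξ, hξ, hlt, rfl, rfl⟩
    exact ⟨Ordinal.toZFSet_mem_toZFSet_iff.2 hlt, label_mem_codeSet.2 (Set.mem_univ _),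
      ξ, hξ, rfl, rfl⟩

/-- `c` codes an injective function from `μ` to the vertices outside `Z`. -/
def IsInjCode {Θ : Cardinal.{u}} (label : V ↪ ZFSet.{u}) (μ : Cardinal.{u}) (Z : Set V)
    (c : hereditary Θ) : Prop :=
  (∀ ξ : hereditary Θ, (ξ : ZFSet.{u}) ∈ μ.ord.toZFSet → ∃ x : hereditary Θ,
    (x : ZFSet.{u}) ∈ codeSet label Set.univ ∧ ¬ (x : ZFSet.{u}) ∈ codeSet label Z ∧
      (ξ : ZFSet.{u}).pair x ∈ (c : ZFSet.{u})) ∧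
  (∀ ξ x y : hereditary Θ, (ξ : ZFSet.{u}).pair x ∈ (c : ZFSet.{u}) →
    (ξ : ZFSet.{u}).pair y ∈ (c : ZFSet.{u}) → (x : ZFSet.{u}) = y) ∧
  (∀ ξ η x : hereditary Θ, (ξ : ZFSet.{u}).pair x ∈ (c : ZFSet.{u}) →
    (η : ZFSet.{u}).pair x ∈ (c : ZFSet.{u}) → (ξ : ZFSet.{u}) = η)

/-- `c` codes the first of `n + 1` injective functions from `μ` to the vertices outside `Z`, such
that the values of these functions at any `ξ < μ`, followed by `w`, form a walk. -/
def IsFanCode {Θ : Cardinal.{u}} (G : SimpleGraph V) (label : V ↪ ZFSet.{u}) (μ : Cardinal.{u})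
    (Z : Set V) (w : V) : ℕ → hereditary Θ → Prop
  | 0, c => IsInjCode label μ Z c ∧ ∀ ξ x : hereditary Θ, (ξ : ZFSet.{u}) ∈ μ.ord.toZFSet →
      (ξ : ZFSet.{u}).pair x ∈ (c : ZFSet.{u}) →
      ({(x : ZFSet.{u}), label w} : ZFSet.{u}) ∈ codeEdges label G
  | n + 1, c => IsInjCode label μ Z c ∧ ∃ d : hereditary Θ, IsFanCode G label μ Z w n d ∧
      ∀ ξ x y : hereditary Θ, (ξ : ZFSet.{u}) ∈ μ.ord.toZFSet →
      (ξ : ZFSet.{u}).pair x ∈ (c : ZFSet.{u}) → (ξ : ZFSet.{u}).pair y ∈ (d : ZFSet.{u}) →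
      ({(x : ZFSet.{u}), (y : ZFSet.{u})} : ZFSet.{u}) ∈ codeEdges label G

theorem IsFanCode.isInjCode {Θ : Cardinal.{u}} {G : SimpleGraph V} {label : V ↪ ZFSet.{u}}
    {μ : Cardinal.{u}} {Z : Set V} {w : V} {n : ℕ} {c : hereditary Θ}
    (h : IsFanCode G label μ Z w n c) : IsInjCode label μ Z c := by
  cases n <;> exact h.1

namespace IsGraphSubmodel

variable {G : SimpleGraph V} {label : V ↪ ZFSet.{u}} {A : Set V} {μ Θ : Cardinal.{u}}
  {M : ZFSet.{u}}

theorem funCode_mem_hereditary (hM : IsGraphSubmodel G label A μ Θ M) (D : Set Ordinal.{u})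
    (u : Ordinal.{u} → V) : funCode label μ D u ∈ hereditary Θ :=
  relCode_mem_hereditary hM.aleph0_le_bound (hM.elementary.mem_hereditary hM.card_mem)
    (hM.elementary.mem_hereditary hM.codeUniv_mem) _

theorem isInjCode_funCode (hM : IsGraphSubmodel G label A μ Θ M) {Z : Set V}
    {u : Ordinal.{u} → V} (hu : Set.InjOn u (Set.Iio μ.ord)) (hZ : ∀ ξ < μ.ord, u ξ ∉ Z) :
    IsInjCode label μ Z
      (⟨funCode label μ Set.univ u, hM.funCode_mem_hereditary _ _⟩ : hereditary Θ) := by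
  refine ⟨fun ξ hξ => ?_, fun ξ x y hx hy => ?_, fun ξ η x hξ hη => ?_⟩
  · obtain ⟨o, ho, hoξ⟩ := Ordinal.mem_toZFSet_iff.1 hξ
    exact ⟨⟨label (u o), hM.label_mem_hereditary _⟩, label_mem_codeSet.2 (Set.mem_univ _),
      fun h => hZ o ho (label_mem_codeSet.1 h),
      pair_mem_funCode.2 ⟨o, Set.mem_univ _, ho, hoξ.symm, rfl⟩⟩
  · obtain ⟨a, -, ha, ha1, ha2⟩ := pair_mem_funCode.1 hx
    obtain ⟨b, -, hb, hb1, hb2⟩ := pair_mem_funCode.1 hy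
    obtain rfl := Ordinal.toZFSet_injective (ha1.symm.trans hb1)
    exact ha2.trans hb2.symm
  · obtain ⟨a, -, ha, ha1, ha2⟩ := pair_mem_funCode.1 hξ
    obtain ⟨b, -, hb, hb1, hb2⟩ := pair_mem_funCode.1 hη
    rw [ha1, hb1, hu ha hb (label.injective (ha2.symm.trans hb2))]

theorem paramDefinable_isInjCode (hM : IsGraphSubmodel G label A μ Θ M) {Z : Set V}
    (hZ : codeSet label Z ∈ M) {ι : Type} (i : ι) :
    ParamDefinable Θ M fun v : ι → hereditary Θ => IsInjCode label μ Z (v i) := by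
  have h1 := hM.card_mem
  have h2 := hM.codeUniv_mem
  have h3 := hM.aleph0_le_bound
  unfold IsInjCode
  -- The definability rules follow the syntax of the formula; a parameter is recognised by a
  -- hypothesis that puts it in M.
  repeat' first
    | exact ParamTerm.var _
    | exact ParamTerm.const hM.elementary ‹_›
    | apply ParamDefinable.not
    | apply ParamDefinable.and
    | apply ParamDefinable.ex
    | apply ParamDefinable.all
    | apply ParamDefinable.imp
    | apply ParamDefinable.pair_mem h3
    | apply ParamDefinable.mem
    | apply ParamDefinable.eq

/-- The number n is external to the model, so for each n the recursion unfolds to one formula and no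
coding of finite sequences is required. -/
theorem paramDefinable_isFanCode (hM : IsGraphSubmodel G label A μ Θ M) {Z : Set V}
    (hZ : codeSet label Z ∈ M) {w : V} (hw : label w ∈ M) (n : ℕ) {ι : Type} (i : ι) :
    ParamDefinable Θ M fun v : ι → hereditary Θ => IsFanCode G label μ Z w n (v i) := by
  have h1 := hM.card_mem
  have h2 := hM.codeEdges_mem
  have h3 := hM.aleph0_le_bound
  induction n generalizing ι i with
  | zero =>
    unfold IsFanCode
    refine ParamDefinable.and (hM.paramDefinable_isInjCode hZ i) ?_
    repeat' first
      | exact ParamTerm.var _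
      | exact ParamTerm.const hM.elementary ‹_›
      | apply ParamDefinable.all
      | apply ParamDefinable.imp
      | apply ParamDefinable.pair_mem h3
      | apply ParamDefinable.upair_mem h3
      | apply ParamDefinable.mem
  | succ n ih =>
    unfold IsFanCode
    refine ParamDefinable.and (hM.paramDefinable_isInjCode hZ i)
      (ParamDefinable.ex (ParamDefinable.and (ih _) ?_))
    repeat' first
      | exact ParamTerm.var _
      | exact ParamTerm.const hM.elementary ‹_›
      | apply ParamDefinable.all
      | apply ParamDefinable.imp
      | apply ParamDefinable.pair_mem h3
      | apply ParamDefinable.upair_mem h3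
      | apply ParamDefinable.mem

/-- An injective function coded in `M` maps `μ` to vertices in `M`. -/
theorem exists_decode_injCode (hM : IsGraphSubmodel G label A μ Θ M) {Z : Set V}
    {c : hereditary Θ} (hcM : (c : ZFSet.{u}) ∈ M) (hc : IsInjCode label μ Z c) :
    ∃ g : Set.Iio μ.ord → V, Function.Injective g ∧ ∀ ξ, g ξ ∉ Z ∧ label (g ξ) ∈ M ∧
      (ξ : Ordinal.{u}).toZFSet.pair (label (g ξ)) ∈ (c : ZFSet.{u}) ∧
      ∀ x : V, (ξ : Ordinal.{u}).toZFSet.pair (label x) ∈ (c : ZFSet.{u}) → x = g ξ := by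
  have hord : ∀ ξ : Set.Iio μ.ord, (ξ : Ordinal.{u}).toZFSet ∈ hereditary Θ := fun ξ =>
    hM.elementary.mem_hereditary (hM.ord_mem ξ.2)
  have : ∀ ξ : Set.Iio μ.ord, ∃ v : V, v ∉ Z ∧ label v ∈ M ∧
      (ξ : Ordinal.{u}).toZFSet.pair (label v) ∈ (c : ZFSet.{u}) := by
    intro ξ
    obtain ⟨x, hx, hxZ, hxc⟩ := hc.1 ⟨_, hord ξ⟩ (Ordinal.toZFSet_mem_toZFSet_iff.2 ξ.2)
    obtain ⟨v, -, hv⟩ := mem_codeSet.1 hx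
    rw [← hv] at hxc hxZ
    refine ⟨v, fun h => hxZ (label_mem_codeSet.2 h), ?_, hxc⟩
    refine hM.elementary.value_mem hM.aleph0_le_bound hcM (hM.ord_mem ξ.2) hxc fun b' hb' => ?_
    exact hc.2.1 ⟨_, hord ξ⟩ ⟨b', (hereditary_of_pair_mem c.2 hb').2⟩
      ⟨_, hM.label_mem_hereditary v⟩ hb' hxc
  choose g hg using this
  refine ⟨g, fun ξ η h => ?_, fun ξ => ⟨(hg ξ).1, (hg ξ).2.1, (hg ξ).2.2, fun x hx => ?_⟩⟩
  · have h1 := (hg ξ).2.2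
    have h2 := (hg η).2.2
    rw [← h] at h2
    exact Subtype.ext (Ordinal.toZFSet_injective
      (hc.2.2 ⟨_, hord ξ⟩ ⟨_, hord η⟩ ⟨_, hM.label_mem_hereditary _⟩ h1 h2))
  · exact label.injective (hc.2.1 ⟨_, hord ξ⟩ ⟨_, hM.label_mem_hereditary _⟩
      ⟨_, hM.label_mem_hereditary _⟩ hx (hg ξ).2.2)

/-- Each of the n + 1 functions is injective and thus takes values in `F` at fewer than μ arguments.
As μ is infinite, fewer than μ arguments are bad for some function of the fan. -/
theorem exists_walks_of_isFanCode (hM : IsGraphSubmodel G label A μ Θ M) {Z : Set V}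
    (hZ : codeSet label Z ∈ M) {w : V} (hw : label w ∈ M) {F : Set V} (hF : #F < μ) (n : ℕ)
    {c : hereditary Θ} (hcM : (c : ZFSet.{u}) ∈ M) (hc : IsFanCode G label μ Z w n c) :
    ∃ bad : Set (Set.Iio μ.ord), #bad < lift.{u + 1} μ ∧ ∀ ξ ∉ bad, ∀ x : V,
      (ξ : Ordinal.{u}).toZFSet.pair (label x) ∈ (c : ZFSet.{u}) →
      ∃ p : G.Walk x w, ∀ z ∈ p.support, z = w ∨ (label z ∈ M ∧ z ∉ Z ∧ z ∉ F) := by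
  obtain ⟨g, hg, hgξ⟩ := hM.exists_decode_injCode hcM hc.isInjCode
  have hord : ∀ ξ : Set.Iio μ.ord, (ξ : Ordinal.{u}).toZFSet ∈ hereditary Θ := fun ξ =>
    hM.elementary.mem_hereditary (hM.ord_mem ξ.2)
  have hbad : #(g ⁻¹' F) < lift.{u + 1} μ := by
    have := Cardinal.mk_preimage_of_injective_lift g F hg
    rw [Cardinal.lift_id'.{u, u + 1}] at this
    exact this.trans_lt (Cardinal.lift_lt.2 hF)
  induction n generalizing c g with
  | zero =>
    refine ⟨g ⁻¹' F, hbad, fun ξ hξ x hx => ?_⟩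
    obtain rfl := (hgξ ξ).2.2.2 x hx
    have hadj := upair_mem_codeEdges.1 (hc.2 ⟨_, hord ξ⟩ ⟨_, hM.label_mem_hereditary _⟩
      (Ordinal.toZFSet_mem_toZFSet_iff.2 ξ.2) hx)
    refine ⟨.cons hadj .nil, fun z hz => ?_⟩
    simp only [SimpleGraph.Walk.support_cons, SimpleGraph.Walk.support_nil, List.mem_cons,
      List.not_mem_nil, or_false] at hz
    rcases hz with rfl | rfl
    · exact Or.inr ⟨(hgξ ξ).2.1, (hgξ ξ).1, hξ⟩
    · exact Or.inl rfl
  | succ n ih =>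
    -- The remaining part of the fan is reflected anew, with `c` as a parameter, so that all its
    -- functions lie in M.
    obtain ⟨d, hdM, hd, hdc⟩ := hM.elementary.exists_mem
      (ParamDefinable.and (hM.paramDefinable_isFanCode hZ hw n _) (by
        have h1 := hM.card_mem
        have h2 := hM.codeEdges_mem
        have h3 := hM.aleph0_le_bound
        repeat' first
          | exact ParamTerm.var _
          | exact ParamTerm.const hM.elementary ‹_›
          | apply ParamDefinable.all
          | apply ParamDefinable.imp
          | apply ParamDefinable.pair_mem h3
          | apply ParamDefinable.upair_mem h3
          | apply ParamDefinable.mem)) hc.2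
    obtain ⟨g', hg', hgξ'⟩ := hM.exists_decode_injCode hdM hd.isInjCode
    have hbad' : #(g' ⁻¹' F) < lift.{u + 1} μ := by
      have := Cardinal.mk_preimage_of_injective_lift g' F hg'
      rw [Cardinal.lift_id'.{u, u + 1}] at this
      exact this.trans_lt (Cardinal.lift_lt.2 hF)
    obtain ⟨bad, hb, hbw⟩ := ih hdM hd g' hg' hgξ' hbad'
    refine ⟨bad ∪ g ⁻¹' F, (Cardinal.mk_union_le _ _).trans_lt (Cardinal.add_lt_of_lt
      (by simpa using hM.aleph0_le) hb hbad), fun ξ hξ x hx => ?_⟩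
    obtain rfl := (hgξ ξ).2.2.2 x hx
    rw [Set.mem_union, not_or] at hξ
    obtain ⟨p, hp⟩ := hbw ξ hξ.1 (g' ξ) (hgξ' ξ).2.2.1
    have hadj := upair_mem_codeEdges.1 (hdc ⟨_, hord ξ⟩ ⟨_, hM.label_mem_hereditary _⟩
      ⟨_, hM.label_mem_hereditary _⟩ (Ordinal.toZFSet_mem_toZFSet_iff.2 ξ.2) hx (hgξ' ξ).2.2.1)
    refine ⟨.cons hadj p, fun z hz => ?_⟩
    rw [SimpleGraph.Walk.support_cons, List.mem_cons] at hz
    rcases hz with rfl | hz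
    · exact Or.inr ⟨(hgξ ξ).2.1, (hgξ ξ).1, hξ.2⟩
    · exact hp z hz

/-- An actual fan takes the form that can be reflected. The recursion runs away from `w`: `u 0` is
next to `w` and `u n` farthest from it. -/
theorem isFanCode_funCode (hM : IsGraphSubmodel G label A μ Θ M) {Z : Set V} {w : V}
    {u : ℕ → Ordinal.{u} → V} (n : ℕ) (hu : ∀ k ≤ n, Set.InjOn (u k) (Set.Iio μ.ord))
    (hZ : ∀ k ≤ n, ∀ ξ < μ.ord, u k ξ ∉ Z) (h0 : ∀ ξ < μ.ord, G.Adj (u 0 ξ) w)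
    (hs : ∀ k < n, ∀ ξ < μ.ord, G.Adj (u (k + 1) ξ) (u k ξ)) :
    IsFanCode G label μ Z w n
      (⟨funCode label μ Set.univ (u n), hM.funCode_mem_hereditary _ _⟩ : hereditary Θ) := by
  induction n with
  | zero =>
    refine ⟨hM.isInjCode_funCode (hu 0 le_rfl) (hZ 0 le_rfl), fun ξ x _ hx => ?_⟩
    obtain ⟨o, -, ho, ho1, ho2⟩ := pair_mem_funCode.1 hx
    rw [ho2, upair_mem_codeEdges]
    exact h0 o ho
  | succ n ih =>
    refine ⟨hM.isInjCode_funCode (hu _ le_rfl) (hZ _ le_rfl), _,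
      ih (fun k hk => hu k (by omega)) (fun k hk => hZ k (by omega)) (fun k hk => hs k (by omega)),
      fun ξ x y _ hx hy => ?_⟩
    obtain ⟨o, -, ho, ho1, ho2⟩ := pair_mem_funCode.1 hx
    obtain ⟨o', -, ho', ho1', ho2'⟩ := pair_mem_funCode.1 hy
    obtain rfl := Ordinal.toZFSet_injective (ho1.symm.trans ho1')
    rw [ho2, ho2', upair_mem_codeEdges]
    exact hs n (by omega) o ho

end IsGraphSubmodel

end Fans

/-! ### Connectivity inside a submodel -/

section Connectivity

variable {V : Type u}

/-- Among `κ` many disjoint paths, `κ` many avoid a given set of size less than `κ`. -/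
theorem le_mk_paths_avoiding {G : SimpleGraph V} {κ : Cardinal.{u}} (hκ : ℵ₀ ≤ κ)
    {v w : V} {S : Set (G.Path v w)} (hS : #S = κ)
    (hdis : ∀ p ∈ S, ∀ q ∈ S, p ≠ q → ∀ z, z ∈ p.1.support → z ∈ q.1.support → z = v ∨ z = w)
    {Z : Set V} (hZ : #Z < κ) :
    κ ≤ #{p ∈ S | ∀ z ∈ p.1.support, z ∈ Z → z = v ∨ z = w} := by
  let T : Set (G.Path v w) := {p ∈ S | ∀ z ∈ p.1.support, z ∈ Z → z = v ∨ z = w}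
  -- A discarded path has an inner vertex in `Z`; disjointness makes these vertices distinct.
  have hdiff : #(S \ T : Set (G.Path v w)) ≤ #Z := by
    have : ∀ p : (S \ T : Set (G.Path v w)), ∃ z, z ∈ p.1.1.support ∧ z ∈ Z ∧ ¬ (z = v ∨ z = w) := by
      rintro ⟨p, hpS, hpT⟩
      by_contra! h
      exact hpT ⟨hpS, fun z hz hzZ => by
        by_contra hvw
        rw [not_or] at hvw
        exact hvw.2 ((h z hz hzZ).resolve_left hvw.1)⟩
    choose z hz1 hz2 hz3 using this
    refine Cardinal.mk_le_of_injective (f := fun p => (⟨z p, hz2 p⟩ : Z)) fun p q hpq => ?_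
    have hzz : z p = z q := congrArg (fun x : Z => (x : V)) hpq
    by_contra hne
    refine hz3 p (hdis p.1 p.2.1 q.1 q.2.1 (fun h => hne (Subtype.ext h)) _ (hz1 p) ?_)
    rw [hzz]
    exact hz1 q
  by_contra! hlt
  have h1 : #S ≤ #T + #(S \ T : Set (G.Path v w)) :=
    (Cardinal.mk_le_mk_of_subset (fun p hp => by
      by_cases h : p ∈ T
      · exact Or.inl h
      · exact Or.inr ⟨hp, h⟩)).trans (Cardinal.mk_union_le T (S \ T))
  rw [hS] at h1
  exact absurd h1 (not_le.2 (Cardinal.add_lt_of_lt hκ hlt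
    (hdiff.trans_lt hZ)))

/-- Among `κ` many disjoint paths, `μ < κ` many have the same length and avoid a given set of
size less than `κ`. -/
theorem exists_equal_length_paths {G : SimpleGraph V} {κ μ : Cardinal.{u}} (hμ : ℵ₀ ≤ μ)
    (hμκ : μ < κ) {v w : V} {S : Set (G.Path v w)} (hS : #S = κ)
    (hdis : ∀ p ∈ S, ∀ q ∈ S, p ≠ q → ∀ z, z ∈ p.1.support → z ∈ q.1.support → z = v ∨ z = w)
    {Z : Set V} (hZ : #Z < κ) :
    ∃ (l : ℕ) (f : Set.Iio μ.ord → G.Path v w), Function.Injective f ∧ ∀ ξ, f ξ ∈ S ∧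
      (f ξ).1.length = l ∧ ∀ z ∈ (f ξ).1.support, z ∈ Z → z = v ∨ z = w := by
  let T : Set (G.Path v w) := {p ∈ S | ∀ z ∈ p.1.support, z ∈ Z → z = v ∨ z = w}
  have hT : κ ≤ #T := le_mk_paths_avoiding (hμ.trans hμκ.le) hS hdis hZ
  -- Since μ⁺ is regular and uncountable, μ⁺ many of the remaining paths have one common length, and
  -- μ of these are kept.
  have hreg : (Order.succ μ).IsRegular := Cardinal.isRegular_succ hμ
  obtain ⟨⟨l⟩, hl⟩ := Cardinal.infinite_pigeonhole_card
    (fun p : T => (ULift.up p.1.1.length : ULift.{u} ℕ)) (Order.succ μ)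
    ((Order.succ_le_of_lt hμκ).trans hT) (hμ.trans (Order.le_succ μ)) (by
      rw [hreg.cof_ord]
      simpa using Order.lt_succ_of_le hμ)
  have hle : lift.{u} #(Set.Iio μ.ord) ≤ lift.{u + 1}
      #((fun p : T => (ULift.up p.1.1.length : ULift.{u} ℕ)) ⁻¹' {ULift.up l}) := by
    rw [Cardinal.mk_Iio_ordinal, Cardinal.card_ord, Cardinal.lift_id'.{u, u + 1}]
    exact Cardinal.lift_le.2 ((Order.le_succ μ).trans hl)
  obtain ⟨e⟩ := Cardinal.lift_mk_le'.1 hle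
  refine ⟨l, fun ξ => (e ξ).1.1, fun ξ η h => e.injective (Subtype.ext (Subtype.ext h)), fun ξ =>
    ⟨(e ξ).1.2.1, ?_, (e ξ).1.2.2⟩⟩
  have := (e ξ).2
  rw [Set.mem_preimage, Set.mem_singleton_iff] at this
  exact ULift.up_injective this

namespace IsGraphSubmodel

variable {G : SimpleGraph V} {label : V ↪ ZFSet.{u}} {A : Set V} {μ κ Θ : Cardinal.{u}}
  {M : ZFSet.{u}}

/-- Two points of an unseparable set lying in a submodel `M` are joined by walks inside `M` that
avoid a given small set of `M` and a given set of size less than `μ`. -/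
theorem exists_walk_avoiding (hM : IsGraphSubmodel G label A μ Θ M) (hA : Unseparable G κ A)
    (hμκ : μ < κ) {Z : Set V} (hZ : codeSet label Z ∈ M) (hZκ : #Z < κ) {v w : V} (hv : v ∈ A)
    (hw : w ∈ A) (hvM : label v ∈ M) (hwM : label w ∈ M) (hne : v ≠ w) {F : Set V} (hF : #F < μ) :
    ∃ p : G.Walk v w, ∀ z ∈ p.support, z = v ∨ z = w ∨ (label z ∈ M ∧ z ∉ Z ∧ z ∉ F) := by
  obtain ⟨S, hS, hdis⟩ := hA v hv w hw hne
  obtain ⟨l, f, hf, hfl⟩ := exists_equal_length_paths hM.aleph0_le hμκ hS hdis hZκ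
  have hpos : 0 < μ.ord := by
    rw [Cardinal.ord_pos]
    exact Cardinal.aleph0_pos.trans_le hM.aleph0_le
  -- Length 0 is impossible, and for length 1 the edge itself is the walk. Otherwise there are n + 1
  -- inner vertices on each path.
  rcases l with _ | _ | n
  · exact (hne ((f ⟨0, hpos⟩).1.eq_of_length_eq_zero (hfl _).2.1)).elim
  · have hadj := SimpleGraph.Walk.adj_of_length_eq_one (hfl ⟨0, hpos⟩).2.1
    refine ⟨.cons hadj .nil, fun z hz => ?_⟩
    simp only [SimpleGraph.Walk.support_cons, SimpleGraph.Walk.support_nil, List.mem_cons,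
      List.not_mem_nil, or_false] at hz
    exact hz.imp_right Or.inl
  -- Inner vertices are counted from the end `w`: `u 0` is adjacent to `w` and `u n` to `v`. The
  -- value `v` at ordinals from μ on is a dummy.
  · let u : ℕ → Ordinal.{u} → V := fun k ξ =>
      if h : ξ < μ.ord then (f ⟨ξ, h⟩).1.getVert (n + 1 - k) else v
    have hu : ∀ k ξ (h : ξ < μ.ord), u k ξ = (f ⟨ξ, h⟩).1.getVert (n + 1 - k) := fun k ξ h =>
      dif_pos h
    have hint : ∀ k ≤ n, ∀ ξ (h : ξ < μ.ord), ¬ (u k ξ = v ∨ u k ξ = w) := by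
      intro k hk ξ h
      rw [hu k ξ h]
      have hp := (f ⟨ξ, h⟩).2
      have hlen := (hfl ⟨ξ, h⟩).2.1
      rw [hp.getVert_eq_start_iff (by omega), hp.getVert_eq_end_iff (by omega)]
      omega
    have hcode := hM.isFanCode_funCode (w := w) (Z := Z) (u := u) n ?_ ?_ ?_ ?_
    · have hcode' : ∃ c : hereditary Θ, IsFanCode G label μ Z w n c ∧
          ∀ ξ x : hereditary Θ, (ξ : ZFSet.{u}) ∈ μ.ord.toZFSet →
            (ξ : ZFSet.{u}).pair x ∈ (c : ZFSet.{u}) →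
            ({label v, (x : ZFSet.{u})} : ZFSet.{u}) ∈ codeEdges label G := by
        refine ⟨_, hcode, fun ξ x _ hx => ?_⟩
        obtain ⟨o, -, ho, ho1, ho2⟩ := pair_mem_funCode.1 hx
        rw [ho2, upair_mem_codeEdges, hu n o ho]
        have := (f ⟨o, ho⟩).1.adj_getVert_succ (i := 0) (by have := (hfl ⟨o, ho⟩).2.1; omega)
        rw [SimpleGraph.Walk.getVert_zero] at this
        convert this using 2
        omega
      obtain ⟨c, hcM, hc, hcv⟩ := hM.elementary.exists_mem
        (ParamDefinable.and (hM.paramDefinable_isFanCode hZ hwM n _) (by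
          have h1 := hM.card_mem
          have h2 := hM.codeEdges_mem
          have h3 := hM.aleph0_le_bound
          repeat' first
            | exact ParamTerm.var _
            | exact ParamTerm.const hM.elementary ‹_›
            | apply ParamDefinable.all
            | apply ParamDefinable.imp
            | apply ParamDefinable.pair_mem h3
            | apply ParamDefinable.upair_mem h3
            | apply ParamDefinable.mem)) hcode'
      obtain ⟨bad, hbad, hwalk⟩ := hM.exists_walks_of_isFanCode hZ hwM hF n hcM hc
      obtain ⟨g, hg, hgξ⟩ := hM.exists_decode_injCode hcM hc.isInjCode
      -- There are μ indices, and fewer than μ of them are bad.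
      obtain ⟨ξ, hξ⟩ : ∃ ξ, ξ ∉ bad := by
        by_contra! h
        rw [Set.eq_univ_of_forall h, Cardinal.mk_univ, Cardinal.mk_Iio_ordinal,
          Cardinal.card_ord] at hbad
        exact lt_irrefl _ hbad
      obtain ⟨p, hp⟩ := hwalk ξ hξ _ (hgξ ξ).2.2.1
      have hadj := upair_mem_codeEdges.1 (hcv ⟨_, hM.elementary.mem_hereditary (hM.ord_mem ξ.2)⟩
        ⟨_, hM.label_mem_hereditary _⟩ (Ordinal.toZFSet_mem_toZFSet_iff.2 ξ.2) (hgξ ξ).2.2.1)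
      refine ⟨.cons hadj p, fun z hz => ?_⟩
      rw [SimpleGraph.Walk.support_cons, List.mem_cons] at hz
      exact hz.imp_right (hp z)
    · intro k hk ξ hξ η hη h
      by_contra hne'
      have hne'' : f ⟨ξ, hξ⟩ ≠ f ⟨η, hη⟩ := fun h' => hne' (Subtype.mk.inj (hf h'))
      refine hint k hk ξ hξ (hdis _ (hfl _).1 _ (hfl _).1 hne'' _ ?_ ?_)
      · rw [hu k ξ hξ]; exact SimpleGraph.Walk.getVert_mem_support _ _
      · rw [h, hu k η hη]; exact SimpleGraph.Walk.getVert_mem_support _ _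
    · intro k hk ξ hξ hz
      refine hint k hk ξ hξ ((hfl ⟨ξ, hξ⟩).2.2 _ ?_ hz)
      rw [hu k ξ hξ]; exact SimpleGraph.Walk.getVert_mem_support _ _
    · intro ξ hξ
      rw [hu 0 ξ hξ]
      have hlen := (hfl ⟨ξ, hξ⟩).2.1
      have := (f ⟨ξ, hξ⟩).1.adj_getVert_succ (i := n + 1) (by omega)
      rwa [← hlen, SimpleGraph.Walk.getVert_length] at this
    · intro k hk ξ hξ
      rw [hu _ ξ hξ, hu _ ξ hξ]
      have hlen := (hfl ⟨ξ, hξ⟩).2.1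
      have := (f ⟨ξ, hξ⟩).1.adj_getVert_succ (i := n + 1 - (k + 1)) (by omega)
      convert this using 2
      omega

end IsGraphSubmodel

end Connectivity

/-! ### Scaffolds, and the reflection of their two components -/

section Scaffold

variable {V : Type u}

/-- A one-to-one enumeration in order type `o` of a path of `G` concentrated on `A`. -/
structure IsConcentratedSeq (G : SimpleGraph V) (A : Set V) (o : Ordinal.{u})
    (r : Ordinal.{u} → V) : Prop where
  injOn : Set.InjOn r (Set.Iio o)
  cofinal : ∀ η < o, ∀ ξ < η, ∃ ζ, ξ ≤ ζ ∧ ζ < η ∧ G.Adj (r ζ) (r η)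
  limit : ∀ η < o, (∀ ξ < η, ∃ ζ < η, ξ < ζ) → ∀ ξ < η, ∃ ζ, ξ ≤ ζ ∧ ζ < η ∧ G.Adj (r ζ) (r η) ∧
    r ζ ∈ A

/-- The vertex `y` has `A`-neighbours `g ξ`, for the `ξ` in an unbounded subset `D` of `μ`. -/
structure IsApex (G : SimpleGraph V) (A : Set V) (μ : Cardinal.{u}) (y : V) (D : Set Ordinal.{u})
    (g : Ordinal.{u} → V) : Prop where
  subset : D ⊆ Set.Iio μ.ord
  unbounded : ∀ ξ < μ.ord, ∃ η ∈ D, ξ ≤ η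
  injOn : Set.InjOn g D
  mem : ∀ ξ ∈ D, g ξ ∈ A
  adj : ∀ ξ ∈ D, G.Adj y (g ξ)

/-- A path enumerated in order type `μ`, disjoint from a vertex `y` that has `A`-neighbours outside
the path with unboundedly many indices below `μ`. -/
structure IsScaffold (G : SimpleGraph V) (A : Set V) (μ : Cardinal.{u}) (y : V)
    (D : Set Ordinal.{u}) (g r : Ordinal.{u} → V) : Prop where
  seq : IsConcentratedSeq G A μ.ord r
  apex : IsApex G A μ y D g
  ne_apex : ∀ ξ < μ.ord, r ξ ≠ y
  ne_value : ∀ ξ < μ.ord, ∀ η ∈ D, r ξ ≠ g η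

/-- The set of all vertices of a scaffold. -/
def scaffoldSet (μ : Cardinal.{u}) (y : V) (D : Set Ordinal.{u}) (g r : Ordinal.{u} → V) : Set V :=
  insert y (g '' D ∪ r '' Set.Iio μ.ord)

theorem mk_image_le_of_subset_Iio {μ : Cardinal.{u}} {D : Set Ordinal.{u}}
    (hD : D ⊆ Set.Iio μ.ord) (g : Ordinal.{u} → V) : #(g '' D) ≤ μ := by
  rw [← Cardinal.lift_le.{u + 1}]
  have h1 := Cardinal.mk_image_le_lift (f := g) (s := D)
  rw [Cardinal.lift_id'.{u, u + 1}] at h1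
  refine h1.trans ((Cardinal.mk_le_mk_of_subset hD).trans ?_)
  rw [Cardinal.mk_Iio_ordinal, Cardinal.card_ord]

/-- The order isomorphism between o and the path transports both cofinality conditions. Positivity
of o provides a vertex to serve as the value beyond o. -/
theorem TransfinitePath.exists_isConcentratedSeq {G : SimpleGraph V} {A : Set V}
    (P : TransfinitePath G) (hP : P.ConcentratedOn A) {o : Ordinal.{u}} (ho : P.orderType = o)
    (hpos : 0 < o) :
    ∃ r : Ordinal.{u} → V, IsConcentratedSeq G A o r ∧ ∀ ξ < o, r ξ ∈ P.verts := by
  have := P.wellOrder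
  have ht : Ordinal.type P.lt = o := ho
  let e : ∀ ξ < o, P.graph.verts := fun ξ h => Ordinal.enum P.lt ⟨ξ, by rw [ht]; exact h⟩
  have he : ∀ ξ (hξ : ξ < o) η (hη : η < o), P.lt (e ξ hξ) (e η hη) ↔ ξ < η := by
    intro ξ hξ η hη
    exact Ordinal.enum_lt_enum
  have hsurj : ∀ x : P.graph.verts, ∃ ξ, ∃ h : ξ < o, e ξ h = x := by
    intro x
    refine ⟨Ordinal.typein P.lt x, by rw [← ht]; exact Ordinal.typein_lt_type _ x, ?_⟩
    exact Ordinal.enum_typein P.lt x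
  let r : Ordinal.{u} → V := fun ξ => if h : ξ < o then (e ξ h : V) else e 0 hpos
  have hr : ∀ ξ (h : ξ < o), r ξ = e ξ h := fun ξ h => dif_pos h
  refine ⟨r, ⟨fun ξ hξ η hη h => ?_, fun η hη ξ hξ => ?_, fun η hη hlim ξ hξ => ?_⟩, fun ξ hξ => ?_⟩
  · rw [hr ξ hξ, hr η hη] at h
    have h' : e ξ hξ = e η hη := Subtype.ext h
    refine le_antisymm (not_lt.1 fun hlt => ?_) (not_lt.1 fun hlt => ?_)
    · have := (he η hη ξ hξ).2 hlt
      rw [h'] at this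
      exact irrefl_of P.lt _ this
    · have := (he ξ hξ η hη).2 hlt
      rw [h'] at this
      exact irrefl_of P.lt _ this
  · obtain ⟨w, hw, hwlt, hwu⟩ := P.cofinal _ _ ((he ξ (hξ.trans hη) η hη).2 hξ)
    obtain ⟨ζ, hζ, rfl⟩ := hsurj w
    refine ⟨ζ, not_lt.1 fun h => hwu ((he ζ hζ ξ (hξ.trans hη)).2 h), (he ζ hζ η hη).1 hwlt, ?_⟩
    rw [hr ζ hζ, hr η hη]
    exact hw.adj_sub
  · have hlim' : P.IsLimit (e η hη) := by
      refine ⟨⟨e ξ (hξ.trans hη), (he ξ (hξ.trans hη) η hη).2 hξ⟩, fun x hx => ?_⟩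
      obtain ⟨x, hxo, rfl⟩ := hsurj x
      obtain ⟨z, hz, hxz⟩ := hlim x ((he x hxo η hη).1 hx)
      exact ⟨e z (hz.trans hη), (he x hxo z (hz.trans hη)).2 hxz,
        (he z (hz.trans hη) η hη).2 hz⟩
    obtain ⟨w, hw, hwA, hwu, hwlt⟩ := hP _ hlim' _ ((he ξ (hξ.trans hη) η hη).2 hξ)
    obtain ⟨ζ, hζ, rfl⟩ := hsurj w
    refine ⟨ζ, not_lt.1 fun h => hwu ((he ζ hζ ξ (hξ.trans hη)).2 h), (he ζ hζ η hη).1 hwlt, ?_⟩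
    rw [hr ζ hζ, hr η hη]
    exact ⟨hw.adj_sub, hwA⟩
  · rw [hr ξ hξ]
    exact (e ξ hξ).2

/-- Disjoint paths that meet `Z` do so in different points, so not all κ of them can. -/
theorem ManyDisjointPaths.exists_isConcentratedSeq {G : SimpleGraph V} {A : Set V}
    {κ ν : Cardinal.{u}} (h : ManyDisjointPaths G κ A) (hν : ν < κ) (hpos : 0 < ν) {Z : Set V}
    (hZ : #Z < κ) :
    ∃ r : Ordinal.{u} → V, IsConcentratedSeq G A ν.ord r ∧ ∀ ξ < ν.ord, r ξ ∉ Z := by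
  obtain ⟨I, P, hI, hdis, hP⟩ := h ν hν
  obtain ⟨i, hi⟩ : ∃ i, Disjoint (P i).verts Z := by
    by_contra! hcon
    have : ∀ i, ∃ z, z ∈ (P i).verts ∧ z ∈ Z := fun i => Set.not_disjoint_iff.1 (hcon i)
    choose z hz hzZ using this
    refine absurd (Cardinal.mk_le_of_injective (f := fun i => (⟨z i, hzZ i⟩ : Z)) fun i j hij => ?_)
      (not_le.2 (hI ▸ hZ))
    by_contra hne
    have hzz : z i = z j := congrArg (fun x : Z => (x : V)) hij
    exact Set.disjoint_left.1 (hdis i j hne) (hz i) (hzz ▸ hz j)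
  obtain ⟨r, hr, hrP⟩ := (P i).exists_isConcentratedSeq (hP i).1 (hP i).2
    (Cardinal.ord_pos.2 hpos)
  exact ⟨r, hr, fun ξ hξ => Set.disjoint_left.1 hi (hrP ξ hξ)⟩

namespace IsGraphSubmodel

variable {G : SimpleGraph V} {label : V ↪ ZFSet.{u}} {A : Set V} {μ κ Θ : Cardinal.{u}}
  {M : ZFSet.{u}}

/-- The vertices that occur as values of a relation in `M` form a set in `M`. -/
theorem codeSet_union_values_mem (hM : IsGraphSubmodel G label A μ Θ M) {Z : Set V}
    (hZ : codeSet label Z ∈ M) {c : ZFSet.{u}} (hc : c ∈ M) :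
    codeSet label (Z ∪ {v | ∃ ξ < μ.ord, ξ.toZFSet.pair (label v) ∈ c}) ∈ M := by
  have h1 := hM.codeUniv_mem
  have h3 := hM.aleph0_le_bound
  have h4 := hM.card_mem
  have hord : ∀ {ξ : Ordinal.{u}}, ξ < μ.ord → ξ.toZFSet ∈ hereditary Θ := fun hξ =>
    toZFSet_mem_hereditary (hM.elementary.mem_hereditary h4) hξ
  obtain ⟨x, hx, hxe⟩ := hM.elementary.exists_mem
    (P := fun x => ∀ z : hereditary Θ,
      ((z : ZFSet.{u}) ∈ (x : ZFSet.{u}) → (z : ZFSet.{u}) ∈ codeSet label Set.univ ∧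
        ((z : ZFSet.{u}) ∈ codeSet label Z ∨
          ∃ ξ : hereditary Θ, (ξ : ZFSet.{u}) ∈ μ.ord.toZFSet ∧ (ξ : ZFSet.{u}).pair z ∈ c)) ∧
      ((z : ZFSet.{u}) ∈ codeSet label Set.univ ∧ ((z : ZFSet.{u}) ∈ codeSet label Z ∨
          ∃ ξ : hereditary Θ, (ξ : ZFSet.{u}) ∈ μ.ord.toZFSet ∧ (ξ : ZFSet.{u}).pair z ∈ c) →
          (z : ZFSet.{u}) ∈ (x : ZFSet.{u})))
    (by
      repeat' first
        | exact ParamTerm.var _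
        | exact ParamTerm.const hM.elementary ‹_›
        | apply ParamDefinable.and
        | apply ParamDefinable.or
        | apply ParamDefinable.ex
        | apply ParamDefinable.all
        | apply ParamDefinable.imp
        | apply ParamDefinable.pair_mem h3
        | apply ParamDefinable.mem)
    ⟨⟨codeSet label (Z ∪ {v | ∃ ξ < μ.ord, ξ.toZFSet.pair (label v) ∈ c}),
      hM.codeSet_mem_hereditary _⟩, by
      intro z
      constructor
      · intro hz
        obtain ⟨v, hv, hvz⟩ := mem_codeSet.1 hz
        rw [← hvz]
        refine ⟨label_mem_codeSet.2 (Set.mem_univ _), ?_⟩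
        rcases hv with hv | ⟨ξ, hξ, hξc⟩
        · exact Or.inl (label_mem_codeSet.2 hv)
        · exact Or.inr ⟨⟨_, hord hξ⟩, Ordinal.toZFSet_mem_toZFSet_iff.2 hξ, hξc⟩
      · rintro ⟨hz, h⟩
        obtain ⟨v, -, hvz⟩ := mem_codeSet.1 hz
        rw [← hvz] at h ⊢
        refine label_mem_codeSet.2 ?_
        rcases h with h | ⟨ξ, hξ, hξc⟩
        · exact Or.inl (label_mem_codeSet.1 h)
        · obtain ⟨o, ho, hoξ⟩ := Ordinal.mem_toZFSet_iff.1 hξ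
          rw [← hoξ] at hξc
          exact Or.inr ⟨o, ho, hξc⟩⟩
  suffices codeSet label (Z ∪ {v | ∃ ξ < μ.ord, ξ.toZFSet.pair (label v) ∈ c}) = x by rwa [this]
  ext z
  constructor
  · intro hz
    obtain ⟨v, hv, rfl⟩ := mem_codeSet.1 hz
    refine (hxe ⟨_, hM.label_mem_hereditary v⟩).2 ⟨label_mem_codeSet.2 (Set.mem_univ _), ?_⟩
    rcases hv with hv | ⟨ξ, hξ, hξc⟩
    · exact Or.inl (label_mem_codeSet.2 hv)
    · exact Or.inr ⟨⟨_, hord hξ⟩, Ordinal.toZFSet_mem_toZFSet_iff.2 hξ, hξc⟩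
  · intro hz
    obtain ⟨hz1, hz2⟩ := (hxe ⟨z, hereditary_of_mem x.2 hz⟩).1 hz
    obtain ⟨v, -, rfl⟩ := mem_codeSet.1 hz1
    refine label_mem_codeSet.2 ?_
    rcases hz2 with h | ⟨ξ, hξ, hξc⟩
    · exact Or.inl (label_mem_codeSet.1 h)
    · obtain ⟨o, ho, hoξ⟩ := Ordinal.mem_toZFSet_iff.1 hξ
      rw [← hoξ] at hξc
      exact Or.inr ⟨o, ho, hξc⟩

theorem codeSet_insert_mem (hM : IsGraphSubmodel G label A μ Θ M) {Z : Set V}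
    (hZ : codeSet label Z ∈ M) {y : V} (hy : label y ∈ M) : codeSet label (insert y Z) ∈ M := by
  obtain ⟨x, hx, hxe⟩ := hM.elementary.exists_mem
    (P := fun x => ∀ z : hereditary Θ,
      ((z : ZFSet.{u}) ∈ (x : ZFSet.{u}) →
        ((z : ZFSet.{u}) = label y ∨ (z : ZFSet.{u}) ∈ codeSet label Z)) ∧
      ((z : ZFSet.{u}) = label y ∨ (z : ZFSet.{u}) ∈ codeSet label Z →
        (z : ZFSet.{u}) ∈ (x : ZFSet.{u})))
    (by
      repeat' first
        | exact ParamTerm.var _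
        | exact ParamTerm.const hM.elementary ‹_›
        | apply ParamDefinable.and
        | apply ParamDefinable.or
        | apply ParamDefinable.all
        | apply ParamDefinable.imp
        | apply ParamDefinable.mem
        | apply ParamDefinable.eq)
    ⟨⟨codeSet label (insert y Z), hM.codeSet_mem_hereditary _⟩, by
      intro z
      simp only [mem_codeSet, Set.mem_insert_iff]
      constructor
      · rintro ⟨a, rfl | ha, hz⟩
        exacts [Or.inl hz.symm, Or.inr ⟨a, ha, hz⟩]
      · rintro (hz | ⟨a, ha, hz⟩)
        exacts [⟨y, Or.inl rfl, hz.symm⟩, ⟨a, Or.inr ha, hz⟩]⟩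
  suffices codeSet label (insert y Z) = x by rwa [this]
  ext z
  constructor
  · intro hz
    obtain ⟨v, hv, rfl⟩ := mem_codeSet.1 hz
    refine (hxe ⟨_, hM.label_mem_hereditary v⟩).2 ?_
    rcases hv with rfl | hv
    exacts [Or.inl rfl, Or.inr (label_mem_codeSet.2 hv)]
  · intro hz
    rcases (hxe ⟨z, hereditary_of_mem x.2 hz⟩).1 hz with rfl | h
    · exact label_mem_codeSet.2 (Set.mem_insert _ _)
    · obtain ⟨v, hv, rfl⟩ := mem_codeSet.1 h
      exact label_mem_codeSet.2 (Set.mem_insert_of_mem _ hv)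

/-- If there is an apex outside `Z`, then there is one in `M`. -/
theorem exists_isApex (hM : IsGraphSubmodel G label A μ Θ M) {Z : Set V}
    (hZ : codeSet label Z ∈ M) {y : V} {D : Set Ordinal.{u}} {g : Ordinal.{u} → V}
    (h : IsApex G A μ y D g) (hy : y ∉ Z) (hg : ∀ ξ ∈ D, g ξ ∉ Z) :
    ∃ (y' : V) (D' : Set Ordinal.{u}) (g' : Ordinal.{u} → V), IsApex G A μ y' D' g' ∧
      y' ∉ Z ∧ label y' ∈ M ∧ (∀ ξ ∈ D', g' ξ ∉ Z ∧ label (g' ξ) ∈ M) ∧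
      codeSet label (Z ∪ insert y' (g' '' D')) ∈ M := by
  have h1 := hM.codeUniv_mem
  have h2 := hM.codeEdges_mem
  have h3 := hM.aleph0_le_bound
  have h4 := hM.card_mem
  have h5 := hM.codeSet_mem
  have hH := hM.elementary.mem_hereditary h4
  -- Here c codes a partial function on μ with values in the neighbourhood of y. The last clause
  -- says that its domain is unbounded, ξ ≤ η being written as ξ = η or ξ ∈ η.
  let Φ : hereditary Θ → hereditary Θ → Prop := fun y c =>
    (y : ZFSet.{u}) ∈ codeSet label Set.univ ∧ ¬ (y : ZFSet.{u}) ∈ codeSet label Z ∧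
    (∀ ξ x : hereditary Θ, (ξ : ZFSet.{u}).pair x ∈ (c : ZFSet.{u}) →
      (ξ : ZFSet.{u}) ∈ μ.ord.toZFSet ∧ (x : ZFSet.{u}) ∈ codeSet label A ∧
      ¬ (x : ZFSet.{u}) ∈ codeSet label Z ∧
      ({(y : ZFSet.{u}), (x : ZFSet.{u})} : ZFSet.{u}) ∈ codeEdges label G) ∧
    (∀ ξ x x' : hereditary Θ, (ξ : ZFSet.{u}).pair x ∈ (c : ZFSet.{u}) →
      (ξ : ZFSet.{u}).pair x' ∈ (c : ZFSet.{u}) → (x : ZFSet.{u}) = x') ∧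
    (∀ ξ ξ' x : hereditary Θ, (ξ : ZFSet.{u}).pair x ∈ (c : ZFSet.{u}) →
      (ξ' : ZFSet.{u}).pair x ∈ (c : ZFSet.{u}) → (ξ : ZFSet.{u}) = ξ') ∧
    (∀ ξ : hereditary Θ, (ξ : ZFSet.{u}) ∈ μ.ord.toZFSet → ∃ η x : hereditary Θ,
      ((ξ : ZFSet.{u}) = η ∨ (ξ : ZFSet.{u}) ∈ (η : ZFSet.{u})) ∧
      (η : ZFSet.{u}).pair x ∈ (c : ZFSet.{u}))
  have hex : ∃ y c : hereditary Θ, Φ y c := by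
    refine ⟨⟨label y, hM.label_mem_hereditary y⟩, ⟨_, hM.funCode_mem_hereditary D g⟩,
      label_mem_codeSet.2 (Set.mem_univ _), fun h => hy (label_mem_codeSet.1 h),
      fun ξ x hx => ?_, fun ξ x x' hx hx' => ?_, fun ξ ξ' x hx hx' => ?_, fun ξ hξ => ?_⟩
    · obtain ⟨o, ho, hoμ, ho1, ho2⟩ := pair_mem_funCode.1 hx
      rw [ho1, ho2, label_mem_codeSet, label_mem_codeSet, upair_mem_codeEdges]
      exact ⟨Ordinal.toZFSet_mem_toZFSet_iff.2 hoμ, h.mem o ho, hg o ho, h.adj o ho⟩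
    · obtain ⟨o, ho, hoμ, ho1, ho2⟩ := pair_mem_funCode.1 hx
      obtain ⟨o', ho', hoμ', ho1', ho2'⟩ := pair_mem_funCode.1 hx'
      obtain rfl := Ordinal.toZFSet_injective (ho1.symm.trans ho1')
      exact ho2.trans ho2'.symm
    · obtain ⟨o, ho, hoμ, ho1, ho2⟩ := pair_mem_funCode.1 hx
      obtain ⟨o', ho', hoμ', ho1', ho2'⟩ := pair_mem_funCode.1 hx'
      rw [ho1, ho1', h.injOn ho ho' (label.injective (ho2.symm.trans ho2'))]
    · obtain ⟨o, ho, hoξ⟩ := Ordinal.mem_toZFSet_iff.1 hξ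
      obtain ⟨η, hη, hoη⟩ := h.unbounded o ho
      refine ⟨⟨η.toZFSet, toZFSet_mem_hereditary hH (h.subset hη)⟩,
        ⟨label (g η), hM.label_mem_hereditary _⟩, ?_,
        pair_mem_funCode.2 ⟨η, hη, h.subset hη, rfl, rfl⟩⟩
      rw [← hoξ]
      rcases hoη.eq_or_lt with rfl | hlt
      exacts [Or.inl rfl, Or.inr (Ordinal.toZFSet_mem_toZFSet_iff.2 hlt)]
  -- Reflection proceeds one variable at a time: first y, then c with this y as a parameter.
  obtain ⟨yc, hyM, hyc⟩ := hM.elementary.exists_mem (by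
    simp only [Φ]
    repeat' first
      | exact ParamTerm.var _
      | exact ParamTerm.const hM.elementary ‹_›
      | apply ParamDefinable.not
      | apply ParamDefinable.and
      | apply ParamDefinable.or
      | apply ParamDefinable.ex
      | apply ParamDefinable.all
      | apply ParamDefinable.imp
      | apply ParamDefinable.pair_mem h3
      | apply ParamDefinable.upair_mem h3
      | apply ParamDefinable.mem
      | apply ParamDefinable.eq) hex
  obtain ⟨c, hcM, hc⟩ := hM.elementary.exists_mem (by
    simp only [Φ]
    repeat' first
      | exact ParamTerm.var _
      | exact ParamTerm.const hM.elementary ‹_›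
      | apply ParamDefinable.not
      | apply ParamDefinable.and
      | apply ParamDefinable.or
      | apply ParamDefinable.ex
      | apply ParamDefinable.all
      | apply ParamDefinable.imp
      | apply ParamDefinable.pair_mem h3
      | apply ParamDefinable.upair_mem h3
      | apply ParamDefinable.mem
      | apply ParamDefinable.eq) hyc
  obtain ⟨hc1, hc2, hc3, hc4, hc5, hc6⟩ := hc
  obtain ⟨y', -, hy'⟩ := mem_codeSet.1 hc1
  rw [← hy'] at hyM hc2 hc3
  let D' : Set Ordinal.{u} := {ξ | ∃ x : V, ξ.toZFSet.pair (label x) ∈ (c : ZFSet.{u})}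
  have hD : ∀ ξ, ∃ x : V, ξ ∈ D' → ξ.toZFSet.pair (label x) ∈ (c : ZFSet.{u}) := by
    intro ξ
    by_cases hξ : ξ ∈ D'
    · exact ⟨_, fun _ => hξ.choose_spec⟩
    · exact ⟨y, fun h => (hξ h).elim⟩
  choose g' hg' using hD
  have hdec : ∀ ξ x : ZFSet.{u}, ξ.pair x ∈ (c : ZFSet.{u}) → ∃ o ∈ D', ξ = o.toZFSet ∧
      x = label (g' o) := by
    intro ξ x hx
    obtain ⟨hξH, hxH⟩ := hereditary_of_pair_mem c.2 hx
    obtain ⟨hξ, hxA, -, -⟩ := hc3 ⟨ξ, hξH⟩ ⟨x, hxH⟩ hx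
    obtain ⟨o, ho, rfl⟩ := Ordinal.mem_toZFSet_iff.1 hξ
    obtain ⟨a, ha, rfl⟩ := mem_codeSet.1 hxA
    have hoD : o ∈ D' := ⟨a, hx⟩
    exact ⟨o, hoD, rfl, hc4 ⟨_, hξH⟩ ⟨_, hxH⟩ ⟨_, hM.label_mem_hereditary _⟩ hx (hg' o hoD)⟩
  have hprop : ∀ ξ ∈ D', ξ < μ.ord ∧ g' ξ ∈ A ∧ g' ξ ∉ Z ∧ G.Adj y' (g' ξ) := by
    intro ξ hξ
    have := hc3 ⟨ξ.toZFSet, (hereditary_of_pair_mem c.2 (hg' ξ hξ)).1⟩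
      ⟨label (g' ξ), hM.label_mem_hereditary _⟩ (hg' ξ hξ)
    rwa [Ordinal.toZFSet_mem_toZFSet_iff, label_mem_codeSet, label_mem_codeSet,
      upair_mem_codeEdges] at this
  refine ⟨y', D', g', ⟨fun ξ hξ => (hprop ξ hξ).1, fun ξ hξ => ?_, fun ξ hξ η hη heq => ?_,
    fun ξ hξ => (hprop ξ hξ).2.1, fun ξ hξ => (hprop ξ hξ).2.2.2⟩,
    fun h => hc2 (label_mem_codeSet.2 h), hyM, fun ξ hξ => ⟨(hprop ξ hξ).2.2.1, ?_⟩, ?_⟩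
  · obtain ⟨η, x, hle, hη⟩ := hc6 ⟨ξ.toZFSet, toZFSet_mem_hereditary hH hξ⟩
      (Ordinal.toZFSet_mem_toZFSet_iff.2 hξ)
    obtain ⟨o, hoD, ho, -⟩ := hdec _ _ hη
    refine ⟨o, hoD, ?_⟩
    rw [ho] at hle
    rcases hle with hle | hle
    · exact (Ordinal.toZFSet_injective hle).le
    · exact (Ordinal.toZFSet_mem_toZFSet_iff.1 hle).le
  · have e1 := hg' ξ hξ
    have e2 := hg' η hη
    rw [← heq] at e2
    exact Ordinal.toZFSet_injective (hc5 ⟨_, (hereditary_of_pair_mem c.2 e1).1⟩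
      ⟨_, (hereditary_of_pair_mem c.2 e2).1⟩ ⟨_, hM.label_mem_hereditary _⟩ e1 e2)
  · refine hM.elementary.value_mem h3 hcM (hM.ord_mem (hprop ξ hξ).1) (hg' ξ hξ) fun b' hb' => ?_
    obtain ⟨o, -, ho, rfl⟩ := hdec _ _ hb'
    rw [Ordinal.toZFSet_injective ho]
  -- The range of `g'` is the set of vertices that c assigns to ordinals below μ, which is definable
  -- from elements of M.
  · have := hM.codeSet_insert_mem (hM.codeSet_union_values_mem hZ hcM) hyM
    convert this using 2
    rw [Set.union_insert]
    congr 2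
    ext v
    constructor
    · rintro ⟨ξ, hξ, rfl⟩
      exact ⟨ξ, (hprop ξ hξ).1, hg' ξ hξ⟩
    · rintro ⟨ξ, -, hξ⟩
      obtain ⟨o, hoD, -, ho⟩ := hdec _ _ hξ
      exact ⟨o, hoD, (label.injective ho).symm⟩

/-- If there is a path of order type `μ` concentrated on `A` outside `Z`, then there is one
in `M`. -/
theorem exists_isConcentratedSeq (hM : IsGraphSubmodel G label A μ Θ M) {Z : Set V}
    (hZ : codeSet label Z ∈ M) {r : Ordinal.{u} → V} (h : IsConcentratedSeq G A μ.ord r)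
    (hr : ∀ ξ < μ.ord, r ξ ∉ Z) :
    ∃ r' : Ordinal.{u} → V, IsConcentratedSeq G A μ.ord r' ∧
      (∀ ξ < μ.ord, r' ξ ∉ Z ∧ label (r' ξ) ∈ M) ∧
      codeSet label (Z ∪ r' '' Set.Iio μ.ord) ∈ M := by
  have h1 := hM.codeUniv_mem
  have h2 := hM.codeEdges_mem
  have h3 := hM.aleph0_le_bound
  have h4 := hM.card_mem
  have h5 := hM.codeSet_mem
  have hH := hM.elementary.mem_hereditary h4
  have hord : ∀ {ξ : Ordinal.{u}}, ξ < μ.ord → ξ.toZFSet ∈ hereditary Θ := fun hξ =>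
    toZFSet_mem_hereditary hH hξ
  -- The path is reflected through its enumeration, with comparisons of indices expressed by
  -- membership of ordinals.
  obtain ⟨c, hcM, hc, hcof, hlim⟩ := hM.elementary.exists_mem (P := fun c => IsInjCode label μ Z c ∧
      (∀ η : hereditary Θ, (η : ZFSet.{u}) ∈ μ.ord.toZFSet → ∀ ξ : hereditary Θ,
        (ξ : ZFSet.{u}) ∈ (η : ZFSet.{u}) → ∃ ζ : hereditary Θ,
        ((ξ : ZFSet.{u}) = ζ ∨ (ξ : ZFSet.{u}) ∈ (ζ : ZFSet.{u})) ∧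
        (ζ : ZFSet.{u}) ∈ (η : ZFSet.{u}) ∧ ∃ x y : hereditary Θ,
          (ζ : ZFSet.{u}).pair x ∈ (c : ZFSet.{u}) ∧ (η : ZFSet.{u}).pair y ∈ (c : ZFSet.{u}) ∧
          ({(x : ZFSet.{u}), (y : ZFSet.{u})} : ZFSet.{u}) ∈ codeEdges label G) ∧
      (∀ η : hereditary Θ, (η : ZFSet.{u}) ∈ μ.ord.toZFSet →
        (∀ ξ : hereditary Θ, (ξ : ZFSet.{u}) ∈ (η : ZFSet.{u}) → ∃ ζ : hereditary Θ,
          (ζ : ZFSet.{u}) ∈ (η : ZFSet.{u}) ∧ (ξ : ZFSet.{u}) ∈ (ζ : ZFSet.{u})) →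
        ∀ ξ : hereditary Θ,
        (ξ : ZFSet.{u}) ∈ (η : ZFSet.{u}) → ∃ ζ : hereditary Θ,
        ((ξ : ZFSet.{u}) = ζ ∨ (ξ : ZFSet.{u}) ∈ (ζ : ZFSet.{u})) ∧
        (ζ : ZFSet.{u}) ∈ (η : ZFSet.{u}) ∧ ∃ x y : hereditary Θ,
          (ζ : ZFSet.{u}).pair x ∈ (c : ZFSet.{u}) ∧ (η : ZFSet.{u}).pair y ∈ (c : ZFSet.{u}) ∧
          ({(x : ZFSet.{u}), (y : ZFSet.{u})} : ZFSet.{u}) ∈ codeEdges label G ∧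
          (x : ZFSet.{u}) ∈ codeSet label A))
    (by
      refine ParamDefinable.and (hM.paramDefinable_isInjCode hZ _) ?_
      repeat' first
        | exact ParamTerm.var _
        | exact ParamTerm.const hM.elementary ‹_›
        | apply ParamDefinable.and
        | apply ParamDefinable.or
        | apply ParamDefinable.ex
        | apply ParamDefinable.all
        | apply ParamDefinable.imp
        | apply ParamDefinable.pair_mem h3
        | apply ParamDefinable.upair_mem h3
        | apply ParamDefinable.mem
        | apply ParamDefinable.eq)
    ⟨⟨_, hM.funCode_mem_hereditary Set.univ r⟩, hM.isInjCode_funCode h.injOn hr, by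
      intro η hη ξ hξ
      obtain ⟨η', hη', hηe⟩ := Ordinal.mem_toZFSet_iff.1 hη
      rw [← hηe] at hξ ⊢
      obtain ⟨ξ', hξ', hξe⟩ := Ordinal.mem_toZFSet_iff.1 hξ
      rw [← hξe]
      obtain ⟨ζ, hle, hlt, hadj⟩ := h.cofinal η' hη' ξ' hξ'
      refine ⟨⟨ζ.toZFSet, hord (hlt.trans hη')⟩, ?_, Ordinal.toZFSet_mem_toZFSet_iff.2 hlt,
        ⟨_, hM.label_mem_hereditary (r ζ)⟩, ⟨_, hM.label_mem_hereditary (r η')⟩,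
        pair_mem_funCode.2 ⟨ζ, Set.mem_univ _, hlt.trans hη', rfl, rfl⟩,
        pair_mem_funCode.2 ⟨η', Set.mem_univ _, hη', rfl, rfl⟩, upair_mem_codeEdges.2 hadj⟩
      rcases hle.eq_or_lt with rfl | hlt
      exacts [Or.inl rfl, Or.inr (Ordinal.toZFSet_mem_toZFSet_iff.2 hlt)], by
      intro η hη hl ξ hξ
      obtain ⟨η', hη', hηe⟩ := Ordinal.mem_toZFSet_iff.1 hη
      rw [← hηe] at hξ hl ⊢
      obtain ⟨ξ', hξ', hξe⟩ := Ordinal.mem_toZFSet_iff.1 hξ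
      rw [← hξe]
      obtain ⟨ζ, hle, hlt, hadj, hA⟩ := h.limit η' hη' (fun o ho => by
        obtain ⟨z, hz1, hz2⟩ := hl ⟨o.toZFSet, hord (ho.trans hη')⟩
          (Ordinal.toZFSet_mem_toZFSet_iff.2 ho)
        obtain ⟨z', hz', hze⟩ := Ordinal.mem_toZFSet_iff.1 hz1
        rw [← hze] at hz2
        exact ⟨z', hz', Ordinal.toZFSet_mem_toZFSet_iff.1 hz2⟩) ξ' hξ'
      refine ⟨⟨ζ.toZFSet, hord (hlt.trans hη')⟩, ?_, Ordinal.toZFSet_mem_toZFSet_iff.2 hlt,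
        ⟨_, hM.label_mem_hereditary (r ζ)⟩, ⟨_, hM.label_mem_hereditary (r η')⟩,
        pair_mem_funCode.2 ⟨ζ, Set.mem_univ _, hlt.trans hη', rfl, rfl⟩,
        pair_mem_funCode.2 ⟨η', Set.mem_univ _, hη', rfl, rfl⟩, upair_mem_codeEdges.2 hadj,
        label_mem_codeSet.2 hA⟩
      rcases hle.eq_or_lt with rfl | hlt
      exacts [Or.inl rfl, Or.inr (Ordinal.toZFSet_mem_toZFSet_iff.2 hlt)]⟩
  obtain ⟨f, hf, hfξ⟩ := hM.exists_decode_injCode hcM hc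
  have hpos : 0 < μ.ord := Cardinal.ord_pos.2 (Cardinal.aleph0_pos.trans_le hM.aleph0_le)
  let r' : Ordinal.{u} → V := fun ξ => if h : ξ < μ.ord then f ⟨ξ, h⟩ else f ⟨0, hpos⟩
  have hr' : ∀ ξ (h : ξ < μ.ord), r' ξ = f ⟨ξ, h⟩ := fun ξ h => dif_pos h
  have hdec : ∀ ξ (hξ : ξ < μ.ord) (x : hereditary Θ), ξ.toZFSet.pair x ∈ (c : ZFSet.{u}) →
      (x : ZFSet.{u}) = label (r' ξ) := by
    intro ξ hξ x hx
    rw [hr' ξ hξ]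
    exact hc.2.1 ⟨_, hord hξ⟩ x ⟨_, hM.label_mem_hereditary _⟩ hx (hfξ ⟨ξ, hξ⟩).2.2.1
  have hle : ∀ {ξ : Ordinal.{u}} {ζ : ZFSet.{u}} {o : Ordinal.{u}}, o.toZFSet = ζ →
      (ξ.toZFSet = ζ ∨ ξ.toZFSet ∈ ζ) → ξ ≤ o := by
    rintro ξ ζ o rfl (h | h)
    exacts [(Ordinal.toZFSet_injective h).le, (Ordinal.toZFSet_mem_toZFSet_iff.1 h).le]
  refine ⟨r', ⟨fun ξ hξ η hη heq => ?_, fun η hη ξ hξ => ?_, fun η hη hl ξ hξ => ?_⟩,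
    fun ξ hξ => ?_, ?_⟩
  · rw [hr' ξ hξ, hr' η hη] at heq
    exact Subtype.mk.inj (hf heq)
  · obtain ⟨ζ, h1, h2, x, y, hx, hy, hadj⟩ := hcof ⟨_, hord hη⟩
      (Ordinal.toZFSet_mem_toZFSet_iff.2 hη) ⟨_, hord (hξ.trans hη)⟩
      (Ordinal.toZFSet_mem_toZFSet_iff.2 hξ)
    obtain ⟨o, ho, hoe⟩ := Ordinal.mem_toZFSet_iff.1 h2
    rw [← hoe] at hx
    rw [hdec o (ho.trans hη) x hx, hdec η hη y hy, upair_mem_codeEdges] at hadj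
    exact ⟨o, hle hoe h1, ho, hadj⟩
  · obtain ⟨ζ, h1, h2, x, y, hx, hy, hadj, hA⟩ := hlim ⟨_, hord hη⟩
      (Ordinal.toZFSet_mem_toZFSet_iff.2 hη) (fun o ho => by
        obtain ⟨o', ho', hoe⟩ := Ordinal.mem_toZFSet_iff.1 ho
        obtain ⟨z, hz, hlt⟩ := hl o' ho'
        refine ⟨⟨_, hord (hz.trans hη)⟩, Ordinal.toZFSet_mem_toZFSet_iff.2 hz, ?_⟩
        rw [← hoe]
        exact Ordinal.toZFSet_mem_toZFSet_iff.2 hlt) ⟨_, hord (hξ.trans hη)⟩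
      (Ordinal.toZFSet_mem_toZFSet_iff.2 hξ)
    obtain ⟨o, ho, hoe⟩ := Ordinal.mem_toZFSet_iff.1 h2
    rw [← hoe] at hx
    rw [hdec o (ho.trans hη) x hx] at hA
    rw [hdec o (ho.trans hη) x hx, hdec η hη y hy, upair_mem_codeEdges] at hadj
    exact ⟨o, hle hoe h1, ho, hadj, label_mem_codeSet.1 hA⟩
  · rw [hr' ξ hξ]
    exact ⟨(hfξ _).1, (hfξ _).2.1⟩
  · convert hM.codeSet_union_values_mem hZ hcM using 3
    ext v
    constructor
    · rintro ⟨ξ, hξ, rfl⟩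
      refine ⟨ξ, hξ, ?_⟩
      rw [hr' ξ hξ]
      exact (hfξ _).2.2.1
    · rintro ⟨ξ, hξ, hξc⟩
      exact ⟨ξ, hξ, (label.injective (hdec ξ hξ ⟨_, hM.label_mem_hereditary v⟩ hξc)).symm⟩

end IsGraphSubmodel

end Scaffold

/-! ### Reflecting scaffolds and edges to a submodel -/

section Reflection

variable {V : Type u}

theorem mk_scaffoldSet_le {μ : Cardinal.{u}} (hμ : ℵ₀ ≤ μ) (y : V) {D : Set Ordinal.{u}}
    (hD : D ⊆ Set.Iio μ.ord) (g r : Ordinal.{u} → V) : #(scaffoldSet μ y D g r) ≤ μ := by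
  refine Cardinal.mk_insert_le.trans (Cardinal.add_le_of_le hμ ?_
    (Cardinal.one_lt_aleph0.le.trans hμ))
  exact (Cardinal.mk_union_le _ _).trans (Cardinal.add_le_of_le hμ
    (mk_image_le_of_subset_Iio hD g) (mk_image_le_of_subset_Iio subset_rfl r))

/-- This makes comparison of sizes a first-order statement over H(Θ): a partial map from `Z` onto
`C` can be taken inside Z × C, and is then an element of H(Θ). -/
theorem exists_surjective_code_iff {Θ : Cardinal.{u}} (hΘ : ℵ₀ ≤ Θ) {Z C : ZFSet.{u}}
    (hZ : Z ∈ hereditary Θ) (hC : C ∈ hereditary Θ) :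
    (∃ r : hereditary Θ, (∀ c : hereditary Θ, (c : ZFSet.{u}) ∈ C → ∃ z : hereditary Θ,
      (z : ZFSet.{u}) ∈ Z ∧ (z : ZFSet.{u}).pair c ∈ (r : ZFSet.{u})) ∧
      ∀ z c c' : hereditary Θ, (z : ZFSet.{u}).pair c ∈ (r : ZFSet.{u}) →
        (z : ZFSet.{u}).pair c' ∈ (r : ZFSet.{u}) → (c : ZFSet.{u}) = c') ↔ C.card ≤ Z.card := by
  rw [← Cardinal.lift_le.{u + 1}, ← ZFSet.cardinalMk_coe_sort, ← ZFSet.cardinalMk_coe_sort]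
  constructor
  · rintro ⟨r, hr, hf⟩
    have : ∀ c : C, ∃ z : Z, (z : ZFSet.{u}).pair c ∈ (r : ZFSet.{u}) := by
      rintro ⟨c, hc⟩
      obtain ⟨z, hz, h⟩ := hr ⟨c, hereditary_of_mem hC hc⟩ hc
      exact ⟨⟨z, hz⟩, h⟩
    choose z hz using this
    refine Cardinal.mk_le_of_injective (f := z) fun c c' h => ?_
    have h' := hz c'
    rw [← h] at h'
    exact Subtype.ext (hf ⟨z c, hereditary_of_mem hZ (z c).2⟩ ⟨c, hereditary_of_mem hC c.2⟩
      ⟨c', hereditary_of_mem hC c'.2⟩ (hz c) h')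
  · intro h
    obtain ⟨f⟩ := Cardinal.le_def _ _ |>.1 h
    refine ⟨⟨_, relCode_mem_hereditary hΘ hZ hC fun z c => ∃ h : c ∈ C, z = f ⟨c, h⟩⟩,
      fun c hc => ?_, fun z c c' h h' => ?_⟩
    · exact ⟨⟨f ⟨c, hc⟩, hereditary_of_mem hZ (f ⟨c, hc⟩).2⟩, (f ⟨c, hc⟩).2,
        pair_mem_relCode.2 ⟨(f ⟨c, hc⟩).2, hc, hc, rfl⟩⟩
    · obtain ⟨-, -, hc, h1⟩ := pair_mem_relCode.1 h
      obtain ⟨-, -, hc', h2⟩ := pair_mem_relCode.1 h'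
      exact Subtype.mk.inj (f.injective (Subtype.ext (h1.symm.trans h2)))

namespace IsGraphSubmodel

variable {G : SimpleGraph V} {label : V ↪ ZFSet.{u}} {A : Set V} {μ κ Θ : Cardinal.{u}}
  {M : ZFSet.{u}}

/-- Outside any small set of `M` there is a scaffold in `M`. -/
theorem exists_isScaffold (hM : IsGraphSubmodel G label A μ Θ M) (hP : ManyDisjointPaths G κ A)
    (hμκ : μ < κ) (hY : ∀ Z : Set V, #Z < κ → ∃ (y : V) (D : Set Ordinal.{u})
      (g : Ordinal.{u} → V), IsApex G A μ y D g ∧ y ∉ Z ∧ ∀ ξ ∈ D, g ξ ∉ Z)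
    {Z : Set V} (hZ : codeSet label Z ∈ M) (hZκ : #Z < κ) :
    ∃ (y : V) (D : Set Ordinal.{u}) (g r : Ordinal.{u} → V), IsScaffold G A μ y D g r ∧
      (∀ v ∈ scaffoldSet μ y D g r, v ∉ Z ∧ label v ∈ M) ∧
      codeSet label (Z ∪ scaffoldSet μ y D g r) ∈ M ∧
      #(Z ∪ scaffoldSet μ y D g r : Set V) < κ := by
  obtain ⟨y₀, D₀, g₀, h₀, hy₀, hg₀⟩ := hY Z hZκ
  obtain ⟨y, D, g, hapex, hyZ, hyM, hg, hZ'⟩ := hM.exists_isApex hZ h₀ hy₀ hg₀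
  have hκ : ℵ₀ ≤ κ := hM.aleph0_le.trans hμκ.le
  have hcard : #(Z ∪ insert y (g '' D) : Set V) < κ := by
    refine (Cardinal.mk_union_le _ _).trans_lt (Cardinal.add_lt_of_lt hκ hZκ ?_)
    refine Cardinal.mk_insert_le.trans_lt (Cardinal.add_lt_of_lt hκ
      ((mk_image_le_of_subset_Iio hapex.subset g).trans_lt hμκ)
      (Cardinal.one_lt_aleph0.trans_le hκ))
  -- The apex and its chosen neighbours form a set coded in M, so a path avoiding them can be
  -- reflected together with the avoidance.
  obtain ⟨r₀, hr₀, hr₀Z⟩ := hP.exists_isConcentratedSeq hμκ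
    (Cardinal.aleph0_pos.trans_le hM.aleph0_le) hcard
  obtain ⟨r, hr, hrZ, hZ''⟩ := hM.exists_isConcentratedSeq hZ' hr₀ hr₀Z
  have heq : Z ∪ insert y (g '' D) ∪ r '' Set.Iio μ.ord = Z ∪ scaffoldSet μ y D g r := by
    rw [scaffoldSet, Set.union_assoc, Set.insert_union]
  rw [heq] at hZ''
  refine ⟨y, D, g, r, ⟨hr, hapex, fun ξ hξ h => ?_, fun ξ hξ η hη h => ?_⟩, ?_, hZ'', ?_⟩
  · exact (hrZ ξ hξ).1 (Or.inr (Or.inl h))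
  · exact (hrZ ξ hξ).1 (Or.inr (Or.inr ⟨η, hη, h.symm⟩))
  · rintro v (rfl | ⟨η, hη, rfl⟩ | ⟨ξ, hξ, rfl⟩)
    · exact ⟨hyZ, hyM⟩
    · exact hg η hη
    · exact ⟨fun h => (hrZ ξ hξ).1 (Or.inl h), (hrZ ξ hξ).2⟩
  · exact (Cardinal.mk_union_le _ _).trans_lt (Cardinal.add_lt_of_lt hκ hZκ
      ((mk_scaffoldSet_le hM.aleph0_le y hapex.subset g r).trans_lt hμκ))

theorem codeSet_preimage_mem (hM : IsGraphSubmodel G label A μ Θ M) {W : ZFSet.{u}} (hW : W ∈ M) :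
    codeSet label {v | label v ∈ W} ∈ M := by
  have h1 := hM.codeUniv_mem
  obtain ⟨x, hx, hxe⟩ := hM.elementary.exists_mem
    (P := fun x => ∀ z : hereditary Θ,
      ((z : ZFSet.{u}) ∈ (x : ZFSet.{u}) →
        ((z : ZFSet.{u}) ∈ codeSet label Set.univ ∧ (z : ZFSet.{u}) ∈ W)) ∧
      ((z : ZFSet.{u}) ∈ codeSet label Set.univ ∧ (z : ZFSet.{u}) ∈ W →
        (z : ZFSet.{u}) ∈ (x : ZFSet.{u})))
    (by
      repeat' first
        | exact ParamTerm.var _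
        | exact ParamTerm.const hM.elementary ‹_›
        | apply ParamDefinable.and
        | apply ParamDefinable.all
        | apply ParamDefinable.imp
        | apply ParamDefinable.mem)
    ⟨⟨codeSet label {v | label v ∈ W}, hM.codeSet_mem_hereditary _⟩, by
      intro z
      simp only [mem_codeSet, Set.mem_ofPred_eq, Set.mem_univ, true_and]
      constructor
      · rintro ⟨a, ha, hz⟩
        exact ⟨⟨a, hz⟩, hz ▸ ha⟩
      · rintro ⟨⟨a, hz⟩, ha⟩
        exact ⟨a, hz.symm ▸ ha, hz⟩⟩
  suffices codeSet label {v | label v ∈ W} = x by rwa [this]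
  ext z
  constructor
  · intro hz
    obtain ⟨v, hv, rfl⟩ := mem_codeSet.1 hz
    exact (hxe ⟨_, hM.label_mem_hereditary v⟩).2 ⟨label_mem_codeSet.2 (Set.mem_univ _), hv⟩
  · intro hz
    obtain ⟨hz1, hz2⟩ := (hxe ⟨z, hereditary_of_mem x.2 hz⟩).1 hz
    obtain ⟨v, -, rfl⟩ := mem_codeSet.1 hz1
    exact label_mem_codeSet.2 hz2

/-- Reflection to `M` of the existence of an edge outside `W` whose end `y` has infinitely many
`A`-neighbours in `W \ W'`. -/
theorem exists_edge_infinite (hM : IsGraphSubmodel G label A μ Θ M) {W W' : ZFSet.{u}} (hW : W ∈ M)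
    (hW' : W' ∈ M) {x y : V} (hx : x ∈ A) (hxW : label x ∉ W) (hyW : label y ∉ W)
    (hxy : G.Adj x y)
    (hinf : {z | G.Adj y z ∧ z ∈ A ∧ label z ∈ W ∧ label z ∉ W'}.Infinite) :
    ∃ x' ∈ A, ∃ y' : V, label x' ∈ M ∧ label y' ∈ M ∧ label x' ∉ W ∧ label y' ∉ W ∧
      G.Adj x' y' ∧ {z | G.Adj y' z ∧ z ∈ A ∧ label z ∈ W ∧ label z ∉ W'}.Infinite := by
  have h1 := hM.codeUniv_mem
  have h2 := hM.codeEdges_mem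
  have h3 := hM.aleph0_le_bound
  have h5 := hM.codeSet_mem
  -- Infinity is expressed by a non-empty, transitive, irreflexive relation in which every second
  -- coordinate occurs as a first coordinate.
  obtain ⟨yc, hyM, hyV, hyW', hx₀, r, hr1, hr2, hr3, hr4⟩ := hM.elementary.exists_mem
    (P := fun y => (y : ZFSet.{u}) ∈ codeSet label Set.univ ∧ ¬ (y : ZFSet.{u}) ∈ W ∧
      (∃ x : hereditary Θ, (x : ZFSet.{u}) ∈ codeSet label A ∧ ¬ (x : ZFSet.{u}) ∈ W ∧
        ({(x : ZFSet.{u}), (y : ZFSet.{u})} : ZFSet.{u}) ∈ codeEdges label G) ∧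
      ∃ r : hereditary Θ, (∃ a b : hereditary Θ, (a : ZFSet.{u}).pair b ∈ (r : ZFSet.{u})) ∧
        (∀ a b : hereditary Θ, (a : ZFSet.{u}).pair b ∈ (r : ZFSet.{u}) →
          ((b : ZFSet.{u}) ∈ codeSet label A ∧ (b : ZFSet.{u}) ∈ W ∧ ¬ (b : ZFSet.{u}) ∈ W' ∧
          ({(y : ZFSet.{u}), (b : ZFSet.{u})} : ZFSet.{u}) ∈ codeEdges label G) ∧
          ∃ c : hereditary Θ, (b : ZFSet.{u}).pair c ∈ (r : ZFSet.{u})) ∧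
        (∀ a b c : hereditary Θ, (a : ZFSet.{u}).pair b ∈ (r : ZFSet.{u}) →
          (b : ZFSet.{u}).pair c ∈ (r : ZFSet.{u}) → (a : ZFSet.{u}).pair c ∈ (r : ZFSet.{u})) ∧
        ∀ a : hereditary Θ, ¬ (a : ZFSet.{u}).pair a ∈ (r : ZFSet.{u}))
    (by
      repeat' first
        | exact ParamTerm.var _
        | exact ParamTerm.const hM.elementary ‹_›
        | apply ParamDefinable.not
        | apply ParamDefinable.and
        | apply ParamDefinable.ex
        | apply ParamDefinable.all
        | apply ParamDefinable.imp
        | apply ParamDefinable.pair_mem h3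
        | apply ParamDefinable.upair_mem h3
        | apply ParamDefinable.mem)
    (by
      -- Such a relation is the order of a sequence of distinct neighbours.
      let e := hinf.natEmbedding
      let q : ZFSet.{u} → ZFSet.{u} → Prop := fun a b =>
        ∃ m n, m < n ∧ a = label (e m) ∧ b = label (e n)
      have hq : ∀ {a b : ZFSet.{u}}, a.pair b ∈
          relCode (codeSet label Set.univ) (codeSet label Set.univ) q → q a b := fun h =>
        (pair_mem_relCode.1 h).2.2
      have hV := hM.elementary.mem_hereditary h1
      refine ⟨⟨label y, hM.label_mem_hereditary y⟩, label_mem_codeSet.2 (Set.mem_univ _), hyW,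
        ⟨⟨label x, hM.label_mem_hereditary x⟩, label_mem_codeSet.2 hx, hxW,
          upair_mem_codeEdges.2 hxy⟩, ⟨_, relCode_mem_hereditary h3 hV hV q⟩, ?_, ?_, ?_, ?_⟩
      · exact ⟨⟨label (e 0), hM.label_mem_hereditary _⟩, ⟨label (e 1), hM.label_mem_hereditary _⟩,
          pair_mem_relCode.2 ⟨label_mem_codeSet.2 (Set.mem_univ _),
            label_mem_codeSet.2 (Set.mem_univ _), 0, 1, Nat.zero_lt_one, rfl, rfl⟩⟩
      · intro a b hab
        obtain ⟨m, n, hmn, h1', h2'⟩ := hq hab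
        rw [h2', label_mem_codeSet, upair_mem_codeEdges]
        obtain ⟨q1, q2, q3, q4⟩ := (e n).2
        refine ⟨⟨q2, q3, q4, q1⟩, ⟨label (e (n + 1)), hM.label_mem_hereditary _⟩,
          pair_mem_relCode.2 ⟨label_mem_codeSet.2 (Set.mem_univ _),
            label_mem_codeSet.2 (Set.mem_univ _), n, n + 1, Nat.lt_succ_self n, rfl, rfl⟩⟩
      · intro a b c hab hbc
        obtain ⟨m, n, hmn, h1', h2'⟩ := hq hab
        obtain ⟨m', n', hmn', h1'', h2''⟩ := hq hbc
        have : n = m' := e.injective (Subtype.ext (label.injective (h2'.symm.trans h1'')))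
        subst this
        change (a : ZFSet.{u}).pair c ∈
          relCode (codeSet label Set.univ) (codeSet label Set.univ) q
        refine pair_mem_relCode.2 ⟨?_, ?_, m, n', hmn.trans hmn', h1', h2''⟩
        · rw [h1']; exact label_mem_codeSet.2 (Set.mem_univ _)
        · rw [h2'']; exact label_mem_codeSet.2 (Set.mem_univ _)
      · intro a haa
        obtain ⟨m, n, hmn, h1', h2'⟩ := hq haa
        have : m = n := e.injective (Subtype.ext (label.injective (h1'.symm.trans h2')))
        exact hmn.ne this)
  obtain ⟨xc, hxM, hxA, hxW', hxy'⟩ := hM.elementary.exists_mem (by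
    repeat' first
      | exact ParamTerm.var _
      | exact ParamTerm.const hM.elementary ‹_›
      | apply ParamDefinable.not
      | apply ParamDefinable.and
      | apply ParamDefinable.upair_mem h3
      | apply ParamDefinable.mem) hx₀
  obtain ⟨x', hx', hxe⟩ := mem_codeSet.1 hxA
  obtain ⟨y', -, hye⟩ := mem_codeSet.1 hyV
  rw [← hye] at hyM hyW' hxy'
  rw [← hxe] at hxM hxW' hxy'
  refine ⟨x', hx', y', hxM, hyM, hxW', hyW', upair_mem_codeEdges.1 hxy', fun hfin => ?_⟩
  let s := {b : V | ∃ a : hereditary Θ, (a : ZFSet.{u}).pair (label b) ∈ (r : ZFSet.{u})}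
  have hdec : ∀ a b : hereditary Θ, (a : ZFSet.{u}).pair b ∈ (r : ZFSet.{u}) →
      ∃ v ∈ s, (b : ZFSet.{u}) = label v := by
    intro a b hab
    obtain ⟨v, -, hv⟩ := mem_codeSet.1 (hr2 a b hab).1.1
    exact ⟨v, ⟨a, by rwa [hv]⟩, hv.symm⟩
  have hs : s.Finite := by
    refine hfin.subset ?_
    rintro b ⟨a, hab⟩
    obtain ⟨q1, q2, q3, q4⟩ := (hr2 a ⟨_, hM.label_mem_hereditary b⟩ hab).1
    rw [← hye] at q4
    exact ⟨upair_mem_codeEdges.1 q4, label_mem_codeSet.1 q1, q2, q3⟩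
  have hne : s.Nonempty := by
    obtain ⟨a, b, hab⟩ := hr1
    obtain ⟨v, hv, -⟩ := hdec a b hab
    exact ⟨v, hv⟩
  have : Finite s := hs
  have : Nonempty s := hne.to_subtype
  -- On a finite set the reversed relation is well-founded; a minimal element of it would have no
  -- successor under `r`.
  let R : s → s → Prop := fun b a => (label a).pair (label b) ∈ (r : ZFSet.{u})
  have htrans : IsTrans s R := ⟨fun a b c hab hbc => hr3 ⟨_, hM.label_mem_hereditary c⟩
    ⟨_, hM.label_mem_hereditary b⟩ ⟨_, hM.label_mem_hereditary a⟩ hbc hab⟩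
  have hirr : Std.Irrefl R := ⟨fun a => hr4 ⟨_, hM.label_mem_hereditary a⟩⟩
  have hwf : WellFounded R := Finite.wellFounded_of_trans_of_irrefl R
  obtain ⟨m, -, hm⟩ := hwf.has_min Set.univ Set.univ_nonempty
  obtain ⟨a, ha⟩ := m.2
  obtain ⟨c, hc⟩ := (hr2 a ⟨_, hM.label_mem_hereditary m⟩ ha).2
  obtain ⟨v, hv, hcv⟩ := hdec ⟨_, hM.label_mem_hereditary m⟩ c hc
  rw [hcv] at hc
  exact hm ⟨v, hv⟩ (Set.mem_univ _) hc

/-- Reflection to `M` of the existence of an edge outside `W` whose end `y` has `A`-neighbours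
in `W` outside any element of `W` smaller than `C`. -/
theorem exists_edge_unbounded (hM : IsGraphSubmodel G label A μ Θ M) {W C : ZFSet.{u}} (hW : W ∈ M)
    (hC : C ∈ M) {x y : V} (hx : x ∈ A) (hxW : label x ∉ W) (hyW : label y ∉ W)
    (hxy : G.Adj x y)
    (hinf : ∀ Z ∈ W, Z.card < C.card → ∃ z, G.Adj y z ∧ z ∈ A ∧ label z ∈ W ∧ label z ∉ Z) :
    ∃ x' ∈ A, ∃ y' : V, label x' ∈ M ∧ label y' ∈ M ∧ label x' ∉ W ∧ label y' ∉ W ∧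
      G.Adj x' y' ∧
      ∀ Z ∈ W, Z.card < C.card → ∃ z, G.Adj y' z ∧ z ∈ A ∧ label z ∈ W ∧ label z ∉ Z := by
  have h1 := hM.codeUniv_mem
  have h2 := hM.codeEdges_mem
  have h3 := hM.aleph0_le_bound
  have h5 := hM.codeSet_mem
  have hWH := hM.elementary.mem_hereditary hW
  have hCH := hM.elementary.mem_hereditary hC
  -- Smallness of Z enters as the absence of a partial map from Z onto `C`. The only parameters
  -- beyond the graph and `A` are `W` and `C`.
  obtain ⟨yc, hyM, hyV, hyW', hx₀, hZ⟩ := hM.elementary.exists_mem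
    (P := fun y => (y : ZFSet.{u}) ∈ codeSet label Set.univ ∧ ¬ (y : ZFSet.{u}) ∈ W ∧
      (∃ x : hereditary Θ, (x : ZFSet.{u}) ∈ codeSet label A ∧ ¬ (x : ZFSet.{u}) ∈ W ∧
        ({(x : ZFSet.{u}), (y : ZFSet.{u})} : ZFSet.{u}) ∈ codeEdges label G) ∧
      ∀ Z : hereditary Θ, (Z : ZFSet.{u}) ∈ W →
        ¬ (∃ r : hereditary Θ, (∀ c : hereditary Θ, (c : ZFSet.{u}) ∈ C → ∃ z : hereditary Θ,
          (z : ZFSet.{u}) ∈ (Z : ZFSet.{u}) ∧ (z : ZFSet.{u}).pair c ∈ (r : ZFSet.{u})) ∧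
          ∀ z c c' : hereditary Θ, (z : ZFSet.{u}).pair c ∈ (r : ZFSet.{u}) →
            (z : ZFSet.{u}).pair c' ∈ (r : ZFSet.{u}) → (c : ZFSet.{u}) = c') →
        ∃ z : hereditary Θ, (z : ZFSet.{u}) ∈ codeSet label A ∧ (z : ZFSet.{u}) ∈ W ∧
          ¬ (z : ZFSet.{u}) ∈ (Z : ZFSet.{u}) ∧
          ({(y : ZFSet.{u}), (z : ZFSet.{u})} : ZFSet.{u}) ∈ codeEdges label G)
    (by
      repeat' first
        | exact ParamTerm.var _
        | exact ParamTerm.const hM.elementary ‹_›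
        | apply ParamDefinable.not
        | apply ParamDefinable.and
        | apply ParamDefinable.ex
        | apply ParamDefinable.all
        | apply ParamDefinable.imp
        | apply ParamDefinable.pair_mem h3
        | apply ParamDefinable.upair_mem h3
        | apply ParamDefinable.mem
        | apply ParamDefinable.eq)
    ⟨⟨label y, hM.label_mem_hereditary y⟩, label_mem_codeSet.2 (Set.mem_univ _), hyW,
        ⟨⟨label x, hM.label_mem_hereditary x⟩, label_mem_codeSet.2 hx, hxW,
          upair_mem_codeEdges.2 hxy⟩, fun Z hZ hs => by
      rw [exists_surjective_code_iff h3 Z.2 hCH, not_le] at hs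
      obtain ⟨z, h1, h2, h3, h4⟩ := hinf Z hZ hs
      exact ⟨⟨label z, hM.label_mem_hereditary z⟩, label_mem_codeSet.2 h2, h3, h4,
        upair_mem_codeEdges.2 h1⟩⟩
  obtain ⟨xc, hxM, hxA, hxW', hxy'⟩ := hM.elementary.exists_mem (by
    repeat' first
      | exact ParamTerm.var _
      | exact ParamTerm.const hM.elementary ‹_›
      | apply ParamDefinable.not
      | apply ParamDefinable.and
      | apply ParamDefinable.upair_mem h3
      | apply ParamDefinable.mem) hx₀
  obtain ⟨x', hx', hxe⟩ := mem_codeSet.1 hxA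
  obtain ⟨y', -, hye⟩ := mem_codeSet.1 hyV
  rw [← hye] at hyM hyW' hxy' hZ
  rw [← hxe] at hxM hxW' hxy'
  refine ⟨x', hx', y', hxM, hyM, hxW', hyW', upair_mem_codeEdges.1 hxy', fun Z hZW hZC => ?_⟩
  obtain ⟨z, hzA, hzW, hzZ, hzy⟩ := hZ ⟨Z, hereditary_of_mem hWH hZW⟩ hZW (by
    rw [exists_surjective_code_iff h3 (hereditary_of_mem hWH hZW) hCH, not_le]
    exact hZC)
  obtain ⟨v, hv, hvz⟩ := mem_codeSet.1 hzA
  rw [← hvz] at hzW hzZ hzy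
  exact ⟨v, upair_mem_codeEdges.1 hzy, hv, hzW, hzZ⟩

end IsGraphSubmodel

end Reflection

/-! ### Rays covering a countable set, and concatenation of rays -/

section Rays

variable {V : Type u} {G : SimpleGraph V}

/-- A finite path that ends in `v` can be prolonged to one that contains `c`. -/
theorem exists_prolongation {B O : Set V} (hconn : ∀ v ∈ B, ∀ w ∈ B, v ≠ w → ∀ F : Set V, F.Finite →
      ∃ p : G.Walk v w, ∀ z ∈ p.support, z = v ∨ z = w ∨ (z ∈ O ∧ z ∉ F))
    {L : List V} (hne : L ≠ []) (hnd : L.Nodup) (hch : L.IsChain G.Adj) (hlast : L.getLast hne ∈ B)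
    {c : V} (hc : c ∈ B) :
    ∃ (L' : List V) (hne' : L' ≠ []), L'.Nodup ∧ L'.IsChain G.Adj ∧ L'.getLast hne' ∈ B ∧
      L <+: L' ∧ c ∈ L' ∧ ∀ z ∈ L', z ∈ L ∨ z = c ∨ z ∈ O := by
  classical
  by_cases hcL : c ∈ L
  · exact ⟨L, hne, hnd, hch, hlast, List.prefix_refl L, hcL, fun z hz => Or.inl hz⟩
  have hvc : L.getLast hne ≠ c := fun h => hcL (h ▸ List.getLast_mem hne)
  -- A walk to `c` off all of `L` except its last vertex; once shortened to a path, its tail can be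
  -- appended to `L`.
  obtain ⟨p, hp⟩ := hconn _ hlast c hc hvc {z | z ∈ L} L.finite_toSet
  have hq : ∀ z ∈ p.bypass.support, z = L.getLast hne ∨ z = c ∨ (z ∈ O ∧ z ∉ L) := fun z hz =>
    hp z (p.support_bypass_subset_support hz)
  have hnd' := p.bypass_isPath.support_nodup
  have hch' := p.bypass.isChain_adj_support
  have hlast' : p.bypass.support.getLast p.bypass.support_ne_nil = c := p.bypass.getLast_support
  have hcons := p.bypass.cons_tail_support.symm
  set t := p.bypass.support.tail with ht
  have htne : t ≠ [] := by
    intro h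
    simp only [hcons, h, List.getLast_singleton] at hlast'
    exact hvc hlast'
  have htlast : t.getLast htne = c := by
    simp only [hcons] at hlast'
    rwa [List.getLast_cons htne] at hlast'
  rw [hcons] at hnd' hch'
  have htL : ∀ z ∈ t, z = c ∨ (z ∈ O ∧ z ∉ L) := by
    intro z hz
    rcases hq z (by rw [hcons]; exact List.mem_cons_of_mem _ hz) with h | h
    · exact ((List.nodup_cons.1 hnd').1 (h ▸ hz)).elim
    · exact h
  refine ⟨L ++ t, by simp [hne], ?_, ?_, ?_, List.prefix_append L t, ?_, ?_⟩
  · refine hnd.append (List.nodup_cons.1 hnd').2 ?_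
    intro z hzL hzt
    rcases htL z hzt with rfl | h
    exacts [hcL hzL, h.2 hzL]
  · rw [List.isChain_append]
    rw [List.isChain_cons] at hch'
    refine ⟨hch, hch'.2, fun x hx y hy => ?_⟩
    rw [List.getLast?_eq_getLast_of_ne_nil hne, Option.mem_some_iff] at hx
    rw [← hx]
    exact hch'.1 y hy
  · rw [List.getLast_append_of_ne_nil _ htne, htlast]
    exact hc
  · rw [← htlast]
    exact List.mem_append_right _ (List.getLast_mem htne)
  · intro z hz
    rcases List.mem_append.1 hz with h | h
    · exact Or.inl h
    · exact Or.inr ((htL z h).imp_right And.left)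

/-- A finite path can be prolonged to a ray that covers a given infinite countable set `C`, if the
points of `C` are joined by paths inside `O` that avoid any finite set. -/
theorem exists_ray_covering {C O : Set V} {l : List V} (hne : l ≠ []) (hnd : l.Nodup)
    (hch : l.IsChain G.Adj) (hC : C.Countable) (hinf : C.Infinite)
    (hconn : ∀ v ∈ insert (l.getLast hne) C, ∀ w ∈ insert (l.getLast hne) C, v ≠ w →
      ∀ F : Set V, F.Finite → ∃ p : G.Walk v w, ∀ z ∈ p.support, z = v ∨ z = w ∨ (z ∈ O ∧ z ∉ F)) :
    ∃ s : ℕ → V, Function.Injective s ∧ (∀ n, G.Adj (s n) (s (n + 1))) ∧ s 0 = l.head hne ∧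
      C ⊆ Set.range s ∧ (∀ v ∈ l, v ∈ Set.range s) ∧ ∀ n, s n ∈ l ∨ s n ∈ C ∨ s n ∈ O := by
  obtain ⟨e, he⟩ := hC.exists_eq_range hinf.nonempty
  let S := {L : List V // ∃ h : L ≠ [], L.Nodup ∧ L.IsChain G.Adj ∧
    L.getLast h ∈ insert (l.getLast hne) C}
  have step : ∀ (L : S) (n : ℕ), ∃ L' : S, L.1 <+: L'.1 ∧ e n ∈ L'.1 ∧
      ∀ z ∈ L'.1, z ∈ L.1 ∨ z ∈ C ∨ z ∈ O := by
    rintro ⟨L, h1, h2, h3, h4⟩ n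
    have hen : e n ∈ C := he ▸ Set.mem_range_self n
    obtain ⟨L', g1, g2, g3, g4, g5, g6, g7⟩ := exists_prolongation hconn h1 h2 h3 h4
      (Set.mem_insert_of_mem _ hen)
    refine ⟨⟨L', g1, g2, g3, g4⟩, g5, g6, fun z hz => (g7 z hz).imp_right (Or.imp_left ?_)⟩
    rintro rfl
    exact hen
  choose f hf1 hf2 hf3 using step
  let L : ℕ → S := fun n => Nat.rec ⟨l, hne, hnd, hch, Set.mem_insert _ _⟩ (fun n L => f L n) n
  have hsucc : ∀ n, L (n + 1) = f (L n) n := fun n => rfl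
  have hpre : ∀ m n, m ≤ n → (L m).1 <+: (L n).1 := by
    intro m n hmn
    induction n, hmn using Nat.le_induction with
    | base => exact List.prefix_refl _
    | succ n _ ih => exact ih.trans (hf1 (L n) n)
  -- The lists grow beyond any length because together they contain the infinite set `C`.
  have hlen : ∀ k, ∃ n, k < (L n).1.length := by
    classical
    intro k
    obtain ⟨T, hTC, hT⟩ := hinf.exists_subset_card_eq (k + 1)
    have : ∀ T : Finset V, (T : Set V) ⊆ C → ∃ n, ∀ z ∈ T, z ∈ (L n).1 := by
      intro T
      induction T using Finset.induction_on with
      | empty => exact fun _ => ⟨0, by simp⟩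
      | insert a T _ ih =>
        intro hT
        rw [Finset.coe_insert, Set.insert_subset_iff] at hT
        obtain ⟨n, hn⟩ := ih hT.2
        obtain ⟨m, hm⟩ : a ∈ Set.range e := he ▸ hT.1
        refine ⟨max n (m + 1), fun z hz => ?_⟩
        rcases Finset.mem_insert.1 hz with rfl | hz
        · exact (hpre _ _ (le_max_right _ _)).subset (hm ▸ hf2 (L m) m)
        · exact (hpre _ _ (le_max_left _ _)).subset (hn z hz)
    obtain ⟨n, hn⟩ := this T hTC
    refine ⟨n, ?_⟩
    have h1 : T ⊆ (L n).1.toFinset := fun z hz => List.mem_toFinset.2 (hn z hz)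
    have h2 := (Finset.card_le_card h1).trans (List.toFinset_card_le _)
    omega
  choose N hN using hlen
  let s : ℕ → V := fun k => (L (N k)).1[k]'(hN k)
  have hs : ∀ k n (h : k < (L n).1.length), (L n).1[k] = s k := by
    intro k n h
    rcases le_total n (N k) with hle | hle
    · exact (hpre _ _ hle).getElem h
    · exact ((hpre _ _ hle).getElem (hN k)).symm
  have hmem : ∀ n, ∀ z ∈ (L n).1, z ∈ Set.range s := by
    intro n z hz
    obtain ⟨k, hk, rfl⟩ := List.mem_iff_getElem.1 hz
    exact ⟨k, (hs k n hk).symm⟩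
  refine ⟨s, fun i j hij => ?_, fun n => ?_, ?_, ?_, hmem 0, fun n => ?_⟩
  · have hi : i < (L (max (N i) (N j))).1.length :=
      (hN i).trans_le (hpre _ _ (le_max_left _ _)).length_le
    have hj : j < (L (max (N i) (N j))).1.length :=
      (hN j).trans_le (hpre _ _ (le_max_right _ _)).length_le
    rw [← hs i _ hi, ← hs j _ hj] at hij
    exact ((L _).2.choose_spec.1.getElem_inj_iff).1 hij
  · have h1 := hN (n + 1)
    have := List.isChain_iff_getElem.1 (L (N (n + 1))).2.choose_spec.2.1 n (by omega)
    rwa [hs, hs] at this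
  · rw [← hs 0 0 (List.length_pos_of_ne_nil hne)]
    exact List.getElem_zero _
  · rw [he]
    rintro _ ⟨n, rfl⟩
    exact hmem (n + 1) _ (hf2 (L n) n)
  · have : ∀ m, ∀ z ∈ (L m).1, z ∈ l ∨ z ∈ C ∨ z ∈ O := by
      intro m
      induction m with
      | zero => exact fun z hz => Or.inl hz
      | succ m ih =>
        intro z hz
        rcases hf3 (L m) m z hz with h | h
        exacts [ih z h, Or.inr h]
    exact this _ _ (List.getElem_mem (hN n))

/-- A sequence of disjoint rays, indexed by a well-order, such that the first vertex of each ray has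
cofinally many neighbours in `A` on the previous rays, forms a path concentrated on `A`. -/
theorem exists_transfinitePath_of_rays {A : Set V} {ι : Type*} [LinearOrder ι] [WellFoundedLT ι]
    (I : Set ι) (s : ι → ℕ → V)
    (hinj : ∀ i ∈ I, ∀ j ∈ I, ∀ m n, s i m = s j n → i = j ∧ m = n)
    (hadj : ∀ i ∈ I, ∀ n, G.Adj (s i n) (s i (n + 1)))
    (hlim : ∀ i ∈ I, ∀ j ∈ I, j < i → ∀ n, ∃ j' ∈ I, ∃ n', j' < i ∧ (j < j' ∨ j = j' ∧ n ≤ n') ∧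
      G.Adj (s j' n') (s i 0) ∧ s j' n' ∈ A) :
    ∃ P : TransfinitePath G, P.verts = {v | ∃ i ∈ I, ∃ n, s i n = v} ∧ P.ConcentratedOn A := by
  let S : Set V := {v | ∃ i ∈ I, ∃ n, s i n = v}
  have hpos : ∀ v : S, ∃ p : ι × ℕ, p.1 ∈ I ∧ s p.1 p.2 = v := by
    rintro ⟨v, i, hi, n, hn⟩
    exact ⟨(i, n), hi, hn⟩
  choose pos hposI hpos using hpos
  let vtx : ∀ i ∈ I, ℕ → S := fun i hi n => ⟨s i n, i, hi, n, rfl⟩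
  have hvtx : ∀ i (hi : i ∈ I) n, pos (vtx i hi n) = (i, n) := by
    intro i hi n
    have := hinj _ (hposI (vtx i hi n)) i hi _ _ (hpos (vtx i hi n))
    exact Prod.ext this.1 this.2
  have hsurj : ∀ v : S, ∃ i, ∃ hi : i ∈ I, ∃ n, vtx i hi n = v := fun v =>
    ⟨_, hposI v, _, Subtype.ext (hpos v)⟩
  let f : S → ι ×ₗ ℕ := fun v => toLex (pos v)
  have hf : Function.Injective f := by
    intro v w h
    have : pos v = pos w := toLex.injective h
    refine Subtype.ext ?_
    rw [← hpos v, ← hpos w, this]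
  have hlt : ∀ i (hi : i ∈ I) m j (hj : j ∈ I) n, f (vtx i hi m) < f (vtx j hj n) ↔
      i < j ∨ i = j ∧ m < n := by
    intro i hi m j hj n
    simp only [f, hvtx, Prod.Lex.toLex_lt_toLex]
  -- The order is lexicographic in ray and position. All edges of `G` between the vertices are kept,
  -- since extra edges do no harm.
  let P : TransfinitePath G :=
    { graph := (⊤ : G.Subgraph).induce S
      lt := fun v w : S => f v < f w
      wellOrder := (RelEmbedding.preimage ⟨f, hf⟩ ((· < ·) : ι ×ₗ ℕ → ι ×ₗ ℕ → Prop)).isWellOrder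
      cofinal := by
        intro u v huv
        obtain ⟨j, hj, k, rfl⟩ := hsurj u
        obtain ⟨i, hi, n, rfl⟩ := hsurj v
        change f (vtx j hj k) < f (vtx i hi n) at huv
        change ∃ w : S, ((⊤ : G.Subgraph).induce S).Adj w (s i n) ∧ f w < f (vtx i hi n) ∧
          ¬ f w < f (vtx j hj k)
        replace huv := (hlt _ hj _ _ hi _).1 huv
        rcases n with _ | n
        · have hji : j < i := by
            rcases huv with h | h
            exacts [h, absurd h.2 (Nat.not_lt_zero _)]
          obtain ⟨j', hj', n', hlt', hle, hA, -⟩ := hlim i hi j hj hji k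
          refine ⟨vtx j' hj' n', ⟨(vtx j' hj' n').2, (vtx i hi 0).2, hA⟩,
            (hlt _ hj' _ _ hi _).2 (Or.inl hlt'), ?_⟩
          intro h
          rcases (hlt _ hj' _ _ hj _).1 h with h | h
          · rcases hle with h' | h'
            exacts [lt_asymm h h', h.ne h'.1.symm]
          · rcases hle with h' | h'
            exacts [h'.ne h.1.symm, absurd h.2 (not_lt.2 h'.2)]
        · refine ⟨vtx i hi n, ⟨(vtx i hi n).2, (vtx i hi (n + 1)).2, hadj i hi n⟩,
            (hlt _ hi _ _ hi _).2 (Or.inr ⟨rfl, Nat.lt_succ_self n⟩), ?_⟩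
          intro h
          rcases (hlt _ hi _ _ hj _).1 h with h | h
          · rcases huv with h' | h'
            exacts [lt_asymm h h', h.ne h'.1.symm]
          · rcases huv with h' | h'
            · exact h'.ne h.1.symm
            · have := h.2; have := h'.2; omega }
  refine ⟨P, rfl, ?_⟩
  intro v hv u huv
  have hv' : (∃ x : S, f x < f v) ∧ ∀ x : S, f x < f v → ∃ z : S, f x < f z ∧ f z < f v := hv
  obtain ⟨j, hj, k, rfl⟩ := hsurj u
  obtain ⟨i, hi, n, rfl⟩ := hsurj v
  change f (vtx j hj k) < f (vtx i hi n) at huv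
  change ∃ w : S, ((⊤ : G.Subgraph).induce S).Adj w (s i n) ∧ (w : V) ∈ A ∧
    ¬ f w < f (vtx j hj k) ∧ f w < f (vtx i hi n)
  replace huv := (hlt _ hj _ _ hi _).1 huv
  rcases n with _ | n
  · have hji : j < i := by
      rcases huv with h | h
      exacts [h, absurd h.2 (Nat.not_lt_zero _)]
    obtain ⟨j', hj', n', hlt', hle, hA, hA'⟩ := hlim i hi j hj hji k
    refine ⟨vtx j' hj' n', ⟨(vtx j' hj' n').2, (vtx i hi 0).2, hA⟩, hA', ?_,
      (hlt _ hj' _ _ hi _).2 (Or.inl hlt')⟩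
    intro h
    rcases (hlt _ hj' _ _ hj _).1 h with h | h
    · rcases hle with h' | h'
      exacts [lt_asymm h h', h.ne h'.1.symm]
    · rcases hle with h' | h'
      exacts [h'.ne h.1.symm, absurd h.2 (not_lt.2 h'.2)]
  -- Position n + 1 has position n of the same ray as its immediate predecessor, so it is not a
  -- limit.
  · exfalso
    obtain ⟨z, hz1, hz2⟩ := hv'.2 (vtx i hi n) ((hlt _ hi _ _ hi _).2 (Or.inr ⟨rfl, Nat.lt_succ_self n⟩))
    obtain ⟨i', hi', m, rfl⟩ := hsurj z
    replace hz1 := (hlt _ hi _ _ hi' _).1 hz1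
    replace hz2 := (hlt _ hi' _ _ hi _).1 hz2
    rcases hz1 with h1 | h1 <;> rcases hz2 with h2 | h2
    · exact lt_asymm h1 h2
    · exact h1.ne h2.1.symm
    · exact h2.ne h1.1.symm
    · have := h1.2; have := h2.2; omega

end Rays

/-! ### Ordinals split into ω-blocks, and transfinite sequences of rays -/

section OmegaBlocks

theorem exists_eq_omega0_mul_add (ξ : Ordinal.{u}) :
    ∃ (q : Ordinal.{u}) (m : ℕ), ξ = Ordinal.omega0 * q + m := by
  obtain ⟨m, hm⟩ := Ordinal.lt_omega0.1 (Ordinal.mod_lt ξ Ordinal.omega0_ne_zero)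
  exact ⟨ξ / Ordinal.omega0, m, by rw [← hm, Ordinal.div_add_mod]⟩

theorem omega0_mul_add_lt_of_lt {q q' : Ordinal.{u}} (h : q < q') (m m' : ℕ) :
    Ordinal.omega0 * q + m < Ordinal.omega0 * q' + m' := by
  have h1 : Ordinal.omega0 * q + m < Ordinal.omega0 * (q + 1) := by
    rw [mul_add, mul_one]
    exact add_lt_add_right (Ordinal.natCast_lt_omega0 m) _
  have h2 : Ordinal.omega0 * (q + 1) ≤ Ordinal.omega0 * q' :=
    mul_le_mul_right (Order.add_one_le_of_lt h) _
  exact h1.trans_le (h2.trans le_self_add)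

theorem omega0_mul_add_le_iff {q q' : Ordinal.{u}} {m m' : ℕ} :
    Ordinal.omega0 * q + m ≤ Ordinal.omega0 * q' + m' ↔ q < q' ∨ q = q' ∧ m ≤ m' := by
  rcases lt_trichotomy q q' with h | rfl | h
  · exact ⟨fun _ => Or.inl h, fun _ => (omega0_mul_add_lt_of_lt h m m').le⟩
  · simp
  · refine ⟨fun h' => absurd (omega0_mul_add_lt_of_lt h m' m) (not_lt.2 h'), ?_⟩
    rintro (h' | h')
    exacts [absurd h (not_lt.2 h'.le), absurd h'.1 h.ne']

theorem omega0_mul_add_inj {q q' : Ordinal.{u}} {m m' : ℕ}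
    (h : Ordinal.omega0 * q + m = Ordinal.omega0 * q' + m') : q = q' ∧ m = m' := by
  have h1 := omega0_mul_add_le_iff.1 h.le
  have h2 := omega0_mul_add_le_iff.1 h.ge
  rcases h1 with h1 | h1 <;> rcases h2 with h2 | h2
  · exact absurd h1 h2.asymm
  · exact absurd h1 (h2.1 ▸ lt_irrefl _)
  · exact absurd h2 (h1.1 ▸ lt_irrefl _)
  · exact ⟨h1.1, le_antisymm h1.2 h2.2⟩

/-- An uncountable cardinal is closed under ω · q + m, so a path of order type μ splits into μ
blocks of type ω. -/
theorem omega0_mul_add_lt_ord {μ : Cardinal.{u}} (hμ : ℵ₀ < μ) {q : Ordinal.{u}} (hq : q < μ.ord)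
    (m : ℕ) : Ordinal.omega0 * q + m < μ.ord := by
  rw [Cardinal.lt_ord] at hq ⊢
  rw [Ordinal.card_add, Ordinal.card_mul, Ordinal.card_omega0, Ordinal.card_nat]
  exact Cardinal.add_lt_of_lt hμ.le (Cardinal.mul_lt_of_lt hμ.le hμ hq)
    ((Cardinal.natCast_lt_aleph0).trans hμ)

theorem exists_initial_segment {V : Type u} {G : SimpleGraph V} {h : ℕ → V}
    (hinj : Function.Injective h) (hadj : ∀ n, G.Adj (h n) (h (n + 1))) (n : ℕ) :
    ∃ (l : List V) (hne : l ≠ []), l.Nodup ∧ l.IsChain G.Adj ∧ l.head hne = h 0 ∧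
      l.getLast hne = h n ∧ ∀ z ∈ l, ∃ k, z = h k := by
  refine ⟨(List.range (n + 1)).map h, by simp, List.nodup_range.map hinj, ?_, ?_, ?_, ?_⟩
  · rw [List.isChain_iff_getElem]
    intro i hi
    simp [hadj]
  · simp [List.head_eq_getElem]
  · simp [List.getLast_eq_getElem]
  · intro z hz
    obtain ⟨k, -, rfl⟩ := List.mem_map.1 hz
    exact ⟨k, rfl⟩

/-- Well-founded recursion in which a ray depends on its predecessors only through the set of
vertices they use. -/
theorem exists_transfinite_rays {V : Type u} (F : Ordinal.{u} → Set V → ℕ → V) :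
    ∃ s : Ordinal.{u} → ℕ → V, ∀ i, s i = F i (⋃ j, ⋃ _ : j < i, Set.range (s j)) := by
  refine ⟨(Ordinal.lt_wf).fix fun i rec => F i (⋃ j, ⋃ h : j < i, Set.range (rec j h)), fun i => ?_⟩
  rw [WellFounded.fix_eq]

theorem mk_iUnion_range_lt {V : Type u} {μ : Cardinal.{u}} (hμ : ℵ₀ < μ) {i : Ordinal.{u}}
    (hi : i < μ.ord) (s : Ordinal.{u} → ℕ → V) :
    #(⋃ j, ⋃ _ : j < i, Set.range (s j) : Set V) < μ := by
  have heq : (⋃ j, ⋃ _ : j < i, Set.range (s j) : Set V) =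
      Set.range fun p : Set.Iio i × ℕ => s p.1 p.2 := by
    ext v
    simp only [Set.mem_iUnion, Set.mem_range, exists_prop, Prod.exists, Subtype.exists, Set.mem_Iio]
  rw [heq, ← Cardinal.lift_lt.{u, u + 1}]
  refine (Cardinal.mk_range_le_lift (f := fun p : Set.Iio i × ℕ => s p.1 p.2)).trans_lt ?_
  rw [Cardinal.lift_id'.{u, u + 1}, Cardinal.mk_prod, Cardinal.mk_Iio_ordinal]
  have := Cardinal.mul_lt_of_lt hμ.le (Cardinal.lt_ord.1 hi) hμ
  rw [← Cardinal.lift_lt.{u, u + 1}] at this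
  simpa using this

end OmegaBlocks

/-! ### Ray systems covering one stage -/

section RaySystem

variable {V : Type u} {G : SimpleGraph V}

/-- A sequence of rays inside `U`, of length `τ + 1`, that starts in `y₀`, covers `A ∩ U`, and has
infinitely many points of `N` on its last ray, such that the rays can be concatenated to a path
concentrated on `A`. -/
structure IsRaySystem (G : SimpleGraph V) (A U : Set V) (y₀ : V) (N : Set V) (τ : Ordinal.{u})
    (s : Ordinal.{u} → ℕ → V) : Prop where
  inj : ∀ i ≤ τ, ∀ j ≤ τ, ∀ m n, s i m = s j n → i = j ∧ m = n
  adj : ∀ i ≤ τ, ∀ n, G.Adj (s i n) (s i (n + 1))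
  start : s 0 0 = y₀
  mem : ∀ i ≤ τ, ∀ n, s i n ∈ U
  cover : ∀ a ∈ A, a ∈ U → ∃ i ≤ τ, ∃ n, s i n = a
  limit : ∀ i ≤ τ, ∀ j < i, ∀ n, ∃ j' < i, ∃ n', (j < j' ∨ j = j' ∧ n ≤ n') ∧
    G.Adj (s j' n') (s i 0) ∧ s j' n' ∈ A
  last : (N ∩ Set.range (s τ)).Infinite

/-- A single ray is enough. It starts with the edge from y₀ to x₀, so that it can be prolonged from
a point of `A`, and it covers all of A ∩ U, including `N`. -/
theorem exists_raySystem_of_countable {A U N : Set V} {x₀ y₀ : V} (hcount : (A ∩ U).Countable)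
    (hx₀ : x₀ ∈ A ∩ U) (hy₀ : y₀ ∈ U) (hadj : G.Adj y₀ x₀) (hN : N ⊆ A ∩ U) (hNinf : N.Infinite)
    (hconn : ∀ v ∈ A ∩ U, ∀ w ∈ A ∩ U, v ≠ w → ∀ F : Set V, F.Finite →
      ∃ p : G.Walk v w, ∀ z ∈ p.support, z = v ∨ z = w ∨ (z ∈ U ∧ z ∉ F)) :
    ∃ (τ : Ordinal.{u}) (s : Ordinal.{u} → ℕ → V), IsRaySystem G A U y₀ N τ s := by
  have hins : insert x₀ (A ∩ U) = A ∩ U := Set.insert_eq_self.2 hx₀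
  obtain ⟨s, h1, h2, h3, h4, h5, h6⟩ := exists_ray_covering (G := G) (C := A ∩ U) (O := U)
    (l := [y₀, x₀]) (by simp) (by simp [hadj.ne]) (by simp [hadj]) hcount (hNinf.mono hN) (by
      rw [show [y₀, x₀].getLast (by simp) = x₀ from rfl, hins]
      exact hconn)
  refine ⟨0, fun _ => s, ⟨fun i hi j hj m n h => ⟨?_, h1 h⟩, fun i _ => h2, h3, fun i _ n => ?_,
    fun a ha haU => ?_, fun i hi j hj => ?_, ?_⟩⟩
  · rw [nonpos_iff_eq_zero.1 hi, nonpos_iff_eq_zero.1 hj]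
  · rcases h6 n with h | h | h
    · simp only [List.mem_cons, List.not_mem_nil, or_false] at h
      rcases h with h | h
      exacts [h ▸ hy₀, h ▸ hx₀.2]
    · exact h.2
    · exact h
  · obtain ⟨n, hn⟩ := h4 ⟨ha, haU⟩
    exact ⟨0, le_rfl, n, hn⟩
  · exact absurd (hj.trans_le hi) not_lt_zero
  · rw [Set.inter_eq_left.2 (hN.trans h4)]
    exact hNinf

/-- The rays are indexed by i ≤ μ. For 0 < i < μ, ray i starts at the first vertex of block i of
`r`, which has neighbours in `A` cofinally in the earlier blocks; these lie on earlier rays, since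
each ray j < μ covers the `A`-vertices of block j. Ray μ starts at `y`, whose neighbours g j lie on
the rays j ∈ D, except for one. A ray meets the scaffold only in vertices reserved for it, and
elsewhere avoids all rays built before; this keeps the rays disjoint. -/
theorem exists_raySystem_of_scaffold {A U N : Set V} {x₀ y₀ : V} {μ : Cardinal.{u}} (hμ : ℵ₀ < μ)
    (hcard : #(A ∩ U : Set V) ≤ μ) (hx₀ : x₀ ∈ A ∩ U) (hy₀ : y₀ ∈ U) (hadj₀ : G.Adj y₀ x₀)
    (hN : N ⊆ A ∩ U) (hNinf : N.Infinite) (hNc : N.Countable)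
    {y : V} {D : Set Ordinal.{u}} {g r : Ordinal.{u} → V} (hS : IsScaffold G A μ y D g r)
    (hSU : scaffoldSet μ y D g r ⊆ U) (hx₀S : x₀ ∉ scaffoldSet μ y D g r)
    (hy₀S : y₀ ∉ scaffoldSet μ y D g r) (hNS : ∀ v ∈ N, v ∉ scaffoldSet μ y D g r)
    (hx₀N : x₀ ∉ N) (hy₀N : y₀ ∉ N)
    (hconn : ∀ v ∈ A ∩ U, ∀ w ∈ A ∩ U, v ≠ w → ∀ F : Set V, #F < μ →
      ∃ p : G.Walk v w, ∀ z ∈ p.support, z = v ∨ z = w ∨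
        (z ∈ U ∧ z ∉ scaffoldSet μ y D g r ∧ z ∉ F)) :
    ∃ (τ : Ordinal.{u}) (s : Ordinal.{u} → ℕ → V), IsRaySystem G A U y₀ N τ s := by
  classical
  set S := scaffoldSet μ y D g r with hSdef
  have hpos : 0 < μ.ord := Cardinal.ord_pos.2 (Cardinal.aleph0_pos.trans hμ)
  have hyS : y ∈ S := Or.inl rfl
  have hgS : ∀ ξ ∈ D, g ξ ∈ S := fun ξ hξ => Or.inr (Or.inl ⟨ξ, hξ, rfl⟩)
  have hrS : ∀ ξ < μ.ord, r ξ ∈ S := fun ξ hξ => Or.inr (Or.inr ⟨ξ, hξ, rfl⟩)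
  have hgB : ∀ ξ ∈ D, g ξ ∈ A ∩ U := fun ξ hξ => ⟨hS.apex.mem ξ hξ, hSU (hgS ξ hξ)⟩
  -- the blocks of the path `r`
  let ρ : Ordinal.{u} → ℕ → V := fun i k => r (Ordinal.omega0 * i + k)
  have hρlt : ∀ i < μ.ord, ∀ k : ℕ, Ordinal.omega0 * i + k < μ.ord := fun i hi k =>
    omega0_mul_add_lt_ord hμ hi k
  have hρS : ∀ i < μ.ord, ∀ k, ρ i k ∈ S := fun i hi k => hrS _ (hρlt i hi k)
  have hρinj : ∀ i < μ.ord, ∀ j < μ.ord, ∀ k k', ρ i k = ρ j k' → i = j ∧ k = k' :=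
    fun i hi j hj k k' h => omega0_mul_add_inj (hS.seq.injOn (hρlt i hi k) (hρlt j hj k') h)
  have hρadj : ∀ i < μ.ord, ∀ k, G.Adj (ρ i k) (ρ i (k + 1)) := by
    intro i hi k
    obtain ⟨ζ, h1, h2, h3⟩ := hS.seq.cofinal _ (hρlt i hi (k + 1)) (Ordinal.omega0 * i + k)
      (by simp)
    have : ζ = Ordinal.omega0 * i + k := by
      refine le_antisymm ?_ h1
      rw [Nat.cast_succ, ← add_assoc] at h2
      exact Order.lt_add_one_iff.1 h2
    rwa [this] at h3
  -- limit property, in terms of blocks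
  have hρlim : ∀ i < μ.ord, ∀ j < i, ∀ k : ℕ, ∃ (j' : Ordinal.{u}) (k' : ℕ), j' < i ∧
      (j < j' ∨ j = j' ∧ k ≤ k') ∧ G.Adj (ρ j' k') (ρ i 0) ∧ ρ j' k' ∈ A := by
    intro i hi j hj k
    have hlt : ∀ (q : Ordinal.{u}) (m : ℕ), Ordinal.omega0 * q + m < Ordinal.omega0 * i + (0 : ℕ) ↔
        q < i := by
      intro q m
      rw [← not_le, omega0_mul_add_le_iff, not_or, not_lt]
      constructor
      · rintro ⟨h1, h2⟩
        exact lt_of_le_of_ne h1 fun h => h2 ⟨h.symm, Nat.zero_le _⟩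
      · intro h
        exact ⟨h.le, fun h' => h.ne h'.1.symm⟩
    obtain ⟨ζ, h1, h2, h3, h4⟩ := hS.seq.limit _ (hρlt i hi 0) (by
      intro ξ hξ
      obtain ⟨q, m, rfl⟩ := exists_eq_omega0_mul_add ξ
      refine ⟨Ordinal.omega0 * q + (m + 1 : ℕ), (hlt _ _).2 ((hlt _ _).1 hξ), ?_⟩
      simp) (Ordinal.omega0 * j + k) ((hlt _ _).2 hj)
    obtain ⟨q, m, rfl⟩ := exists_eq_omega0_mul_add ζ
    exact ⟨q, m, (hlt _ _).1 h2, omega0_mul_add_le_iff.1 h1, h3, h4⟩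
  let T : Ordinal.{u} → Set V := fun i => {v | v ∈ A ∧ ∃ k, ρ i k = v}
  have hsuccμ : ∀ i < μ.ord, i + 1 < μ.ord := fun i hi =>
    (Cardinal.isSuccLimit_ord hμ.le).succ_lt hi
  -- The first vertex of block i + 1 has neighbours in `A` cofinally in block i, so this block
  -- contains infinitely many points of `A`.
  have hTex : ∀ i < μ.ord, ∀ k, ∃ k', k ≤ k' ∧ ρ i k' ∈ A := by
    intro i hi k
    obtain ⟨j', k', h1, h2, -, h4⟩ := hρlim (i + 1) (hsuccμ i hi) i (lt_add_one i) k
    rcases h2 with h2 | ⟨rfl, h2⟩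
    · exact absurd (Order.lt_add_one_iff.1 h1) (not_le.2 h2)
    · exact ⟨k', h2, h4⟩
  have hTinf : ∀ i < μ.ord, (T i).Infinite := by
    intro i hi
    have hinf : {k | ρ i k ∈ A}.Infinite := by
      rw [Set.infinite_iff_exists_gt]
      intro k
      obtain ⟨k', h1, h2⟩ := hTex i hi (k + 1)
      exact ⟨k', h2, h1⟩
    refine (hinf.image fun k _ k' _ h => (hρinj i hi i hi k k' h).2).mono ?_
    rintro _ ⟨k, hk, rfl⟩
    exact ⟨hk, k, rfl⟩
  have hTB : ∀ i < μ.ord, T i ⊆ A ∩ U := by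
    rintro i hi _ ⟨hA, k, rfl⟩
    exact ⟨hA, hSU (hρS i hi k)⟩
  -- the last ray
  obtain ⟨d₀, hd₀, -⟩ := hS.apex.unbounded 0 hpos
  have hyz : G.Adj y (g d₀) := hS.apex.adj d₀ hd₀
  have hfin2 : ∀ a b : V, #({a, b} : Set V) < μ := fun a b =>
    (Set.toFinite ({a, b} : Set V)).lt_aleph0.trans hμ
  -- The last ray is built first, so that the others can avoid its countably many vertices. Since
  -- `y` need not lie in `A`, the neighbour `g d₀` is spent here as a point of `A` from which to
  -- prolong. The ends of the starting edge are left to ray 0.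
  obtain ⟨t, ht1, ht2, ht3, ht4, ht5, ht6⟩ := exists_ray_covering (G := G) (C := N)
    (O := {z | z ∈ U ∧ z ∉ S ∧ z ≠ x₀ ∧ z ≠ y₀}) (l := [y, g d₀]) (by simp) (by simp [hyz.ne])
    (by simp [hyz]) hNc hNinf (by
      have hsub : insert (g d₀) N ⊆ A ∩ U := Set.insert_subset_iff.2 ⟨hgB _ hd₀, hN⟩
      intro v hv w hw hvw F hF
      obtain ⟨p, hp⟩ := hconn v (hsub hv) w (hsub hw) hvw (F ∪ {x₀, y₀})
        (((hF.union (Set.toFinite _)).lt_aleph0).trans hμ)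
      refine ⟨p, fun z hz => (hp z hz).imp_right (Or.imp_right ?_)⟩
      rintro ⟨h1, h2, h3⟩
      simp only [Set.mem_union, Set.mem_insert_iff, Set.mem_singleton_iff, not_or] at h3
      exact ⟨⟨h1, h2, h3.2.1, h3.2.2⟩, h3.1⟩)
  have htS : ∀ v ∈ Set.range t, v ∈ S → v = y ∨ v = g d₀ := by
    rintro _ ⟨n, rfl⟩ hv
    rcases ht6 n with h | h | h
    · simpa using h
    · exact (hNS _ h hv).elim
    · exact (h.2.1 hv).elim
  have htx : x₀ ∉ Set.range t := by
    rintro ⟨n, hn⟩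
    rcases ht6 n with h | h | h
    · simp only [List.mem_cons, List.not_mem_nil, or_false] at h
      rw [hn] at h
      rcases h with h | h
      exacts [hx₀S (h ▸ hyS), hx₀S (h ▸ hgS _ hd₀)]
    · exact hx₀N (hn ▸ h)
    · exact h.2.2.1 hn
  have hty : y₀ ∉ Set.range t := by
    rintro ⟨n, hn⟩
    rcases ht6 n with h | h | h
    · simp only [List.mem_cons, List.not_mem_nil, or_false] at h
      rw [hn] at h
      rcases h with h | h
      exacts [hy₀S (h ▸ hyS), hy₀S (h ▸ hgS _ hd₀)]
    · exact hy₀N (hn ▸ h)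
    · exact h.2.2.2 hn
  have htU : ∀ n, t n ∈ U := by
    intro n
    rcases ht6 n with h | h | h
    · simp only [List.mem_cons, List.not_mem_nil, or_false] at h
      rcases h with h | h
      exacts [h ▸ hSU hyS, h ▸ hSU (hgS _ hd₀)]
    · exact (hN h).2
    · exact h.1
  -- an enumeration of `A ∩ U`
  obtain ⟨e, heB, he⟩ : ∃ e : Ordinal.{u} → V, (∀ i, e i ∈ A ∩ U) ∧
      ∀ a ∈ A ∩ U, ∃ i < μ.ord, e i = a := by
    have hle : lift.{u + 1} #(A ∩ U : Set V) ≤ lift.{u} #(Set.Iio μ.ord) := by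
      rw [Cardinal.mk_Iio_ordinal, Cardinal.card_ord, Cardinal.lift_id'.{u, u + 1}]
      exact Cardinal.lift_le.2 hcard
    obtain ⟨f⟩ := Cardinal.lift_mk_le'.1 hle
    have hinv : ∀ i : Ordinal.{u}, ∃ a ∈ A ∩ U, ∀ b : (A ∩ U : Set V), (f b : Ordinal.{u}) = i →
        (b : V) = a := by
      intro i
      by_cases h : ∃ b, (f b : Ordinal.{u}) = i
      · obtain ⟨b, hb⟩ := h
        exact ⟨b, b.2, fun c hc => congrArg _ (f.injective (Subtype.ext (hc.trans hb.symm)))⟩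
      · exact ⟨x₀, hx₀, fun b hb => (h ⟨b, hb⟩).elim⟩
    choose e he1 he2 using hinv
    exact ⟨e, he1, fun a ha => ⟨f ⟨a, ha⟩, (f ⟨a, ha⟩).2, (he2 _ ⟨a, ha⟩ rfl).symm⟩⟩
  -- the initial segments of the rays
  have hl : ∀ i < μ.ord, ∃ (l : List V) (hne : l ≠ []), l.Nodup ∧ l.IsChain G.Adj ∧
      l.getLast hne ∈ A ∩ U ∧ l.head hne = (if i = 0 then y₀ else ρ i 0) ∧
      ∀ z ∈ l, (i = 0 ∧ (z = y₀ ∨ z = x₀)) ∨ ∃ k, z = ρ i k := by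
    intro i hi
    by_cases h0 : i = 0
    · exact ⟨[y₀, x₀], by simp, by simp [hadj₀.ne], by simp [hadj₀], hx₀, by simp [h0],
        fun z hz => Or.inl ⟨h0, by simpa using hz⟩⟩
    · obtain ⟨k, -, hk⟩ := hTex i hi 0
      obtain ⟨l, hne, h1, h2, h3, h4, h5⟩ := exists_initial_segment
        (fun k k' h => (hρinj i hi i hi k k' h).2) (hρadj i hi) k
      refine ⟨l, hne, h1, h2, ?_, by rw [h3, if_neg h0], fun z hz => Or.inr (h5 z hz)⟩
      rw [h4]
      exact hTB i hi ⟨hk, k, rfl⟩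
  -- What ray i must cover: the `A`-vertices of its block, its neighbour of `y` unless this is `g
  -- d₀`, and the i-th point of A ∩ U unless another ray or the scaffold takes care of it.
  let X : Ordinal.{u} → Set V → Set V := fun i used =>
    T i ∪ {v | i ∈ D ∧ i ≠ d₀ ∧ v = g i} ∪ {v | v = e i ∧ v ∉ S ∧ v ∉ Set.range t ∧ v ∉ used}
  have hXB : ∀ i < μ.ord, ∀ used, X i used ⊆ A ∩ U := by
    rintro i hi used v ((h | ⟨h, -, rfl⟩) | ⟨rfl, -⟩)
    exacts [hTB i hi h, hgB _ h, heB i]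
  -- the construction of a single ray
  have hstep : ∀ (i : Ordinal.{u}) (used : Set V), ∃ s : ℕ → V, i < μ.ord → #used < μ →
      Function.Injective s ∧ (∀ n, G.Adj (s n) (s (n + 1))) ∧
      s 0 = (if i = 0 then y₀ else ρ i 0) ∧ X i used ⊆ Set.range s ∧
      ∀ n, (i = 0 ∧ (s n = y₀ ∨ s n = x₀)) ∨ (∃ k, s n = ρ i k) ∨ s n ∈ X i used ∨
        (s n ∈ U ∧ s n ∉ S ∧ s n ∉ Set.range t ∧ s n ∉ used ∧ s n ≠ x₀ ∧ s n ≠ y₀) := by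
    intro i used
    by_cases hi : i < μ.ord
    swap
    · exact ⟨fun _ => x₀, fun h => (hi h).elim⟩
    by_cases hu : #used < μ
    swap
    · exact ⟨fun _ => x₀, fun _ h => (hu h).elim⟩
    obtain ⟨l, hne, hl1, hl2, hl3, hl4, hl5⟩ := hl i hi
    have hXc : (X i used).Countable := by
      refine (Set.Countable.union ?_ ?_).union ?_
      · refine (Set.countable_range (ρ i)).mono ?_
        rintro v ⟨-, k, hk⟩
        exact ⟨k, hk⟩
      · exact (Set.countable_singleton (g i)).mono fun v hv => hv.2.2
      · exact (Set.countable_singleton (e i)).mono fun v hv => hv.1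
    have hXinf : (X i used).Infinite := (hTinf i hi).mono fun v hv => Or.inl (Or.inl hv)
    obtain ⟨s, h1, h2, h3, h4, -, h6⟩ := exists_ray_covering (G := G) (C := X i used)
      (O := {z | z ∈ U ∧ z ∉ S ∧ z ∉ Set.range t ∧ z ∉ used ∧ z ≠ x₀ ∧ z ≠ y₀}) hne hl1 hl2 hXc
      hXinf (by
        have hsub : insert (l.getLast hne) (X i used) ⊆ A ∩ U :=
          Set.insert_subset_iff.2 ⟨hl3, hXB i hi used⟩
        intro v hv w hw hvw F hF
        -- Finitely many vertices, the countable ray `t` and the earlier rays together are fewer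
        -- than μ.
        obtain ⟨p, hp⟩ := hconn v (hsub hv) w (hsub hw) hvw ((F ∪ {x₀, y₀} ∪ Set.range t) ∪ used) (by
          refine (Cardinal.mk_union_le _ _).trans_lt (Cardinal.add_lt_of_lt hμ.le ?_ hu)
          refine lt_of_le_of_lt ?_ hμ
          rw [Cardinal.le_aleph0_iff_set_countable]
          exact (hF.countable.union (Set.toFinite _).countable).union (Set.countable_range t))
        refine ⟨p, fun z hz => (hp z hz).imp_right (Or.imp_right ?_)⟩
        rintro ⟨q1, q2, q3⟩
        simp only [Set.mem_union, Set.mem_insert_iff, Set.mem_singleton_iff, not_or] at q3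
        exact ⟨⟨q1, q2, q3.1.2, q3.2, q3.1.1.2.1, q3.1.1.2.2⟩, q3.1.1.1⟩)
    refine ⟨s, fun _ _ => ⟨h1, h2, h3.trans hl4, h4, fun n => ?_⟩⟩
    rcases h6 n with h | h
    · rcases hl5 _ h with h | h
      exacts [Or.inl h, Or.inr (Or.inl h)]
    · exact Or.inr (Or.inr h)
  choose F hF using hstep
  obtain ⟨s, hs⟩ := exists_transfinite_rays F
  let used : Ordinal.{u} → Set V := fun i => ⋃ j, ⋃ _ : j < i, Set.range (s j)
  have hused : ∀ i, ∀ j < i, ∀ n, s j n ∈ used i := fun i j hj n =>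
    Set.mem_iUnion.2 ⟨j, Set.mem_iUnion.2 ⟨hj, n, rfl⟩⟩
  have hspec : ∀ i < μ.ord, Function.Injective (s i) ∧ (∀ n, G.Adj (s i n) (s i (n + 1))) ∧
      s i 0 = (if i = 0 then y₀ else ρ i 0) ∧ X i (used i) ⊆ Set.range (s i) ∧
      ∀ n, (i = 0 ∧ (s i n = y₀ ∨ s i n = x₀)) ∨ (∃ k, s i n = ρ i k) ∨ s i n ∈ X i (used i) ∨
        (s i n ∈ U ∧ s i n ∉ S ∧ s i n ∉ Set.range t ∧ s i n ∉ used i ∧ s i n ≠ x₀ ∧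
          s i n ≠ y₀) := by
    intro i hi
    have := hF i (used i) hi (mk_iUnion_range_lt hμ hi s)
    rwa [← hs i] at this
  -- the position of the vertices of a ray with respect to the scaffold
  have hkind : ∀ i < μ.ord, ∀ n, (i = 0 ∧ (s i n = y₀ ∨ s i n = x₀)) ∨ (∃ k, s i n = ρ i k) ∨
      (i ∈ D ∧ i ≠ d₀ ∧ s i n = g i) ∨
      (s i n ∈ U ∧ s i n ∉ S ∧ s i n ∉ Set.range t ∧ s i n ∉ used i) := by
    intro i hi n
    rcases (hspec i hi).2.2.2.2 n with h | h | h | h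
    · exact Or.inl h
    · exact Or.inr (Or.inl h)
    · rcases h with (⟨-, k, hk⟩ | h) | ⟨h1, h2, h3, h4⟩
      · exact Or.inr (Or.inl ⟨k, hk.symm⟩)
      · exact Or.inr (Or.inr (Or.inl h))
      · exact Or.inr (Or.inr (Or.inr ⟨h1 ▸ (heB i).2, h2, h3, h4⟩))
    · exact Or.inr (Or.inr (Or.inr ⟨h.1, h.2.1, h.2.2.1, h.2.2.2.1⟩))
  have hmemU : ∀ i < μ.ord, ∀ n, s i n ∈ U := by
    intro i hi n
    rcases hkind i hi n with ⟨-, h | h⟩ | ⟨k, h⟩ | ⟨h1, -, h⟩ | h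
    · exact h ▸ hy₀
    · exact h ▸ hx₀.2
    · exact h ▸ hSU (hρS i hi k)
    · exact h ▸ (hgB i h1).2
    · exact h.1
  have hnt : ∀ i < μ.ord, ∀ n, s i n ∉ Set.range t := by
    intro i hi n hn
    rcases hkind i hi n with ⟨-, h | h⟩ | ⟨k, h⟩ | ⟨h1, h2, h⟩ | h
    · exact hty (h ▸ hn)
    · exact htx (h ▸ hn)
    · rw [h] at hn
      rcases htS _ hn (hρS i hi k) with h' | h'
      exacts [hS.ne_apex _ (hρlt i hi k) h', hS.ne_value _ (hρlt i hi k) d₀ hd₀ h']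
    · rw [h] at hn
      rcases htS _ hn (hgS i h1) with h' | h'
      exacts [(hS.apex.adj i h1).ne h'.symm, h2 (hS.apex.injOn h1 hd₀ h')]
    · exact h.2.2.1 hn
  have hdisj : ∀ i < μ.ord, ∀ j < i, ∀ m n, s i m ≠ s j n := by
    intro i hi j hj m n heq
    have hjμ := hj.trans hi
    have hi0 : i ≠ 0 := ((zero_le (a := j)).trans_lt hj).ne'
    have hmem := hused i j hj n
    rcases hkind i hi m with ⟨h, -⟩ | ⟨k, h⟩ | ⟨h1, h2, h⟩ | h
    · exact hi0 h
    · rw [h] at heq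
      rcases hkind j hjμ n with ⟨-, h' | h'⟩ | ⟨k', h'⟩ | ⟨h1', h2', h'⟩ | h' 
      · exact hy₀S (h' ▸ heq ▸ hρS i hi k)
      · exact hx₀S (h' ▸ heq ▸ hρS i hi k)
      · exact hj.ne' (hρinj i hi j hjμ k k' (heq.trans h')).1
      · exact hS.ne_value _ (hρlt i hi k) j h1' (heq.trans h')
      · exact h'.2.1 (heq ▸ hρS i hi k)
    · rw [h] at heq
      rcases hkind j hjμ n with ⟨-, h' | h'⟩ | ⟨k', h'⟩ | ⟨h1', h2', h'⟩ | h'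
      · exact hy₀S (h' ▸ heq ▸ hgS i h1)
      · exact hx₀S (h' ▸ heq ▸ hgS i h1)
      · exact hS.ne_value _ (hρlt j hjμ k') i h1 (heq.trans h').symm
      · exact hj.ne' (hS.apex.injOn h1 h1' (heq.trans h'))
      · exact h'.2.1 (heq ▸ hgS i h1)
    · exact h.2.2.2 (heq ▸ hmem)
  -- the points of the scaffold are on the rays
  have hρcov : ∀ i < μ.ord, ∀ k, ρ i k ∈ A → ∃ n, s i n = ρ i k := fun i hi k hk =>
    (hspec i hi).2.2.2.1 (Or.inl (Or.inl ⟨hk, k, rfl⟩))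
  have hgcov : ∀ i ∈ D, i ≠ d₀ → ∃ n, s i n = g i := fun i hi h0 =>
    (hspec i (hS.apex.subset hi)).2.2.2.1 (Or.inl (Or.inr ⟨hi, h0, rfl⟩))
  let s' : Ordinal.{u} → ℕ → V := fun i => if i < μ.ord then s i else t
  have hs' : ∀ i < μ.ord, s' i = s i := fun i hi => if_pos hi
  have hst : s' μ.ord = t := if_neg (lt_irrefl _)
  refine ⟨μ.ord, s', ⟨fun i hi j hj m n h => ?_, fun i hi n => ?_, ?_, fun i hi n => ?_,
    fun a haA haU => ?_, fun i hi j hj n => ?_, ?_⟩⟩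
  · rcases hi.lt_or_eq with hi' | rfl <;> rcases hj.lt_or_eq with hj' | rfl
    · rw [hs' i hi', hs' j hj'] at h
      rcases lt_trichotomy i j with hij | rfl | hij
      · exact (hdisj j hj' i hij n m h.symm).elim
      · exact ⟨rfl, (hspec i hi').1 h⟩
      · exact (hdisj i hi' j hij m n h).elim
    · rw [hs' i hi', hst] at h
      exact (hnt i hi' m ⟨n, h.symm⟩).elim
    · rw [hs' j hj', hst] at h
      exact (hnt j hj' n ⟨m, h⟩).elim
    · rw [hst] at h
      exact ⟨rfl, ht1 h⟩
  · rcases hi.lt_or_eq with hi' | rfl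
    · rw [hs' i hi']
      exact (hspec i hi').2.1 n
    · rw [hst]
      exact ht2 n
  · rw [hs' 0 hpos, (hspec 0 hpos).2.2.1, if_pos rfl]
  · rcases hi.lt_or_eq with hi' | rfl
    · rw [hs' i hi']
      exact hmemU i hi' n
    · rw [hst]
      exact htU n
  · have hlift : (∃ i < μ.ord, ∃ n, s i n = a) → ∃ i ≤ μ.ord, ∃ n, s' i n = a := by
      rintro ⟨i, hi, n, hn⟩
      exact ⟨i, hi.le, n, by rw [hs' i hi, hn]⟩
    have hliftt : a ∈ Set.range t → ∃ i ≤ μ.ord, ∃ n, s' i n = a := by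
      rintro ⟨n, hn⟩
      exact ⟨μ.ord, le_rfl, n, by rw [hst, hn]⟩
    by_cases haS : a ∈ S
    · rcases haS with rfl | ⟨ξ, hξ, rfl⟩ | ⟨ξ, hξ, rfl⟩
      · exact hliftt (ht5 _ (by simp))
      · by_cases h0 : ξ = d₀
        · subst h0
          exact hliftt (ht5 _ (by simp))
        · exact hlift ⟨ξ, hS.apex.subset hξ, hgcov ξ hξ h0⟩
      · obtain ⟨q, m, rfl⟩ := exists_eq_omega0_mul_add ξ
        have hq : q < μ.ord := by
          refine lt_of_le_of_lt ?_ hξ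
          exact (le_mul_of_one_le_left (zero_le) Ordinal.one_lt_omega0.le).trans le_self_add
        exact hlift ⟨q, hq, hρcov q hq m haA⟩
    by_cases hat : a ∈ Set.range t
    · exact hliftt hat
    obtain ⟨i, hi, rfl⟩ := he a ⟨haA, haU⟩
    by_cases hau : e i ∈ used i
    · obtain ⟨j, hj⟩ := Set.mem_iUnion.1 hau
      obtain ⟨hji, n, hn⟩ := Set.mem_iUnion.1 hj
      exact hlift ⟨j, hji.trans hi, n, hn⟩
    · exact hlift ⟨i, hi, (hspec i hi).2.2.2.1 (Or.inr ⟨rfl, haS, hat, hau⟩)⟩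
  · rcases hi.lt_or_eq with hi' | rfl
    · have hjμ := hj.trans hi'
      have hi0 : i ≠ 0 := ((zero_le (a := j)).trans_lt hj).ne'
      -- Ray j may visit its block in a different order. A bound `K` on the indices of the block
      -- vertices among its first n vertices ensures that those of index at least `K` occur at
      -- position n or later.
      obtain ⟨K, hK⟩ : ∃ K, ∀ k n', n' < n → s j n' = ρ j k → k < K := by
        have hfin : {k | ∃ n' < n, s j n' = ρ j k}.Finite := by
          refine Set.Finite.of_finite_image (f := ρ j) ?_
            fun k _ k' _ h => (hρinj j hjμ j hjμ k k' h).2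
          refine ((Set.finite_Iio n).image (s j)).subset ?_
          rintro _ ⟨k, ⟨n', hn', h⟩, rfl⟩
          exact ⟨n', hn', h⟩
        obtain ⟨K, hK⟩ := hfin.bddAbove
        exact ⟨K + 1, fun k n' hn' h => Nat.lt_succ_of_le (hK ⟨n', hn', h⟩)⟩
      obtain ⟨j', k', h1, h2, h3, h4⟩ := hρlim i hi' j hj K
      obtain ⟨n', hn'⟩ := hρcov j' (h1.trans hi') k' h4
      refine ⟨j', h1, n', ?_, ?_, ?_⟩
      · refine h2.imp_right ?_
        rintro ⟨rfl, hle⟩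
        refine ⟨rfl, not_lt.1 fun hlt => ?_⟩
        exact absurd (hK k' n' hlt hn') (not_lt.2 hle)
      · rw [hs' j' (h1.trans hi'), hs' i hi', hn', (hspec i hi').2.2.1, if_neg hi0]
        exact h3
      · rw [hs' j' (h1.trans hi'), hn']
        exact h4
    -- The index η must exceed d₀ as well, because `g d₀` lies on the last ray itself.
    · obtain ⟨η, hη, hle⟩ := hS.apex.unbounded (max (j + 1) (d₀ + 1))
        (max_lt (hsuccμ j hj) (hsuccμ d₀ (hS.apex.subset hd₀)))
      have hη1 : j < η := (lt_add_one j).trans_le ((le_max_left _ _).trans hle)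
      have hη2 : d₀ < η := (lt_add_one d₀).trans_le ((le_max_right _ _).trans hle)
      obtain ⟨n', hn'⟩ := hgcov η hη hη2.ne'
      refine ⟨η, hS.apex.subset hη, n', Or.inl hη1, ?_, ?_⟩
      · rw [hs' η (hS.apex.subset hη), hst, hn', ht3]
        exact (hS.apex.adj η hη).symm
      · rw [hs' η (hS.apex.subset hη), hn']
        exact hS.apex.mem η hη
  · rw [hst, Set.inter_eq_left.2 ht4]
    exact hNinf

end RaySystem

/-! ### Nice chains and the sizes of their members -/

section NiceChain

variable {V : Type u}

theorem mk_preimage_label_le (label : V ↪ ZFSet.{u}) (W : ZFSet.{u}) :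
    #{v | label v ∈ W} ≤ W.card := by
  refine (card_codeSet (label := label) _).symm.trans_le (ZFSet.card_mono fun z hz => ?_)
  obtain ⟨v, hv, rfl⟩ := mem_codeSet.1 hz
  exact hv

theorem Cardinal.isSuccLimit_or_exists_succ {κ : Cardinal.{u}} (hκ : ℵ₀ < κ) :
    Order.IsSuccLimit κ ∨ ∃ μ, ℵ₀ ≤ μ ∧ κ = Order.succ μ := by
  by_cases h : Order.IsSuccLimit κ
  · exact Or.inl h
  · rcases Order.not_isSuccLimit_iff.1 h with h | h
    · exact absurd (h.eq_bot ▸ hκ) not_lt_bot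
    · obtain ⟨μ, rfl⟩ := Order.mem_range_succ_of_not_isSuccPrelimit h
      exact Or.inr ⟨μ, Order.lt_succ_iff.1 hκ, rfl⟩

namespace IsNiceChain

variable {κ Θ : Cardinal.{u}} {X : ZFSet.{u}} {M : Ordinal.{u} → ZFSet.{u}}

theorem add_one_lt_cof (hκ : ℵ₀ ≤ κ) {β : Ordinal.{u}} (hβ : β < κ.ord.cof.ord) :
    β + 1 < κ.ord.cof.ord :=
  (Cardinal.isSuccLimit_ord (isRegular_cof (Cardinal.isSuccLimit_ord hκ)).1).add_one_lt hβ

theorem mono (h : IsNiceChain κ X Θ M) {α β : Ordinal.{u}} (hαβ : α ≤ β)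
    (hβ : β < κ.ord.cof.ord) : M α ⊆ M β := by
  rcases hαβ.eq_or_lt with rfl | hlt
  · exact fun _ h => h
  rcases eq_or_ne α 0 with rfl | h0
  · rw [h.zero]
    exact ZFSet.empty_subset _
  · exact (h.subset_and_mem α β (Order.one_le_iff_ne_zero.2 h0) hlt hβ).1

theorem card_lt (h : IsNiceChain κ X Θ M) (hκ : ℵ₀ < κ) {β : Ordinal.{u}}
    (hβ : β < κ.ord.cof.ord) : (M β).card < κ := by
  rcases isSuccLimit_or_exists_succ hκ with hl | ⟨μ, hμ, rfl⟩
  · exact (h.of_limit hl).2.1 β hβ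
  · rcases eq_or_ne β 0 with rfl | h0
    · rw [h.zero, ZFSet.card_empty]
      exact aleph0_pos.trans hκ
    · rw [(h.of_succ μ rfl).2 β (Order.one_le_iff_ne_zero.2 h0) hβ]
      exact Order.lt_succ μ

theorem aleph0_le_card (h : IsNiceChain κ X Θ M) (hκ : ℵ₀ < κ) {β : Ordinal.{u}}
    (hβ : β + 1 < κ.ord.cof.ord) : ℵ₀ ≤ (M (β + 1)).card := by
  rcases isSuccLimit_or_exists_succ hκ with hl | ⟨μ, hμ, rfl⟩
  · exact ((h.of_limit hl).2.2 β hβ).1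
  · rwa [(h.of_succ μ rfl).2 _ le_add_self hβ]

theorem mem_of_lt (h : IsNiceChain κ X Θ M) {α β : Ordinal.{u}} (hαβ : α < β)
    (hβ : β < κ.ord.cof.ord) : M α ∈ M β := by
  rcases eq_or_ne α 0 with rfl | h0
  · have h1 := Order.one_le_iff_ne_zero.2 hαβ.ne'
    rw [h.zero]
    exact (h.elementary β h1 hβ).empty_mem (h.mem β h1 hβ)
  · exact (h.subset_and_mem α β (Order.one_le_iff_ne_zero.2 h0) hαβ hβ).2

/-- M 0 is empty and limit stages are unions, so elements can only first appear at successor stages.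
-/
theorem exists_first_stage (h : IsNiceChain κ X Θ M) {x : ZFSet.{u}} {α : Ordinal.{u}}
    (hα : α < κ.ord.cof.ord) (hx : x ∈ M α) : ∃ β < α, x ∈ M (β + 1) ∧ x ∉ M β := by
  induction α using WellFoundedLT.induction with
  | _ α ih =>
    rcases Ordinal.zero_or_succ_or_isSuccLimit α with rfl | ⟨β, rfl⟩ | hl
    · rw [h.zero] at hx
      exact absurd hx (ZFSet.notMem_empty x)
    · have hlt : β < Order.succ β := Order.lt_succ β
      by_cases hxβ : x ∈ M β
      · obtain ⟨γ, hγ, hγ'⟩ := ih β hlt (hlt.trans hα) hxβ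
        exact ⟨γ, hγ.trans hlt, hγ'⟩
      · exact ⟨β, hlt, hx, hxβ⟩
    · obtain ⟨β, hβ, hxβ⟩ := (h.continuous α hl hα x).1 hx
      obtain ⟨γ, hγ, hγ'⟩ := ih β hβ (hβ.trans hα) hxβ
      exact ⟨γ, hγ.trans hβ, hγ'⟩

/-- Successor indices matter: there a member of the chain contains and includes its own cardinality.
-/
theorem isGraphSubmodel {G : SimpleGraph V} {label : V ↪ ZFSet.{u}} {A : Set V}
    (h : IsNiceChain κ {codeSet label A, codeGraph label G} Θ M) (hκ : ℵ₀ < κ) {β : Ordinal.{u}}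
    (hβ : β + 1 < κ.ord.cof.ord) :
    IsGraphSubmodel G label A (M (β + 1)).card Θ (M (β + 1)) where
  elementary := h.elementary _ le_add_self hβ
  code_mem := h.mem _ le_add_self hβ
  card_subset := (h.card_subset_and_mem β hβ).1
  card_mem := (h.card_subset_and_mem β hβ).2
  aleph0_le := h.aleph0_le_card hκ hβ

/-- At a limit stage of a chain of strictly increasing sizes, the elements smaller than the stage
are included in earlier stages. -/
theorem exists_subset_of_card_lt (h : IsNiceChain κ X Θ M) (hκ : ℵ₀ < κ) (hΘ : ℵ₀ ≤ Θ)
    (hl : Order.IsSuccLimit κ) {β : Ordinal.{u}} (hβ : β < κ.ord.cof.ord)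
    (hβl : Order.IsSuccLimit β) {Z : ZFSet.{u}} (hZ : Z ∈ M β) (hZc : Z.card < (M β).card) :
    ∃ α < β, Z ⊆ M α := by
  by_contra! hcon
  obtain ⟨α₀, hα₀, hZα₀⟩ := (h.continuous β hβl hβ Z).1 hZ
  have hstrict := (h.of_limit hl).1
  -- A successor stage beyond α and α₀ contains `Z`. If `Z` were smaller than this stage, it would
  -- be included in it, against `hcon`.
  have hcard : ∀ α < β, (M α).card < Z.card := by
    intro α hα
    have hγ : max α α₀ + 1 < β := hβl.add_one_lt (max_lt hα hα₀)
    have hlt : α < max α α₀ + 1 := Order.lt_add_one_iff.2 (le_max_left _ _)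
    have hlt₀ : α₀ < max α α₀ + 1 := Order.lt_add_one_iff.2 (le_max_right _ _)
    refine (hstrict _ _ hlt (hγ.trans hβ)).trans_le (not_lt.1 fun hle => hcon _ hγ ?_)
    obtain ⟨h1, h2⟩ := h.card_subset_and_mem _ (hγ.trans hβ)
    exact (h.elementary _ le_add_self (hγ.trans hβ)).subset_of_card_le hΘ h2 h1
      (h.mono hlt₀.le (hγ.trans hβ) hZα₀) hle.le
  -- Strict growth of the sizes bounds the length β by |Z|. Then M β, a union of |β| many sets of
  -- size below |Z|, has size at most |Z|, a contradiction.
  have hord : ∀ α < β, α ≤ (M α).card.ord := by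
    intro α
    induction α using WellFoundedLT.induction with
    | _ α ih =>
      intro hα
      by_contra! hlt
      have h1 := ih _ hlt (hlt.trans hα)
      exact absurd h1 (not_le.2 (Cardinal.ord_lt_ord.2 (hstrict _ _ hlt (hα.trans hβ))))
  have hβZ : β.card ≤ Z.card := by
    have : β ≤ Z.card.ord := le_of_forall_lt fun α hα =>
      (hord α hα).trans_lt (Cardinal.ord_lt_ord.2 (hcard α hα))
    simpa using Ordinal.card_le_card this
  have hinf : ℵ₀ ≤ Z.card := by
    have h1 : (0 : Ordinal.{u}) + 1 < β := hβl.add_one_lt hβl.bot_lt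
    exact (h.aleph0_le_card hκ (h1.trans hβ)).trans (hcard _ h1).le
  have hsub : M β ⊆ ZFSet.iUnion fun α : Set.Iio β => M α := by
    intro x hx
    obtain ⟨α, hα, hxα⟩ := (h.continuous β hβl hβ x).1 hx
    exact ZFSet.mem_iUnion.2 ⟨⟨α, hα⟩, hxα⟩
  refine absurd ((ZFSet.card_mono hsub).trans ?_) (not_le.2 hZc)
  rw [← Cardinal.lift_le.{u + 1}]
  refine ZFSet.lift_card_iUnion_le_sum_card.trans
    ((Cardinal.sum_le_sum (fun α : Set.Iio β => (M α).card) (fun _ => Z.card)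
      fun α => (hcard α α.2).le).trans ?_)
  rw [Cardinal.sum_const, Cardinal.mk_Iio_ordinal, Cardinal.lift_lift, ← Cardinal.lift_mul,
    Cardinal.lift_le]
  exact (mul_le_mul_left hβZ _).trans (Cardinal.mul_eq_self hinf).le

/-- At a limit stage, the size of a certain set of the next stage tells which elements are included
in earlier stages. -/
theorem exists_size_bound {G : SimpleGraph V} {label : V ↪ ZFSet.{u}} {A : Set V} (hA : #A = κ)
    (h : IsNiceChain κ {codeSet label A, codeGraph label G} Θ M) (hκ : ℵ₀ < κ) {β : Ordinal.{u}}
    (hβ : β < κ.ord.cof.ord) (hβl : Order.IsSuccLimit β) :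
    ∃ C ∈ M (β + 1), (∀ α < β, (M α).card < C.card) ∧
      ∀ Z ∈ M β, Z.card < C.card → ∃ α < β, Z ⊆ M α := by
  have hβ' := add_one_lt_cof hκ.le hβ
  have hsub := h.isGraphSubmodel hκ hβ'
  have hΘ := hsub.aleph0_le_bound
  -- For limit κ the sizes grow strictly and M β itself serves as `C`. For κ = μ⁺ all non-empty
  -- stages have size μ, and the code of `A`, of size κ, serves.
  rcases isSuccLimit_or_exists_succ hκ with hl | ⟨μ, hμ, hκμ⟩
  · exact ⟨M β, h.mem_of_lt (Order.lt_add_one_iff.2 le_rfl) hβ',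
      fun α hα => (h.of_limit hl).1 α β hα hβ,
      fun Z hZ hc => h.exists_subset_of_card_lt hκ hΘ hl hβ hβl hZ hc⟩
  · refine ⟨codeSet label A, hsub.codeSet_mem, fun α hα => ?_, fun Z hZ hc => ?_⟩
    · rw [card_codeSet, hA]
      exact h.card_lt hκ (hα.trans hβ)
    · rw [card_codeSet, hA, hκμ, Order.lt_succ_iff] at hc
      obtain ⟨α, hα, hZα⟩ := (h.continuous β hβl hβ Z).1 hZ
      have hα' : α + 1 < κ.ord.cof.ord := (hβl.add_one_lt hα).trans hβ
      have hs := h.isGraphSubmodel hκ hα'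
      rw [(h.of_succ μ hκμ).2 _ le_add_self hα'] at hs
      exact ⟨α + 1, hβl.add_one_lt hα, hs.elementary.subset_of_card_le hΘ hs.card_mem
        hs.card_subset (h.mono (Order.lt_add_one_iff.2 le_rfl).le hα' hZα) hc⟩

end IsNiceChain

end NiceChain

/-! ### Starting edges, apexes and ray systems of the stages -/

section Stages

variable {V : Type u} {G : SimpleGraph V} {label : V ↪ ZFSet.{u}} {A : Set V}
  {κ Θ : Cardinal.{u}} {M : Ordinal.{u} → ZFSet.{u}}

/-- An edge from `A` of the stage `β` of a chain, one of whose ends has many neighbours in the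
earlier stages. -/
structure IsStageEdge (G : SimpleGraph V) (label : V ↪ ZFSet.{u}) (A : Set V)
    (M : Ordinal.{u} → ZFSet.{u}) (β : Ordinal.{u}) (x y : V) : Prop where
  mem : x ∈ A
  left_mem : label x ∈ M (β + 1)
  left_notMem : label x ∉ M β
  right_mem : label y ∈ M (β + 1)
  right_notMem : label y ∉ M β
  adj : G.Adj y x
  exists_adj : ∀ α < β, ∃ z, G.Adj y z ∧ z ∈ A ∧ label z ∈ M β ∧ label z ∉ M α
  infinite : ∀ α, β = α + 1 → {z | G.Adj y z ∧ z ∈ A ∧ label z ∈ M β ∧ label z ∉ M α}.Infinite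

/-- The condition on neighbours is reflected without using the sequence of earlier stages as a
parameter. At β = α + 1 only M α matters, and it is an element of M (β + 1). At a limit β the stages
M α are elements of M β smaller than a suitable `C`, while every such element is included in an
earlier stage; quantifying over these elements therefore says the same. -/
theorem IsNiceChain.exists_isStageEdge (hA : #A = κ)
    (h : IsNiceChain κ {codeSet label A, codeGraph label G} Θ M) (hκ : ℵ₀ < κ) {β : Ordinal.{u}}
    (hβ : β < κ.ord.cof.ord) {x y : V} (hx : x ∈ A) (hxM : label x ∉ M β) (hyM : label y ∉ M β)
    (hxy : G.Adj x y) (hinf : ∀ α < β,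
      {z | G.Adj y z ∧ z ∈ A ∧ label z ∈ M β ∧ label z ∉ M α}.Infinite) :
    ∃ x' y', IsStageEdge G label A M β x' y' := by
  have hβ' := add_one_lt_cof hκ.le hβ
  have hlt : ∀ γ : Ordinal.{u}, γ < γ + 1 := fun γ => Order.lt_add_one_iff.2 le_rfl
  have hsub := h.isGraphSubmodel hκ hβ'
  have hW := h.mem_of_lt (hlt β) hβ'
  rcases Ordinal.zero_or_succ_or_isSuccLimit β with h0 | ⟨α, hα⟩ | hl
  · obtain ⟨x', hx', y', h1, h2, h3, h4, h5, -⟩ := hsub.exists_edge_unbounded hW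
      (h.mem_of_lt (hlt β) hβ') hx hxM hyM hxy (by
        rw [h0, h.zero]
        exact fun Z hZ => absurd hZ (ZFSet.notMem_empty Z))
    exact ⟨x', y', hx', h1, h3, h2, h4, h5.symm, fun α hα => absurd hα (h0 ▸ not_lt_zero),
      fun α hα => absurd (hα ▸ h0 : α + 1 = 0) (by simp)⟩
  · rw [Order.succ_eq_add_one] at hα
    have hαβ : α < β := hα ▸ hlt α
    obtain ⟨x', hx', y', h1, h2, h3, h4, h5, h6⟩ := hsub.exists_edge_infinite hW
      (h.mem_of_lt (hαβ.trans (hlt β)) hβ') hx hxM hyM hxy (hinf α hαβ)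
    refine ⟨x', y', hx', h1, h3, h2, h4, h5.symm, fun γ hγ => ?_, fun γ hγ => ?_⟩
    · obtain ⟨z, hz1, hz2, hz3, hz4⟩ := h6.nonempty
      refine ⟨z, hz1, hz2, hz3, fun hz => hz4 (h.mono ?_ (hαβ.trans hβ) hz)⟩
      rw [← hα] at hγ
      exact Order.lt_add_one_iff.1 hγ
    · have hγ' : α = γ := Order.succ_injective (by simpa using hα.trans hγ)
      rwa [← hγ']
  · obtain ⟨C, hC, hC1, hC2⟩ := h.exists_size_bound hA hκ hβ hl
    obtain ⟨x', hx', y', h1, h2, h3, h4, h5, h6⟩ := hsub.exists_edge_unbounded hW hC hx hxM hyM hxy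
      (fun Z hZ hZC => by
        obtain ⟨α, hα, hZα⟩ := hC2 Z hZ hZC
        obtain ⟨z, hz1, hz2, hz3, hz4⟩ := (hinf α hα).nonempty
        exact ⟨z, hz1, hz2, hz3, fun hz => hz4 (hZα hz)⟩)
    exact ⟨x', y', hx', h1, h3, h2, h4, h5.symm,
      fun α hα => h6 (M α) (h.mem_of_lt hα hβ) (hC1 α hα),
      fun α hα => absurd (hl.add_one_lt (hα ▸ hlt α)) (hα ▸ lt_irrefl _)⟩

/-- On a path of order type μ⁺ concentrated on `A`, the vertex of index μ is a limit, so its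
neighbours in `A` have unbounded indices below μ. -/
theorem ManyDisjointPaths.exists_isApex (h : ManyDisjointPaths G κ A) {μ : Cardinal.{u}}
    (hμ : ℵ₀ ≤ μ) (hμκ : Order.succ μ < κ) {Z : Set V} (hZ : #Z < κ) :
    ∃ (y : V) (D : Set Ordinal.{u}) (g : Ordinal.{u} → V), IsApex G A μ y D g ∧ y ∉ Z ∧
      ∀ ξ ∈ D, g ξ ∉ Z := by
  obtain ⟨r, hr, hrZ⟩ := h.exists_isConcentratedSeq hμκ (aleph0_pos.trans_le hμ |>.trans
    (Order.lt_succ μ)) hZ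
  have hlt : μ.ord < (Order.succ μ).ord := Cardinal.ord_lt_ord.2 (Order.lt_succ μ)
  refine ⟨r μ.ord, {ζ | ζ < μ.ord ∧ G.Adj (r ζ) (r μ.ord) ∧ r ζ ∈ A}, r,
    ⟨fun ζ hζ => hζ.1, fun ξ hξ => ?_, hr.injOn.mono fun ζ hζ => hζ.1.trans hlt,
      fun ζ hζ => hζ.2.2, fun ζ hζ => hζ.2.1.symm⟩, hrZ _ hlt, fun ζ hζ => hrZ _ (hζ.1.trans hlt)⟩
  obtain ⟨ζ, h1, h2, h3, h4⟩ := hr.limit _ hlt (fun ξ hξ => ⟨ξ + 1,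
    (Cardinal.isSuccLimit_ord hμ).add_one_lt hξ, Order.lt_add_one_iff.2 le_rfl⟩) ξ hξ
  exact ⟨ζ, ⟨h2, h3, h4⟩, h1⟩

/-- For κ = μ⁺ the hypothesis supplies no paths of type μ⁺, and the apex comes from the chain. By
regularity some M γ contains all points of `Z` that occur in the chain. The vertex y (γ + μ) has
neighbours in `A` that first appear unboundedly often between γ and γ + μ. Choosing one from each
layer makes them distinct, and being new after γ they lie outside `Z`. -/
theorem IsNiceChain.exists_isApex_of_succ {X : ZFSet.{u}} {μ : Cardinal.{u}} (hμ : ℵ₀ ≤ μ)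
    (h : IsNiceChain (Order.succ μ) X Θ M) {x y : Ordinal.{u} → V}
    (hxy : ∀ β < (Order.succ μ).ord.cof.ord, IsStageEdge G label A M β (x β) (y β)) {Z : Set V}
    (hZ : #Z < Order.succ μ) :
    ∃ (y : V) (D : Set Ordinal.{u}) (g : Ordinal.{u} → V), IsApex G A μ y D g ∧ y ∉ Z ∧
      ∀ ξ ∈ D, g ξ ∉ Z := by
  have hreg := Cardinal.isRegular_succ hμ
  rw [hreg.cof_ord] at hxy
  have hκ : ℵ₀ < Order.succ μ := hμ.trans_lt (Order.lt_succ μ)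
  have hcof : (Order.succ μ).ord.cof.ord = (Order.succ μ).ord := by rw [hreg.cof_ord]
  have hlt : ∀ γ : Ordinal.{u}, γ < γ + 1 := fun γ => Order.lt_add_one_iff.2 le_rfl
  obtain ⟨γ, hγ, hγZ⟩ : ∃ γ < (Order.succ μ).ord, ∀ z ∈ Z,
      ∀ α < (Order.succ μ).ord, label z ∈ M α → label z ∈ M γ := by
    have : ∀ z : Z, ∃ α < (Order.succ μ).ord, ∀ β < (Order.succ μ).ord,
        label z ∈ M β → label z ∈ M α := by
      intro z
      by_cases hz : ∃ α < (Order.succ μ).ord, label z ∈ M α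
      · obtain ⟨α, hα, hzα⟩ := hz
        exact ⟨α, hα, fun _ _ _ => hzα⟩
      · exact ⟨0, hreg.ord_pos, fun β hβ hzβ => absurd ⟨β, hβ, hzβ⟩ hz⟩
    choose f hf hfM using this
    have hsup := Ordinal.iSup_lt_of_lt_cof (hreg.cof_ord.symm ▸ hZ) hf
    refine ⟨⨆ z, f z, hsup, fun z hz α hα hzα => ?_⟩
    exact h.mono (Ordinal.le_iSup f ⟨z, hz⟩) (hcof.symm ▸ hsup) (hfM ⟨z, hz⟩ α hα hzα)
  have hμlim := Cardinal.isSuccLimit_ord hμ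
  have hβ : γ + μ.ord < (Order.succ μ).ord :=
    (Ordinal.isPrincipal_add_ord hκ.le) hγ (Cardinal.ord_lt_ord.2 (Order.lt_succ μ))
  have hedge := hxy _ hβ
  let D : Set Ordinal.{u} := {ξ | ξ < μ.ord ∧ ∃ a ∈ A, G.Adj (y (γ + μ.ord)) a ∧
    label a ∈ M (γ + ξ + 1) ∧ label a ∉ M (γ + ξ)}
  have : ∀ ξ, ∃ a, ξ ∈ D → a ∈ A ∧ G.Adj (y (γ + μ.ord)) a ∧ label a ∈ M (γ + ξ + 1) ∧
      label a ∉ M (γ + ξ) := by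
    intro ξ
    by_cases hξ : ξ ∈ D
    · obtain ⟨a, ha⟩ := hξ.2
      exact ⟨a, fun _ => ha⟩
    · exact ⟨y 0, fun h => absurd h hξ⟩
  choose g hg using this
  have hbound : ∀ ξ < μ.ord, γ + ξ + 1 < (Order.succ μ).ord := fun ξ hξ => by
    rw [add_assoc]
    exact (add_lt_add_right (hμlim.add_one_lt hξ) γ).trans hβ
  have hlayer : ∀ ξ ∈ D, ∀ η ∈ D, ξ < η → g ξ ≠ g η := fun ξ hξ η hη hξη heq => by
    refine (hg η hη).2.2.2 (heq ▸ h.mono ?_ ?_ (hg ξ hξ).2.2.1)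
    · exact Order.add_one_le_of_lt (add_lt_add_right hξη γ)
    · rw [hcof]
      exact (hlt _).trans (hbound η hη.1)
  refine ⟨y (γ + μ.ord), D, g, ⟨fun ξ hξ => hξ.1, fun ξ hξ => ?_, fun ξ hξ η hη heq => ?_,
    fun ξ hξ => (hg ξ hξ).1, fun ξ hξ => (hg ξ hξ).2.1⟩, fun hyZ => ?_, fun ξ hξ hZξ => ?_⟩
  · obtain ⟨z, hz1, hz2, hz3, hz4⟩ := hedge.exists_adj _ (add_lt_add_right hξ γ)
    obtain ⟨δ, hδ, hδ1, hδ2⟩ := h.exists_first_stage (hcof.symm ▸ hβ) hz3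
    have hle : γ + ξ ≤ δ := not_lt.1 fun hlt' => hz4 (h.mono (Order.add_one_le_of_lt hlt')
      (hcof.symm ▸ (hlt _).trans (hbound ξ hξ)) hδ1)
    have hδ' : γ + (δ - γ) = δ := Ordinal.add_sub_cancel_of_le (le_self_add.trans hle)
    refine ⟨δ - γ, ⟨?_, z, hz2, hz1, ?_, ?_⟩, ?_⟩
    · rwa [← hδ', add_lt_add_iff_left] at hδ
    · rwa [hδ']
    · rwa [hδ']
    · rwa [← hδ', add_le_add_iff_left] at hle
  · rcases lt_trichotomy ξ η with hlt' | heq' | hlt'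
    · exact absurd heq (hlayer ξ hξ η hη hlt')
    · exact heq'
    · exact absurd heq.symm (hlayer η hη ξ hξ hlt')
  · refine hedge.right_notMem (h.mono le_self_add (hcof.symm ▸ hβ) (hγZ _ hyZ _ ?_
      hedge.right_mem))
    exact (Cardinal.isSuccLimit_ord hκ.le).add_one_lt hβ
  · refine (hg ξ hξ).2.2.2 (h.mono le_self_add (hcof.symm ▸ (hlt _).trans (hbound ξ hξ.1))
      (hγZ _ hZξ _ (hbound ξ hξ.1) (hg ξ hξ).2.2.1))

theorem IsNiceChain.exists_isApex (hA : ManyDisjointPaths G κ A) {X : ZFSet.{u}} (hκ : ℵ₀ < κ)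
    (h : IsNiceChain κ X Θ M) {x y : Ordinal.{u} → V}
    (hxy : ∀ β < κ.ord.cof.ord, IsStageEdge G label A M β (x β) (y β)) {β : Ordinal.{u}}
    (hβ : β + 1 < κ.ord.cof.ord) {Z : Set V} (hZ : #Z < κ) :
    ∃ (y : V) (D : Set Ordinal.{u}) (g : Ordinal.{u} → V), IsApex G A (M (β + 1)).card y D g ∧
      y ∉ Z ∧ ∀ ξ ∈ D, g ξ ∉ Z := by
  rcases isSuccLimit_or_exists_succ hκ with hl | ⟨μ, hμ, rfl⟩
  · exact hA.exists_isApex (h.aleph0_le_card hκ hβ) (hl.succ_lt (h.card_lt hκ hβ)) hZ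
  · rw [(h.of_succ μ rfl).2 _ le_add_self hβ]
    exact h.exists_isApex_of_succ hμ hxy hZ

/-- The difference of two consecutive submodels admits a system of rays. -/
theorem IsGraphSubmodel.exists_raySystem {M W : ZFSet.{u}}
    (h : IsGraphSubmodel G label A M.card Θ M)
    (hA : Unseparable G κ A) (hP : ManyDisjointPaths G κ A) (hMκ : M.card < κ)
    (hY : ∀ Z : Set V, #Z < κ → ∃ (y : V) (D : Set Ordinal.{u}) (g : Ordinal.{u} → V),
      IsApex G A M.card y D g ∧ y ∉ Z ∧ ∀ ξ ∈ D, g ξ ∉ Z)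
    (hW : W ∈ M) (hWκ : W.card < κ) {x₀ y₀ : V} {U N : Set V}
    (hU : U = {v | label v ∈ M ∧ label v ∉ W}) (hx₀ : x₀ ∈ A ∩ U) (hy₀ : y₀ ∈ U)
    (hadj : G.Adj y₀ x₀) (hN : N ⊆ A ∩ U) (hNinf : N.Infinite) :
    ∃ (τ : Ordinal.{u}) (s : Ordinal.{u} → ℕ → V), IsRaySystem G A U y₀ N τ s := by
  have hκ : ℵ₀ ≤ κ := h.aleph0_le.trans hMκ.le
  have hcard : #(A ∩ U : Set V) ≤ M.card :=
    (Cardinal.mk_le_mk_of_subset (by rw [hU]; exact fun v hv => hv.2.1)).trans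
      (mk_preimage_label_le label M)
  have hZ₀ := h.codeSet_preimage_mem hW
  have hZ₀κ := (mk_preimage_label_le label W).trans_lt hWκ
  have hconn : ∀ Z : Set V, codeSet label Z ∈ M → #Z < κ → {v | label v ∈ W} ⊆ Z →
      ∀ v ∈ A ∩ U, ∀ w ∈ A ∩ U, v ≠ w → ∀ F : Set V, #F < M.card →
      ∃ p : G.Walk v w, ∀ z ∈ p.support, z = v ∨ z = w ∨ (z ∈ U ∧ z ∉ Z ∧ z ∉ F) := by
    intro Z hZ hZκ hWZ v hv w hw hne F hF
    have hv' : label v ∈ M ∧ label v ∉ W := by simpa [hU] using hv.2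
    have hw' : label w ∈ M ∧ label w ∉ W := by simpa [hU] using hw.2
    obtain ⟨p, hp⟩ := h.exists_walk_avoiding hA hMκ hZ hZκ hv.1 hw.1 hv'.1 hw'.1 hne hF
    refine ⟨p, fun z hz => (hp z hz).imp_right (Or.imp_right fun hz' => ⟨?_, hz'.2⟩)⟩
    rw [hU]
    exact ⟨hz'.1, fun hzW => hz'.2.1 (hWZ hzW)⟩
  rcases h.aleph0_le.eq_or_lt with hμ | hμ
  · refine exists_raySystem_of_countable (Cardinal.le_aleph0_iff_set_countable.1 (hμ ▸ hcard)) hx₀ hy₀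
      hadj hN hNinf fun v hv w hw hne F hF => ?_
    obtain ⟨p, hp⟩ := hconn _ hZ₀ hZ₀κ (fun _ h => h) v hv w hw hne F (hμ ▸ hF.lt_aleph0)
    exact ⟨p, fun z hz => (hp z hz).imp_right (Or.imp_right fun hz' => ⟨hz'.1, hz'.2.2⟩)⟩
  have hx₀' : label x₀ ∈ M ∧ label x₀ ∉ W := by simpa [hU] using hx₀.2
  have hy₀' : label y₀ ∈ M ∧ label y₀ ∉ W := by simpa [hU] using hy₀
  set Z := insert x₀ (insert y₀ {v | label v ∈ W}) with hZdef
  have hZ : codeSet label Z ∈ M := h.codeSet_insert_mem (h.codeSet_insert_mem hZ₀ hy₀'.1) hx₀'.1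
  have hZκ : #Z < κ := by
    refine Cardinal.mk_insert_le.trans_lt (Cardinal.add_lt_of_lt hκ
      (Cardinal.mk_insert_le.trans_lt (Cardinal.add_lt_of_lt hκ hZ₀κ ?_)) ?_) <;>
    exact Cardinal.one_lt_aleph0.trans_le hκ
  have hWZ : {v | label v ∈ W} ⊆ Z := fun v hv => Or.inr (Or.inr hv)
  -- a scaffold that is disjoint from infinitely many points of `N` finishes the proof
  have key : ∀ (Z' : Set V) (y : V) (D : Set Ordinal.{u}) (g r : Ordinal.{u} → V), Z ⊆ Z' →
      IsScaffold G A M.card y D g r →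
      (∀ v ∈ scaffoldSet M.card y D g r, v ∉ Z' ∧ label v ∈ M) →
      codeSet label (Z' ∪ scaffoldSet M.card y D g r) ∈ M →
      #(Z' ∪ scaffoldSet M.card y D g r : Set V) < κ →
      (N \ scaffoldSet M.card y D g r).Infinite →
      ∃ (τ : Ordinal.{u}) (s : Ordinal.{u} → ℕ → V), IsRaySystem G A U y₀ N τ s := by
    intro Z' y D g r hZZ' hS hSZ hZS hZSκ hinf
    set S := scaffoldSet M.card y D g r with hSdef
    -- A single ray has to cover these points, so `N` is thinned out to a countable set away from
    -- the starting edge.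
    have hinf' : ((N \ S) \ {x₀, y₀}).Infinite := hinf.sdiff (Set.toFinite _)
    obtain ⟨N₀, hN₀, hN₀inf, hN₀c⟩ : ∃ N₀ ⊆ (N \ S) \ {x₀, y₀}, N₀.Infinite ∧ N₀.Countable := by
      refine ⟨Set.range fun n => ((hinf'.natEmbedding _ n : _) : V), ?_, ?_, Set.countable_range _⟩
      · rintro _ ⟨n, rfl⟩
        exact (hinf'.natEmbedding _ n).2
      · exact Set.infinite_range_of_injective
          (Subtype.val_injective.comp (hinf'.natEmbedding _).injective)
    have hsub : N₀ ⊆ N := fun v hv => (hN₀ hv).1.1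
    obtain ⟨τ, s, hs⟩ := exists_raySystem_of_scaffold hμ hcard hx₀ hy₀ hadj (hsub.trans hN) hN₀inf
      hN₀c hS (fun v hv => by
        rw [hU]
        exact ⟨(hSZ v hv).2, fun hvW => (hSZ v hv).1 (hZZ' (hWZ hvW))⟩)
      (fun hx => (hSZ _ hx).1 (hZZ' (Or.inl rfl)))
      (fun hy => (hSZ _ hy).1 (hZZ' (Or.inr (Or.inl rfl))))
      (fun v hv => (hN₀ hv).1.2) (fun hx => (hN₀ hx).2 (Or.inl rfl))
      (fun hy => (hN₀ hy).2 (Or.inr rfl)) (fun v hv w hw hne F hF => by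
        -- The scaffold is too large for the set `F`; it is avoided as part of a set that M contains
        -- and whose size is below κ.
        obtain ⟨p, hp⟩ := hconn _ hZS hZSκ ((hWZ.trans hZZ').trans Set.subset_union_left) v hv w hw
          hne F hF
        exact ⟨p, fun z hz => (hp z hz).imp_right (Or.imp_right fun hz' =>
          ⟨hz'.1, fun hzS => hz'.2.1 (Or.inr hzS), hz'.2.2⟩)⟩)
    exact ⟨τ, s, hs.inj, hs.adj, hs.start, hs.mem, hs.cover, hs.limit,
      hs.last.mono (Set.inter_subset_inter_left _ hsub)⟩
  obtain ⟨y, D, g, r, hS, hSZ, hZS, hZSκ⟩ := h.exists_isScaffold hP hMκ hY hZ hZκ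
  -- If the scaffold swallows almost all of `N`, a second one disjoint from it misses infinitely
  -- many points of `N`.
  by_cases hinf : (N \ scaffoldSet M.card y D g r).Infinite
  · exact key Z y D g r subset_rfl hS hSZ hZS hZSκ hinf
  · obtain ⟨y', D', g', r', hS', hSZ', hZS', hZSκ'⟩ := h.exists_isScaffold hP hMκ hY hZS hZSκ
    refine key _ y' D' g' r' Set.subset_union_left hS' hSZ' hZS' hZSκ'
      ((hNinf.sdiff (Set.not_infinite.1 hinf)).mono fun v hv => ⟨hv.1, fun hv' => ?_⟩)
    exact hv.2 ⟨hv.1, fun hvS => (hSZ' v hv').1 (Or.inr hvS)⟩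

end Stages

/-! ### Concatenating the stages -/

section Concatenation

variable {V : Type u} {G : SimpleGraph V} {label : V ↪ ZFSet.{u}} {A : Set V}
  {κ Θ : Cardinal.{u}} {M : Ordinal.{u} → ZFSet.{u}}

theorem Unseparable.exists_walk_avoiding (hκ : ℵ₀ ≤ κ) (hA : Unseparable G κ A) {v w : V}
    (hv : v ∈ A) (hw : w ∈ A) (hne : v ≠ w) {F : Set V} (hF : #F < κ) :
    ∃ p : G.Walk v w, ∀ z ∈ p.support, z = v ∨ z = w ∨ z ∉ F := by
  obtain ⟨S, hS, hdis⟩ := hA v hv w hw hne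
  have h := le_mk_paths_avoiding hκ hS hdis hF
  obtain ⟨⟨p, hp⟩⟩ := Cardinal.mk_ne_zero_iff.1 ((aleph0_pos.trans_le hκ).trans_le h).ne'
  refine ⟨p.1, fun z hz => ?_⟩
  by_cases hzF : z ∈ F
  · exact (hp.2 z hz hzF).imp_right Or.inl
  · exact Or.inr (Or.inr hzF)

/-- A ray has order type ω and no limit elements, so any ray that covers `A` will do. -/
theorem Unseparable.exists_path_of_countable (hA : Unseparable G ℵ₀ A) (hcard : #A = ℵ₀) :
    ∃ P : TransfinitePath G, A ⊆ P.verts ∧ P.ConcentratedOn A := by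
  have hinf : A.Infinite := Set.infinite_coe_iff.1 (Cardinal.aleph0_le_mk_iff.1 hcard.ge)
  have hcount : A.Countable := Cardinal.le_aleph0_iff_set_countable.1 hcard.le
  obtain ⟨a, ha⟩ := hinf.nonempty
  obtain ⟨s, h1, h2, -, h4, -, -⟩ := exists_ray_covering (G := G) (C := A) (O := Set.univ)
    (l := [a]) (by simp) (by simp) (by simp) hcount hinf (fun v hv w hw hne F hF => by
      have hins : insert a A = A := Set.insert_eq_self.2 ha
      rw [show [a].getLast (by simp) = a from rfl, hins] at hv hw
      obtain ⟨p, hp⟩ := hA.exists_walk_avoiding le_rfl hv hw hne hF.lt_aleph0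
      exact ⟨p, fun z hz => (hp z hz).imp_right (Or.imp_right fun h => ⟨Set.mem_univ z, h⟩)⟩)
  obtain ⟨P, hP, hPA⟩ := exists_transfinitePath_of_rays (G := G) (A := A) (Set.univ : Set Unit)
    (fun _ => s) (fun _ _ _ _ m n h => ⟨rfl, h1 h⟩) (fun _ _ => h2)
    (fun _ _ _ _ h => absurd h (lt_irrefl _))
  refine ⟨P, fun v hv => ?_, hPA⟩
  rw [hP]
  obtain ⟨n, hn⟩ := h4 hv
  exact ⟨(), Set.mem_univ _, n, hn⟩

/-- The vertices whose labels first occur at the stage `β + 1` of a chain. -/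
def stageSet (label : V ↪ ZFSet.{u}) (M : Ordinal.{u} → ZFSet.{u}) (β : Ordinal.{u}) : Set V :=
  {v | label v ∈ M (β + 1) ∧ label v ∉ M β}

/-- The last ray prepares the next stage: y (β + 1) has infinitely many neighbours in `A` within
stage β, and these are the points the last ray is made to meet. -/
theorem IsNiceChain.exists_raySystem
    (h : IsNiceChain κ {codeSet label A, codeGraph label G} Θ M) (hκ : ℵ₀ < κ)
    (h₁ : Unseparable G κ A) (h₂ : ManyDisjointPaths G κ A) {x y : Ordinal.{u} → V}
    (hxy : ∀ β < κ.ord.cof.ord, IsStageEdge G label A M β (x β) (y β)) {β : Ordinal.{u}}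
    (hβ : β < κ.ord.cof.ord) :
    ∃ (τ : Ordinal.{u}) (s : Ordinal.{u} → ℕ → V), IsRaySystem G A (stageSet label M β) (y β)
      {z | G.Adj (y (β + 1)) z ∧ z ∈ A} τ s := by
  have hβ' := add_one_lt_cof hκ.le hβ
  have hsub := h.isGraphSubmodel hκ hβ'
  have he := hxy β hβ
  obtain ⟨τ, s, hs⟩ := hsub.exists_raySystem h₁ h₂ (h.card_lt hκ hβ')
    (fun Z hZ => h.exists_isApex h₂ hκ hxy hβ' hZ)
    (h.mem_of_lt (Order.lt_add_one_iff.2 le_rfl) hβ') (h.card_lt hκ hβ)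
    (U := stageSet label M β) rfl
    ⟨he.mem, he.left_mem, he.left_notMem⟩ ⟨he.right_mem, he.right_notMem⟩ he.adj
    (N := {z | G.Adj (y (β + 1)) z ∧ z ∈ A ∧ label z ∈ M (β + 1) ∧ label z ∉ M β})
    (fun z hz => ⟨hz.2.1, hz.2.2⟩) ((hxy _ hβ').infinite β rfl)
  exact ⟨τ, s, hs.inj, hs.adj, hs.start, hs.mem, hs.cover, hs.limit,
    hs.last.mono (Set.inter_subset_inter_left _ fun z hz => ⟨hz.1, hz.2.1⟩)⟩

theorem IsNiceChain.stageSet_disjoint {X : ZFSet.{u}} (h : IsNiceChain κ X Θ M)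
    {β γ : Ordinal.{u}} (hβ : β < κ.ord.cof.ord) (hγ : γ < κ.ord.cof.ord) {v : V}
    (hvβ : v ∈ stageSet label M β) (hvγ : v ∈ stageSet label M γ) : β = γ := by
  rcases lt_trichotomy β γ with hlt | heq | hlt
  · exact absurd (h.mono (Order.add_one_le_of_lt hlt) hγ hvβ.1) hvγ.2
  · exact heq
  · exact absurd (h.mono (Order.add_one_le_of_lt hlt) hβ hvγ.1) hvβ.2

/-- The concatenation of systems of rays for all the stages of a chain. -/
theorem IsNiceChain.exists_path_of_raySystems {X : ZFSet.{u}} (h : IsNiceChain κ X Θ M)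
    (hcov : ∀ a ∈ A, ∃ α < κ.ord.cof.ord, label a ∈ M α) {x y : Ordinal.{u} → V}
    (hxy : ∀ β < κ.ord.cof.ord, IsStageEdge G label A M β (x β) (y β))
    (τ : Ordinal.{u} → Ordinal.{u})
    (s : Ordinal.{u} → Ordinal.{u} → ℕ → V)
    (hs : ∀ β < κ.ord.cof.ord, IsRaySystem G A (stageSet label M β) (y β)
      {z | G.Adj (y (β + 1)) z ∧ z ∈ A} (τ β) (s β)) :
    ∃ P : TransfinitePath G, A ⊆ P.verts ∧ P.ConcentratedOn A := by
  obtain ⟨P, hP, hPA⟩ := exists_transfinitePath_of_rays (G := G) (A := A)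
    (ι := Ordinal.{u} ×ₗ Ordinal.{u})
    {i | (ofLex i).1 < κ.ord.cof.ord ∧ (ofLex i).2 ≤ τ (ofLex i).1}
    (fun i => s (ofLex i).1 (ofLex i).2) (by
      intro i hi j hj m n hij
      have h1 : (ofLex i).1 = (ofLex j).1 := h.stageSet_disjoint hi.1 hj.1
        ((hs _ hi.1).mem _ hi.2 m) (hij ▸ (hs _ hj.1).mem _ hj.2 n)
      obtain ⟨⟨β, i⟩, rfl⟩ := toLex.surjective i
      obtain ⟨⟨γ, j⟩, rfl⟩ := toLex.surjective j
      obtain rfl : β = γ := h1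
      obtain ⟨rfl, rfl⟩ := (hs β hi.1).inj i hi.2 j hj.2 m n hij
      exact ⟨rfl, rfl⟩)
    (fun i hi => (hs _ hi.1).adj _ hi.2) (by
      intro i hi j hj hlt n
      obtain ⟨⟨β, i⟩, rfl⟩ := toLex.surjective i
      obtain ⟨⟨γ, j⟩, rfl⟩ := toLex.surjective j
      change β < _ ∧ i ≤ τ β at hi
      change γ < _ ∧ j ≤ τ γ at hj
      rw [Prod.Lex.toLex_lt_toLex] at hlt
      change γ < β ∨ γ = β ∧ j < i at hlt
      suffices ∃ γ' j' n', γ' < κ.ord.cof.ord ∧ j' ≤ τ γ' ∧ (γ' < β ∨ γ' = β ∧ j' < i) ∧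
          (γ < γ' ∨ γ = γ' ∧ (j < j' ∨ j = j' ∧ n ≤ n')) ∧ G.Adj (s γ' j' n') (s β i 0) ∧
          s γ' j' n' ∈ A by
        obtain ⟨γ', j', n', h1, h2, h3, h4, h5⟩ := this
        refine ⟨toLex (γ', j'), ⟨h1, h2⟩, n', Prod.Lex.toLex_lt_toLex.2 h3, ?_, h5⟩
        rcases h4 with h4 | ⟨rfl, h4 | ⟨rfl, h4⟩⟩
        · exact Or.inl (Prod.Lex.toLex_lt_toLex.2 (Or.inl h4))
        · exact Or.inl (Prod.Lex.toLex_lt_toLex.2 (Or.inr ⟨rfl, h4⟩))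
        · exact Or.inr ⟨rfl, h4⟩
      have hsβ := hs β hi.1
      rcases hlt with hγβ | ⟨rfl, hji⟩
      -- Only the first ray of a system has to look for neighbours in other stages.
      · rcases eq_or_ne i 0 with rfl | hi0
        · rw [hsβ.start]
          rcases Ordinal.zero_or_succ_or_isSuccLimit β with h0 | ⟨α, hα⟩ | hl
          · exact absurd hγβ (h0 ▸ not_lt_zero)
          -- At a successor stage, infinitely many neighbours of the starting vertex lie on the last
          -- ray of the preceding stage, hence beyond any given position.
          · rw [Order.succ_eq_add_one] at hα
            subst hα
            have hlt : α < α + 1 := Order.lt_add_one_iff.2 le_rfl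
            have hα := hlt.trans hi.1
            have hsα := hs α hα
            have hlast := hsα.last
            have hn : ∃ n', n ≤ n' ∧ G.Adj (y (α + 1)) (s α (τ α) n') ∧ s α (τ α) n' ∈ A := by
              by_contra! hcon
              refine hlast (((Set.finite_Iio n).image (s α (τ α))).subset ?_)
              rintro _ ⟨hz, n', rfl⟩
              exact ⟨n', not_le.1 fun hle => hcon n' hle hz.1 hz.2, rfl⟩
            obtain ⟨n', hn, hadj, hA⟩ := hn
            refine ⟨α, τ α, n', hα, le_rfl, Or.inl hlt, ?_, hadj.symm, hA⟩
            rcases (Order.lt_add_one_iff.1 hγβ).lt_or_eq with h1 | rfl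
            · exact Or.inl h1
            · exact Or.inr ⟨rfl, hj.2.lt_or_eq.imp_right fun h => ⟨h, hn⟩⟩
          -- At a limit stage, a neighbour outside M (γ + 1) belongs to a stage δ with γ < δ < β and
          -- is covered by the rays of that stage.
          · have hγ := hl.add_one_lt hγβ
            obtain ⟨z, hz1, hz2, hz3, hz4⟩ := (hxy β hi.1).exists_adj _ hγ
            obtain ⟨δ, hδ, hδ1, hδ2⟩ := h.exists_first_stage hi.1 hz3
            have hδ' := hδ.trans hi.1
            obtain ⟨j', hj', n', rfl⟩ := (hs δ hδ').cover z hz2 ⟨hδ1, hδ2⟩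
            refine ⟨δ, j', n', hδ', hj', Or.inl hδ, Or.inl (not_le.1 fun hle => hz4 ?_), hz1.symm,
              hz2⟩
            exact h.mono (add_le_add_left hle 1) (hγ.trans hi.1) hδ1
        · obtain ⟨j', hj', n', -, h1, h2⟩ := hsβ.limit i hi.2 0 (pos_iff_ne_zero.2 hi0) 0
          exact ⟨β, j', n', hi.1, hj'.le.trans hi.2, Or.inr ⟨rfl, hj'⟩, Or.inl hγβ, h1, h2⟩
      · obtain ⟨j', hj', n', h0, h1, h2⟩ := hsβ.limit i hi.2 j hji n
        exact ⟨γ, j', n', hi.1, hj'.le.trans hi.2, Or.inr ⟨rfl, hj'⟩, Or.inr ⟨rfl, h0⟩, h1, h2⟩)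
  refine ⟨P, fun a ha => ?_, hPA⟩
  rw [hP]
  obtain ⟨α, hα, haα⟩ := hcov a ha
  obtain ⟨β, hβ, hβ'⟩ := h.exists_first_stage hα haα
  obtain ⟨i, hi, n, hn⟩ := (hs β (hβ.trans hα)).cover a ha hβ'
  exact ⟨toLex (β, i), ⟨hβ.trans hα, hi⟩, n, hn⟩

end Concatenation

theorem lemma3p6 {V : Type u} (G : SimpleGraph V) (label : V ↪ ZFSet.{u})
    (κ : Cardinal.{u}) (hκ : ℵ₀ ≤ κ) (A : Set V) (hA : #A = κ)
    (h₁ : Unseparable G κ A)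
    (h₂ : ℵ₀ < κ → ManyDisjointPaths G κ A)
    (h₃ : ℵ₀ < κ → ∃ (Θ : Cardinal.{u}) (M : Ordinal.{u} → ZFSet.{u}),
      IsNiceChain κ {codeSet label A, codeGraph label G} Θ M ∧
      (∀ a ∈ A, ∃ α < κ.ord.cof.ord, label a ∈ M α) ∧
      ∀ β < κ.ord.cof.ord, ∃ x ∈ A, ∃ y : V, label x ∉ M β ∧ label y ∉ M β ∧ G.Adj x y ∧
        ∀ α < β, {z | G.Adj y z ∧ z ∈ A ∧ label z ∈ M β ∧ label z ∉ M α}.Infinite) :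
    ∃ P : TransfinitePath G, A ⊆ P.verts ∧ P.ConcentratedOn A := by
  rcases hκ.eq_or_lt with rfl | hlt
  · exact h₁.exists_path_of_countable hA
  obtain ⟨Θ, M, hM, hcov, hedge⟩ := h₃ hlt
  have hstage : ∀ β, ∃ x y, β < κ.ord.cof.ord → IsStageEdge G label A M β x y := by
    intro β
    by_cases hβ : β < κ.ord.cof.ord
    · obtain ⟨x, hx, y, h1, h2, h3, h4⟩ := hedge β hβ
      obtain ⟨x', y', h⟩ := hM.exists_isStageEdge hA hlt hβ hx h1 h2 h3 h4
      exact ⟨x', y', fun _ => h⟩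
    · obtain ⟨a⟩ := Cardinal.mk_ne_zero_iff.1 (hA ▸ (aleph0_pos.trans hlt).ne')
      exact ⟨a, a, fun h => absurd h hβ⟩
  choose x y hxy using hstage
  have hrays : ∀ β, ∃ (τ : Ordinal.{u}) (s : Ordinal.{u} → ℕ → V), β < κ.ord.cof.ord →
      IsRaySystem G A (stageSet label M β) (y β) {z | G.Adj (y (β + 1)) z ∧ z ∈ A} τ s := by
    intro β
    by_cases hβ : β < κ.ord.cof.ord
    · obtain ⟨τ, s, hs⟩ := hM.exists_raySystem hlt h₁ (h₂ hlt) hxy hβ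
      exact ⟨τ, s, fun _ => hs⟩
    · exact ⟨0, fun _ _ => y β, fun h => absurd h hβ⟩
  choose τ s hs using hrays
  exact hM.exists_path_of_raySystems hcov hxy τ s hs
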